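/- **Setting.** On $\boldsymbol Y_5=\mathbf C^5$ with coordinates $(y_{13},y_{14},y_{24},y_{25},y_{35})$, let $\zeta_1,\dots,\zeta_5$ be the coordinates and $\zeta_{6},\dots,\zeta_{10}$ be $P_1=1+y_{25}-y_{24}y_{35}$, $P_2=1+y_{13}-y_{35}y_{14}$, $P_3=1+y_{24}-y_{14}y_{25}$, $P_4=1+y_{35}-y_{13}y_{25}$, $P_5=1+y_{14}-y_{13}y_{24}$; set $\boldsymbol Y_5^*=\{\zeta_1\cdots\zeta_{10}\neq 0\}$. The web $\boldsymbol{\mathcal W}^{GM}_{\boldsymbol Y_5}$ is the 10-web of codimension 2 with first integrals $U_l=(U_{l,1},U_{l,2})$, $l=1,\dots,10$: $$\begin{aligned} &U_1=(y_{25},\,y_{24}y_{35}),\quad U_2=\Big(\tfrac1{y_{13}},\tfrac{y_{14}y_{35}}{y_{13}}\Big),\quad U_3=(y_{24},\,y_{14}y_{25}),\quad U_4=\Big(\tfrac1{y_{35}},\tfrac{y_{13}y_{25}}{y_{35}}\Big),\quad U_5=(y_{14},\,y_{13}y_{24}),\\ &U_6=\Big(\tfrac{P_2}{y_{14}P_4},\tfrac{y_{13}P_3}{y_{14}P_4}\Big),\quad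 U_7=\Big(\tfrac{P_1}{y_{24}P_4},\tfrac{P_3}{y_{24}P_4}\Big),\quad U_8=\Big(\tfrac{y_{13}P_1}{P_4},\tfrac{P_2}{P_4}\Big),\\ &U_9=\Big(\tfrac{y_{14}P_1}{P_3},\tfrac{y_{24}P_2}{P_3}\Big),\quad U_{10}=\Big(\tfrac{P_1}{y_{35}P_3},\tfrac{y_{25}P_2}{y_{35}P_3}\Big), \end{aligned}$$ and $U_{l,3}=1+U_{l,1}-U_{l,2}$. Every $U_{l,s}$ ($s=1,2,3$) is a product of integral powers of the $\zeta_k$. For $i\in\{1,\dots,5\}$ put $i^*=i+5$. Let $D\subset\boldsymbol Y_5^*$ be a non-empty connected open set on which holomorphic determinations of the ${\rm Log}\,\zeta_k$ are given; they induce determinations of the ${\rm Log}\,U_{l,s}=\sum_k\nu_{\zeta_k}(U_{l,s})\,{\rm Log}\,\zeta_k$, where $\nu_F$ is the valuation of $\mathbf C(y)$ along $\{F=0\}$. A $0$-abelian relation (0-AR) on $D$ is a tuple $(f_l)_{l=1}^{10}$ of holomorphic functions with $f_l$ basic for $U_l$ ($df_l$ vanishes on $\ker dU_l$) and $\sum_l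 f_l=0$; $\boldsymbol{AR}^0$ is the space of these modulo tuples of constants. A $1$-AR is a tuple $(\eta_l)$, $\eta_l=g_{l,1}dU_{l,1}+g_{l,2}dU_{l,2}$ with $g_{l,s}$ holomorphic and basic for $U_l$, such that $\sum_l\eta_l=0$; these form $\boldsymbol{AR}^1$. Let $d^0(f_l)_l=(df_l)_l$. The space $W_w(\boldsymbol{AR}^0)$ of 0-ARs of weight $w$ consists of those whose $l$-th component is, for every $l$, a homogeneous polynomial of degree $w$ in the three functions ${\rm Log}\,U_{l,s}$; $W_w(\boldsymbol{AR}^1)$ consists of the 1-ARs whose components are of the form $\sum_s P_{l,s}({\rm Log}\,U_{l,1},{\rm Log}\,U_{l,2},{\rm Log}\,U_{l,3})\,d\,{\rm Log}\,U_{l,s}$ with $P_{l,s}$ homogeneous of degree $w$. For $i<j<k$ in $\{1,\dots,5\}$, ${\bf AR}^1_{ijk}$ denotes a non-zero 1-AR, supported on the indices $l\in\{i,j,k,i^*,j^*,k^*\}$, with components $\sum_{1\le a<b\le 3}c_l^{a,b}\,d({\rm Log}\,U_{l,a}{\rm Log}\,U_{l,b})$, $c_l^{a,b}\in\{-1,0,1\}$;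 $\boldsymbol{AR}^1_{Sym}$ is the span of all of them. The Weyl group $W_{D_5}=\langle s_1,\dots,s_5\rangle$ (Dynkin diagram with edges $12,23,34,35$) acts birationally on $\boldsymbol Y_5$ and regularly on $\boldsymbol Y^*_5$, $s_k$ acting by the involution $\sigma_k$: $$\begin{aligned} \sigma_1(y)&=\Big(\tfrac1{y_{25}},-y_{24}y_{13},-y_{14}y_{25},\tfrac1{y_{13}},-\tfrac{y_{35}}{y_{13}y_{25}}\Big),& \sigma_2(y)&=\Big(\tfrac1{y_{24}},-\tfrac{y_{14}}{y_{24}y_{13}},\tfrac1{y_{13}},-y_{35}y_{24},-y_{13}y_{25}\Big),\\ \sigma_3(y)&=\Big(-y_{14}y_{35},-y_{24}y_{13},\tfrac1{y_{35}},-\tfrac{y_{25}}{y_{35}y_{24}},\tfrac1{y_{24}}\Big),& \sigma_4(y)&=\Big(-\tfrac{y_{13}}{y_{35}y_{14}},\tfrac1{y_{35}},-y_{14}y_{25},-y_{24}y_{35},\tfrac1{y_{14}}\Big),\\ \sigma_5(y)&=\Big(-P_2,\,y_{14}\tfrac{P_1}{P_3},-\tfrac{y_{24}}{P_3},-\tfrac{y_{25}}{P_1},\,y_{35}\tfrac{P_3}{P_1}\Big).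 \end{aligned}$$ These maps permute the ten foliations: $\sigma_k$ ($k\le4$) exchanges the indices $k\leftrightarrow k+1$ and $k^*\leftrightarrow (k+1)^*$, and $\sigma_5$ exchanges $4\leftrightarrow 5^*$ and $5\leftrightarrow 4^*$. They act by pull-back on ARs of a given weight, the pull-back of multivalued ARs being computed on the global real-analytic versions, where ${\rm Log}\,U_{l,s}$ is replaced by $\log|U_{l,s}|$ in the functions and in the coefficients of the 1-forms. For an unordered pair of distinct partitions of total size 5, $V_{[\lambda,\mu]}$ is the corresponding irreducible representation of $W_{D_5}$, realised as the span in $\mathbf C[x_1,\dots,x_5]$ of the Specht polynomials of bitableaux of shape $(\lambda,\mu)$ (the product of the $x_p^2-x_q^2$ for $p$ above $q$ in the same column, times the product of the variables $x_p$ with $p$ in the $\mu$-part), where $s_k$, $k\le 4$, exchanges $x_k$ and $x_{k+1}$, and $s_5$ is $x_4\mapsto -x_5$, $x_5\mapsto -x_4$. The residue along $\{\zeta_k=0\}$ is given by ${\bf Res}_{\zeta_k}({\rm Log}V_1{\rm Log}V_2)=\nu_{\zeta_k}(V_1){\rm Log}V_2+\nu_{\zeta_k}(V_2){\rm Log}V_1$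 and ${\bf Res}_{\zeta_k}({\rm Log}V_1\,d{\rm Log}V_2)=\nu_{\zeta_k}(V_1)\,d{\rm Log}V_2$, componentwise. **Proposition.** **1.** One has $\boldsymbol{AR}^0=W_1(\boldsymbol{AR}^0)\oplus W_2(\boldsymbol{AR}^0)$, with summands of dimensions $20$ and $5$. Pull-back by the $\sigma_k$ makes $W_1(\boldsymbol{AR}^0)$, $W_2(\boldsymbol{AR}^0)$, $W_0(\boldsymbol{AR}^1)$ and $\boldsymbol{AR}^1_{Sym}$ into representations of $W_{D_5}$. The map $d^0$ is injective on $\boldsymbol{AR}^0$ and induces isomorphisms of $W_{D_5}$-representations $$W_1(\boldsymbol{AR}^0)\simeq W_0(\boldsymbol{AR}^1)\simeq V^{20}_{[2,21]},\qquad W_2(\boldsymbol{AR}^0)\simeq\boldsymbol{AR}^1_{Sym}\simeq V^{5}_{[-,221]}.$$ **2.** Every 3-subweb of $\boldsymbol{\mathcal W}^{GM}_{\boldsymbol Y_5}$ has 0-rank (dimension of its space of 0-ARs modulo constants) at most $1$. The 3-subwebs of 0-rank 1 are exactly $\boldsymbol{\mathcal W}_{ijk}$, $\boldsymbol{\mathcal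 W}_{ijk^*}$, $\boldsymbol{\mathcal W}_{ij^*k^*}$, $\boldsymbol{\mathcal W}_{i^*j^*k^*}$ with $i,j,k\in\{1,\dots,5\}$ pairwise distinct; there are 80 of them. Their 0-ARs all have weight 1, and they span $W_1(\boldsymbol{AR}^0)$. **3.** For all $1\le i<j<k\le5$, the 1-AR ${\bf AR}^1_{ijk}$ exists, is unique up to sign, and is exact: it is $d^0$ of a 0-AR ${\bf AR}^0_{ijk}$ given by a functional identity, unique up to sign, of the form $$\sum_{l\in\{i,j,k,i^*,j^*,k^*\}}\ \sum_{1\le a<b\le3}c_l^{a,b}\,{\rm Log}\,U_{l,a}\,{\rm Log}\,U_{l,b}=0,\qquad c_l^{a,b}\in\{-1,0,1\}\text{ not all zero}.$$ The ten ${\bf AR}^0_{ijk}$ span $W_2(\boldsymbol{AR}^0)$. The residues ${\bf Res}_{\zeta_\ell}({\bf AR}^0_{ijk})$ ($\ell=1,\dots,10$, $1\le i<j<k\le5$) are 0-ARs and span $W_1(\boldsymbol{AR}^0)$; correspondingly, the residues ${\bf Res}_{\zeta_\ell}({\bf AR}^1_{ijk})$ span $d^0(W_1(\boldsymbol{AR}^0))$.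 -/

import Mathlib

namespace GMWeb

open MvPolynomial

noncomputable section

/-! ### The affine space `Y₅ = ℂ⁵`, its ten special polynomials and the ten first integrals -/

/-- The affine space `Y₅ = ℂ⁵`, with coordinates
`(y 0, y 1, y 2, y 3, y 4) = (y₁₃, y₁₄, y₂₄, y₂₅, y₃₅)`. -/
abbrev C5 : Type := Fin 5 → ℂ

/-- The polynomials `ζ₁, …, ζ₁₀`: the five coordinates, then the five sub-pfaffians `P₁, …, P₅`. -/
def zetaPoly : Fin 10 → MvPolynomial (Fin 5) ℂ :=
  ![X 0, X 1, X 2, X 3, X 4,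
    1 + X 3 - X 2 * X 4,
    1 + X 0 - X 4 * X 1,
    1 + X 2 - X 1 * X 3,
    1 + X 4 - X 0 * X 3,
    1 + X 1 - X 0 * X 2]

/-- `ζ_k` as a function on `ℂ⁵`. -/
def zeta (k : Fin 10) (y : C5) : ℂ := eval y (zetaPoly k)

/-- `Y₅* = ℂ⁵ \ {ζ₁ ⋯ ζ₁₀ = 0}`. -/
def Ystar : Set C5 := {y | ∀ k, zeta k y ≠ 0}

/-- The two components `(U_{l,1}, U_{l,2})` of the first integrals `U₁, …, U₁₀`
(all denominators are nonzero on `Y₅*`). -/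
def firstIntegral (y : C5) : Fin 10 → Fin 2 → ℂ :=
  let y13 := y 0
  let y14 := y 1
  let y24 := y 2
  let y25 := y 3
  let y35 := y 4
  ![![y25, y24 * y35],
    ![1 / y13, y14 * y35 / y13],
    ![y24, y14 * y25],
    ![1 / y35, y13 * y25 / y35],
    ![y14, y13 * y24],
    ![(y14 * y35 - y13 - 1) / (y14 * (y13 * y25 - y35 - 1)),
      y13 * (y14 * y25 - y24 - 1) / (y14 * (y13 * y25 - y35 - 1))],
    ![(y24 * y35 - y25 - 1) / (y24 * (y13 * y25 - y35 - 1)),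
      (y14 * y25 - y24 - 1) / (y24 * (y13 * y25 - y35 - 1))],
    ![y13 * (y24 * y35 - y25 - 1) / (y13 * y25 - y35 - 1),
      (y14 * y35 - y13 - 1) / (y13 * y25 - y35 - 1)],
    ![y14 * (y24 * y35 - y25 - 1) / (y14 * y25 - y24 - 1),
      y24 * (y14 * y35 - y13 - 1) / (y14 * y25 - y24 - 1)],
    ![(y24 * y35 - y25 - 1) / (y35 * (y14 * y25 - y24 - 1)),
      y25 * (y14 * y35 - y13 - 1) / (y35 * (y14 * y25 - y24 - 1))]]

/-- `U_{l,s}` for `s = 1, 2, 3`, the third one being `U_{l,3} = 1 + U_{l,1} - U_{l,2}`. -/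
def U (l : Fin 10) (s : Fin 3) (y : C5) : ℂ :=
  ![firstIntegral y l 0, firstIntegral y l 1,
    1 + firstIntegral y l 0 - firstIntegral y l 1] s

/-- The exponents in the factorisation `U_{l,s} = ∏ₖ ζ_k ^ (expo l s k)`, see `U_eq_prod`. -/
def expo : Fin 10 → Fin 3 → Fin 10 → ℤ :=
  ![![![0, 0, 0, 1, 0, 0, 0, 0, 0, 0], ![0, 0, 1, 0, 1, 0, 0, 0, 0, 0],
      ![0, 0, 0, 0, 0, 1, 0, 0, 0, 0]],
    ![![-1, 0, 0, 0, 0, 0, 0, 0, 0, 0], ![-1, 1, 0, 0, 1, 0, 0, 0, 0, 0],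
      ![-1, 0, 0, 0, 0, 0, 1, 0, 0, 0]],
    ![![0, 0, 1, 0, 0, 0, 0, 0, 0, 0], ![0, 1, 0, 1, 0, 0, 0, 0, 0, 0],
      ![0, 0, 0, 0, 0, 0, 0, 1, 0, 0]],
    ![![0, 0, 0, 0, -1, 0, 0, 0, 0, 0], ![1, 0, 0, 1, -1, 0, 0, 0, 0, 0],
      ![0, 0, 0, 0, -1, 0, 0, 0, 1, 0]],
    ![![0, 1, 0, 0, 0, 0, 0, 0, 0, 0], ![1, 0, 1, 0, 0, 0, 0, 0, 0, 0],
      ![0, 0, 0, 0, 0, 0, 0, 0, 0, 1]],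
    ![![0, -1, 0, 0, 0, 0, 1, 0, -1, 0], ![1, -1, 0, 0, 0, 0, 0, 1, -1, 0],
      ![0, -1, 0, 0, 0, 0, 0, 0, -1, 1]],
    ![![0, 0, -1, 0, 0, 1, 0, 0, -1, 0], ![0, 0, -1, 0, 0, 0, 0, 1, -1, 0],
      ![0, 0, -1, 1, 0, 0, 0, 0, -1, 1]],
    ![![1, 0, 0, 0, 0, 1, 0, 0, -1, 0], ![0, 0, 0, 0, 0, 0, 1, 0, -1, 0],
      ![0, 0, 0, 0, 1, 0, 0, 0, -1, 1]],
    ![![0, 1, 0, 0, 0, 1, 0, -1, 0, 0], ![0, 0, 1, 0, 0, 0, 1, -1, 0, 0],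
      ![0, 0, 0, 0, 0, 0, 0, -1, 0, 1]],
    ![![0, 0, 0, 0, -1, 1, 0, -1, 0, 0], ![0, 0, 0, 1, -1, 0, 1, -1, 0, 0],
      ![0, 0, 0, 0, -1, 0, 0, -1, 1, 0]]]

/-- On `Y₅*`, every `U_{l,s}` is a product of integral powers of the `ζ_k`. -/
theorem U_eq_prod {y : C5} (hy : y ∈ Ystar) (l : Fin 10) (s : Fin 3) :
    U l s y = ∏ k, zeta k y ^ expo l s k := by
  have h (k : Fin 10) : eval y (zetaPoly k) ≠ 0 := hy k
  have h0 := h 0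
  have h1 := h 1
  have h2 := h 2
  have h3 := h 3
  have h4 := h 4
  have h7 := h 7
  have h8 := h 8
  simp [zetaPoly] at h0 h1 h2 h3 h4 h7 h8
  obtain ⟨p, hp⟩ : ∃ p, p = 1 + y 2 - y 1 * y 3 := ⟨_, rfl⟩
  obtain ⟨q, hq⟩ : ∃ q, q = 1 + y 4 - y 0 * y 3 := ⟨_, rfl⟩
  have gp : y 1 * y 3 - y 2 - 1 = -p := by rw [hp]; ring
  have gq : y 0 * y 3 - y 4 - 1 = -q := by rw [hq]; ring
  rw [← hp] at h7
  rw [← hq] at h8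
  fin_cases l <;> fin_cases s <;>
    simp [U, firstIntegral, expo, zeta, zetaPoly, Fin.prod_univ_succ, gp, gq, ← hp, ← hq] <;>
    field_simp <;> (try rw [hp]) <;> (try rw [hq]) <;> ring

/-! ### Determinations of the logarithms -/

/-- `L` is a system of holomorphic determinations of `Log ζ₁, …, Log ζ₁₀` on `D`. -/
def IsLogDet (D : Set C5) (L : Fin 10 → C5 → ℂ) : Prop :=
  ∀ k, AnalyticOnNhd ℂ (L k) D ∧ ∀ y ∈ D, Complex.exp (L k y) = zeta k y

/-- The determination of `Log U_{l,s}` induced by determinations `L k` of the `Log ζ_k`. -/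
def logU (L : Fin 10 → C5 → ℂ) (l : Fin 10) (s : Fin 3) (y : C5) : ℂ :=
  ∑ k, (expo l s k : ℂ) * L k y

/-- `logU` is indeed a logarithm of `U_{l,s}`. -/
theorem exp_logU {D : Set C5} {L : Fin 10 → C5 → ℂ} (hL : IsLogDet D L) {y : C5} (hy : y ∈ D)
    (l : Fin 10) (s : Fin 3) : Complex.exp (logU L l s y) = U l s y := by
  have hY : y ∈ Ystar := fun k => by
    rw [← (hL k).2 y hy]; exact Complex.exp_ne_zero _
  rw [U_eq_prod hY, logU, Complex.exp_sum]
  exact Finset.prod_congr rfl fun k _ => by rw [Complex.exp_int_mul, (hL k).2 y hy]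

/-- The real-analytic logarithm `log |U_{l,s}|`, globally defined on `Y₅*`. -/
def absLogU (l : Fin 10) (s : Fin 3) (y : C5) : ℂ := (Real.log ‖U l s y‖ : ℂ)

/-- The holomorphic logarithmic differential `d Log U_{l,s} = d U_{l,s} / U_{l,s}`. -/
def dlogU (l : Fin 10) (s : Fin 3) (y : C5) : C5 →L[ℂ] ℂ :=
  (U l s y)⁻¹ • fderiv ℂ (U l s) y

/-! ### 0-abelian relations and 1-abelian relations on a domain `D` -/

open TopologicalSpace (Opens)

/-- `f` is a holomorphic function on `D` which is basic for the foliation defined by `U_l`: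
its differential vanishes on the tangent spaces `ker dU_l` of the leaves. -/
def IsBasic (D : Opens C5) (l : Fin 10) (f : C5 → ℂ) : Prop :=
  AnalyticOnNhd ℂ f D ∧ ∀ y ∈ D, ∀ v : C5,
    fderiv ℂ (U l 0) y v = 0 → fderiv ℂ (U l 1) y v = 0 → fderiv ℂ f y v = 0

theorem IsBasic.zero (D : Opens C5) (l : Fin 10) : IsBasic D l 0 :=
  ⟨analyticOnNhd_const (v := (0 : ℂ)), fun y _ v _ _ => by
    have : fderiv ℂ (0 : C5 → ℂ) y = 0 := fderiv_const_apply (0 : ℂ)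
    rw [this]; rfl⟩

theorem IsBasic.add {D : Opens C5} {l : Fin 10} {f g : C5 → ℂ} (hf : IsBasic D l f)
    (hg : IsBasic D l g) : IsBasic D l (f + g) := by
  refine ⟨hf.1.add hg.1, fun y hy v h0 h1 => ?_⟩
  have : fderiv ℂ (f + g) y = fderiv ℂ f y + fderiv ℂ g y :=
    fderiv_add (hf.1 y hy).differentiableAt (hg.1 y hy).differentiableAt
  rw [this, add_apply, hf.2 y hy v h0 h1, hg.2 y hy v h0 h1, add_zero]

theorem IsBasic.smul {D : Opens C5} {l : Fin 10} {f : C5 → ℂ} (hf : IsBasic D l f) (c : ℂ) :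
    IsBasic D l (c • f) := by
  refine ⟨(analyticOnNhd_const (v := c)).smul hf.1, fun y hy v h0 h1 => ?_⟩
  have : fderiv ℂ (c • f) y = c • fderiv ℂ f y :=
    fderiv_const_smul (hf.1 y hy).differentiableAt c
  rw [this, smul_apply, hf.2 y hy v h0 h1, smul_zero]

/-- The 10-tuples `(f_l)` of functions, with `f_l` basic for `U_l` on `D` and `∑ f_l = 0` on `D`
(the values of the `f_l` outside `D` are irrelevant). -/
def Z0 (D : Opens C5) : Submodule ℂ (Fin 10 → C5 → ℂ) where
  carrier := {f | (∀ l, IsBasic D l (f l)) ∧ ∀ y ∈ D, ∑ l, f l y = 0}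
  zero_mem' := ⟨fun l => IsBasic.zero D l, fun y _ => by simp⟩
  add_mem' := fun {f g} hf hg => ⟨fun l => (hf.1 l).add (hg.1 l), fun y hy => by
    simp only [Pi.add_apply, Finset.sum_add_distrib, hf.2 y hy, hg.2 y hy, add_zero]⟩
  smul_mem' := fun c f hf => ⟨fun l => (hf.1 l).smul c, fun y hy => by
    simp only [Pi.smul_apply, ← Finset.smul_sum, hf.2 y hy, smul_zero]⟩

/-- The trivial relations: all the `f_l` are constant on `D`. -/
def K0 (D : Opens C5) : Submodule ℂ (Z0 D) where
  carrier := {f | ∀ l, ∃ c : ℂ, ∀ y ∈ D, (f : Fin 10 → C5 → ℂ) l y = c}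
  zero_mem' := fun _ => ⟨0, fun _ _ => rfl⟩
  add_mem' := fun hf hg l => by
    obtain ⟨a, ha⟩ := hf l
    obtain ⟨b, hb⟩ := hg l
    exact ⟨a + b, fun y hy => by simp [ha y hy, hb y hy]⟩
  smul_mem' := fun c f hf l => by
    obtain ⟨a, ha⟩ := hf l
    exact ⟨c * a, fun y hy => by simp [ha y hy]⟩

/-- The space `AR⁰` of 0-abelian relations on `D`; as usual, functions are taken
up to additive constants. -/
abbrev AR0 (D : Opens C5) : Type := Z0 D ⧸ K0 D

/-- 10-tuples of 1-forms on `D`. -/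
abbrev Forms (D : Opens C5) : Type := Fin 10 → D → (C5 →L[ℂ] ℂ)

/-- The componentwise total derivative on tuples of functions. -/
def dZ (D : Opens C5) : Z0 D →ₗ[ℂ] Forms D where
  toFun f := fun l y => fderiv ℂ ((f : Fin 10 → C5 → ℂ) l) y
  map_add' f g := by
    funext l y
    exact fderiv_add ((f.2.1 l).1 y y.2).differentiableAt ((g.2.1 l).1 y y.2).differentiableAt
  map_smul' c f := by
    funext l y
    exact fderiv_const_smul ((f.2.1 l).1 y y.2).differentiableAt c

theorem K0_le_ker (D : Opens C5) : K0 D ≤ LinearMap.ker (dZ D) := by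
  intro f hf
  rw [LinearMap.mem_ker]
  funext l y
  obtain ⟨c, hc⟩ := hf l
  have h : (f : Fin 10 → C5 → ℂ) l =ᶠ[nhds (y : C5)] fun _ => c :=
    Filter.eventuallyEq_of_mem (D.isOpen.mem_nhds y.2) hc
  exact h.fderiv_eq.trans (fderiv_const_apply c)

/-- The differential `d⁰ : (f_l) ↦ (d f_l)`. -/
def d0 (D : Opens C5) : AR0 D →ₗ[ℂ] Forms D := (K0 D).liftQ (dZ D) (K0_le_ker D)

/-- The space `AR¹` of 1-abelian relations on `D`: tuples `(η_l)` with `∑ η_l = 0`, where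
`η_l = g₁ dU_{l,1} + g₂ dU_{l,2}` with `g₁, g₂` holomorphic and basic for `U_l`. -/
def AR1 (D : Opens C5) : Submodule ℂ (Forms D) where
  carrier := {η | (∀ l, ∃ g₁ g₂ : C5 → ℂ, IsBasic D l g₁ ∧ IsBasic D l g₂ ∧
      ∀ y : D, η l y = g₁ y • fderiv ℂ (U l 0) y + g₂ y • fderiv ℂ (U l 1) y) ∧
    ∑ l, η l = 0}
  zero_mem' := ⟨fun l => ⟨0, 0, IsBasic.zero D l, IsBasic.zero D l, fun y => by
    ext v; simp⟩, by simp⟩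
  add_mem' := fun {η θ} hη hθ => ⟨fun l => by
    obtain ⟨a, b, ha, hb, h⟩ := hη.1 l
    obtain ⟨a', b', ha', hb', h'⟩ := hθ.1 l
    refine ⟨a + a', b + b', ha.add ha', hb.add hb', fun y => ?_⟩
    rw [Pi.add_apply, Pi.add_apply, h y, h' y]
    ext v
    simp only [add_apply, smul_apply, Pi.add_apply, smul_eq_mul]
    ring, by simp only [Pi.add_apply, Finset.sum_add_distrib, hη.2, hθ.2, add_zero]⟩
  smul_mem' := fun c η hη => ⟨fun l => by
    obtain ⟨a, b, ha, hb, h⟩ := hη.1 l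
    refine ⟨c • a, c • b, ha.smul c, hb.smul c, fun y => ?_⟩
    simp only [Pi.smul_apply, h y, smul_add, smul_assoc],
    by simp only [Pi.smul_apply, ← Finset.smul_sum, hη.2, smul_zero]⟩

/-! ### Weights -/

/-- The tuple `(Q_l(Log U_{l,1}, Log U_{l,2}, Log U_{l,3}))_l`. -/
def logFun (L : Fin 10 → C5 → ℂ) (Q : Fin 10 → MvPolynomial (Fin 3) ℂ) : Fin 10 → C5 → ℂ :=
  fun l y => eval (fun s => logU L l s y) (Q l)

/-- The tuple of 1-forms `(∑ₛ P_{l,s}(Log U_{l,1}, Log U_{l,2}, Log U_{l,3}) d Log U_{l,s})_l`. -/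
def logForm (D : Opens C5) (L : Fin 10 → C5 → ℂ) (P : Fin 10 → Fin 3 → MvPolynomial (Fin 3) ℂ) :
    Forms D :=
  fun l y => ∑ s, eval (fun t => logU L l t y) (P l s) • dlogU l s y

/-- `x` is the 0-abelian relation given by the identity `∑ Q_l(Log U_l) = 0`. -/
def IsLogClass (D : Opens C5) (L : Fin 10 → C5 → ℂ) (Q : Fin 10 → MvPolynomial (Fin 3) ℂ)
    (x : AR0 D) : Prop :=
  ∃ h : logFun L Q ∈ Z0 D, x = (K0 D).mkQ ⟨logFun L Q, h⟩

/-- The space `W_w(AR⁰)` of 0-abelian relations of weight `w`: each component is a homogeneous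
polynomial of degree `w` in the logarithms `Log U_{l,1}, Log U_{l,2}, Log U_{l,3}`. -/
def WAR0 (D : Opens C5) (L : Fin 10 → C5 → ℂ) (w : ℕ) : Submodule ℂ (AR0 D) :=
  Submodule.span ℂ {x | ∃ Q, (∀ l, (Q l).IsHomogeneous w) ∧ IsLogClass D L Q x}

/-- The space `W_w(AR¹)` of 1-abelian relations of weight `w`: each component is of the form
`∑ₛ P_{l,s}(Log U_l) d Log U_{l,s}` with `P_{l,s}` homogeneous of degree `w`. -/
def WAR1 (D : Opens C5) (L : Fin 10 → C5 → ℂ) (w : ℕ) : Submodule ℂ (Forms D) :=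
  Submodule.span ℂ {η | η ∈ AR1 D ∧ ∃ P, (∀ l s, (P l s).IsHomogeneous w) ∧ η = logForm D L P}

/-! ### Subwebs -/

/-- The index in `{1, …, 5}` underlying `l`: both `i` and `i* = i + 5` have underlying index `i`. -/
def base (l : Fin 10) : Fin 5 := ⟨l % 5, Nat.mod_lt _ (by norm_num)⟩

/-- The 0-abelian relations of the subweb `W(U_l, l ∈ S)`. -/
def subAR0 (D : Opens C5) (S : Finset (Fin 10)) : Submodule ℂ (AR0 D) :=
  Submodule.span ℂ {x | ∃ f : Z0 D, (∀ l ∉ S, ∀ y ∈ D, (f : Fin 10 → C5 → ℂ) l y = 0) ∧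
    x = (K0 D).mkQ f}

/-- The ten triples `{i < j < k}` in `{1, …, 5}`. -/
abbrev Triple : Type := {t : Finset (Fin 5) // t.card = 3}

/-- The three pairs `a < b` in `{1, 2, 3}`. -/
abbrev Pair : Type := {p : Fin 3 × Fin 3 // p.1 < p.2}

/-- `∑_{a<b} c_l^{a,b} X_a X_b`. -/
def quad (c : Fin 10 → Pair → ℤ) (l : Fin 10) : MvPolynomial (Fin 3) ℂ :=
  ∑ p : Pair, C (c l p : ℂ) * (X p.1.1 * X p.1.2)

/-- The coefficients of `d(∑_{a<b} c_l^{a,b} Log U_{l,a} Log U_{l,b})`. -/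
def dquad (c : Fin 10 → Pair → ℤ) (l : Fin 10) (s : Fin 3) : MvPolynomial (Fin 3) ℂ :=
  pderiv s (quad c l)

/-- Nonzero systems of coefficients in `{-1, 0, 1}`, supported on the six indices
`i, j, k, i*, j*, k*`. -/
def IsCoeff (t : Triple) (c : Fin 10 → Pair → ℤ) : Prop :=
  c ≠ 0 ∧ (∀ l p, c l p = -1 ∨ c l p = 0 ∨ c l p = 1) ∧ ∀ l, base l ∉ t.1 → c l = 0

/-- `c` is a system of coefficients of the 1-abelian relation `AR¹_{ijk}` of the 6-subweb
`W_{ijki*j*k*}`, with components `∑_{a<b} c_l^{a,b} d(Log U_{l,a} Log U_{l,b})`. -/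
def IsAR1ijk (D : Opens C5) (L : Fin 10 → C5 → ℂ) (t : Triple) (c : Fin 10 → Pair → ℤ) : Prop :=
  IsCoeff t c ∧ logForm D L (dquad c) ∈ AR1 D

/-- `c` is the system of coefficients of a functional identity
`∑_l ∑_{a<b} c_l^{a,b} Log U_{l,a} Log U_{l,b} = 0`, `l ∈ {i, j, k, i*, j*, k*}`. -/
def IsIdentity (D : Opens C5) (L : Fin 10 → C5 → ℂ) (t : Triple) (c : Fin 10 → Pair → ℤ) : Prop :=
  IsCoeff t c ∧ ∀ y ∈ D, ∑ l, ∑ p : Pair,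
    (c l p : ℂ) * (logU L l p.1.1 y * logU L l p.1.2 y) = 0

/-- The space `AR¹_Sym` spanned by the `AR¹_{ijk}`. -/
def AR1Sym (D : Opens C5) (L : Fin 10 → C5 → ℂ) : Submodule ℂ (Forms D) :=
  Submodule.span ℂ {η | ∃ t c, IsAR1ijk D L t c ∧ η = logForm D L (dquad c)}

/-! ### Residues -/

/-- The rational function `V` has order `n` along the hypersurface `{F = 0}`:
`V = Fⁿ p / q` with `p, q` polynomials not divisible by `F`. -/
def IsOrd (F : MvPolynomial (Fin 5) ℂ) (V : C5 → ℂ) (n : ℤ) : Prop :=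
  ∃ p q : MvPolynomial (Fin 5) ℂ, ¬ F ∣ p ∧ ¬ F ∣ q ∧
    ∀ y, eval y F ≠ 0 → eval y q ≠ 0 → V y = eval y F ^ n * (eval y p / eval y q)

/-- The valuation `ν_F(V)`. -/
def ord (F : MvPolynomial (Fin 5) ℂ) (V : C5 → ℂ) : ℤ := Classical.epsilon (IsOrd F V)

/-- The residue along `{ζ_k = 0}`, on polynomials in the logarithms: the derivation sending
`Log U_{l,s}` to `ν_{ζ_k}(U_{l,s})`. On products of two logarithms it is
`Log V₁ Log V₂ ↦ ν(V₁) Log V₂ + ν(V₂) Log V₁`. -/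
def res (k : Fin 10) (Q : Fin 10 → MvPolynomial (Fin 3) ℂ) (l : Fin 10) :
    MvPolynomial (Fin 3) ℂ :=
  ∑ s, C (ord (zetaPoly k) (U l s) : ℂ) * pderiv s (Q l)

/-- The residue along `{ζ_k = 0}` of logarithmic 1-forms:
`Log V₁ d Log V₂ ↦ ν(V₁) d Log V₂`. -/
def resForm (k : Fin 10) (P : Fin 10 → Fin 3 → MvPolynomial (Fin 3) ℂ) (l : Fin 10) (s : Fin 3) :
    MvPolynomial (Fin 3) ℂ :=
  ∑ t, C (ord (zetaPoly k) (U l t) : ℂ) * pderiv t (P l s)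

/-! ### The Weyl group of type `D₅` and its birational action on `Y₅` -/

/-- The Coxeter matrix of type `D₅`, for the Dynkin diagram with edges 1–2, 2–3, 3–4, 3–5. -/
def D5 : CoxeterMatrix (Fin 5) where
  M := !![1, 3, 2, 2, 2;
          3, 1, 3, 2, 2;
          2, 3, 1, 3, 3;
          2, 2, 3, 1, 2;
          2, 2, 3, 2, 1]
  isSymm := by ext i j; fin_cases i <;> fin_cases j <;> rfl
  diagonal := by intro i; fin_cases i <;> rfl
  off_diagonal := by
    intro i j h; fin_cases i <;> fin_cases j <;> first | exact absurd rfl h | decide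

/-- The Weyl group `W(D₅)`. -/
abbrev WD5 : Type := D5.Group

/-- The Cremona involutions `σ₁, …, σ₅` by which the generators `s₁, …, s₅` of `W(D₅)` act
(all denominators are nonzero on `Y₅*`). -/
def sigma (k : Fin 5) (y : C5) : C5 :=
  let y13 := y 0
  let y14 := y 1
  let y24 := y 2
  let y25 := y 3
  let y35 := y 4
  let P1 := zeta 5 y
  let P2 := zeta 6 y
  let P3 := zeta 7 y
  ![![1 / y25, -(y24 * y13), -(y14 * y25), 1 / y13, -(y35 / (y13 * y25))],
    ![1 / y24, -(y14 / (y24 * y13)), 1 / y13, -(y35 * y24), -(y13 * y25)],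
    ![-(y14 * y35), -(y24 * y13), 1 / y35, -(y25 / (y35 * y24)), 1 / y24],
    ![-(y13 / (y35 * y14)), 1 / y35, -(y14 * y25), -(y24 * y35), 1 / y14],
    ![-P2, y14 * (P1 / P3), -(y24 / P3), -(y25 / P1), y35 * (P3 / P1)]] k

/-- The permutation of the ten foliations induced by `σ_k`: the pull-back by `σ_k` of the foliation
defined by `U_l` is the foliation defined by `U_{foliationPerm k l}`. -/
def foliationPerm : Fin 5 → Equiv.Perm (Fin 10) :=
  ![Equiv.swap 0 1 * Equiv.swap 5 6,
    Equiv.swap 1 2 * Equiv.swap 6 7,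
    Equiv.swap 2 3 * Equiv.swap 7 8,
    Equiv.swap 3 4 * Equiv.swap 8 9,
    Equiv.swap 3 9 * Equiv.swap 4 8]

/-- The real-analytic version, global on `Y₅*`, of `logFun`: `Log U` is replaced by `log |U|`. -/
def absLogFun (Q : Fin 10 → MvPolynomial (Fin 3) ℂ) (l : Fin 10) (y : C5) : ℂ :=
  eval (fun s => absLogU l s y) (Q l)

/-- The real-analytic version, global on `Y₅*`, of `logForm`. -/
def absLogForm (P : Fin 10 → Fin 3 → MvPolynomial (Fin 3) ℂ) (l : Fin 10) (y : C5) :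
    C5 →L[ℂ] ℂ :=
  ∑ s, eval (fun t => absLogU l t y) (P l s) • dlogU l s y

/-- `x' = σ_k^* x`, for 0-abelian relations of weight `w`. Since logarithms are multivalued on
`Y₅*`, the pull-back is computed on their global real-analytic versions. -/
def IsPullback0 (D : Opens C5) (L : Fin 10 → C5 → ℂ) (w : ℕ) (k : Fin 5) (x x' : AR0 D) : Prop :=
  ∃ Q Q' : Fin 10 → MvPolynomial (Fin 3) ℂ,
    (∀ l, (Q l).IsHomogeneous w ∧ (Q' l).IsHomogeneous w) ∧
    IsLogClass D L Q x ∧ IsLogClass D L Q' x' ∧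
    ∀ l, ∀ y ∈ Ystar, absLogFun Q' (foliationPerm k l) y = absLogFun Q l (sigma k y)

/-- `η' = σ_k^* η`, for 1-abelian relations of weight `w`; same convention as for
0-abelian relations. -/
def IsPullback1 (D : Opens C5) (L : Fin 10 → C5 → ℂ) (w : ℕ) (k : Fin 5) (η η' : Forms D) :
    Prop :=
  ∃ P P' : Fin 10 → Fin 3 → MvPolynomial (Fin 3) ℂ,
    (∀ l s, (P l s).IsHomogeneous w ∧ (P' l s).IsHomogeneous w) ∧
    η = logForm D L P ∧ η' = logForm D L P' ∧
    ∀ l, ∀ y ∈ Ystar, absLogForm P' (foliationPerm k l) y =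
      (absLogForm P l (sigma k y)).comp (fderiv ℂ (sigma k) y)

/-! ### The irreducible representations `V_[λ,μ]` of `W(D₅)` -/

/-- The action of the generators of `W(D₅)` on `ℂ[x₁, …, x₅]`: `s_k` exchanges `x_k` and `x_{k+1}`
for `k ≤ 4`, and `s₅` is the reflection `x₄ ↦ -x₅`, `x₅ ↦ -x₄`. -/
def polyGen (k : Fin 5) : MvPolynomial (Fin 5) ℂ →ₐ[ℂ] MvPolynomial (Fin 5) ℂ :=
  aeval (![![X 1, X 0, X 2, X 3, X 4],
           ![X 0, X 2, X 1, X 3, X 4],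
           ![X 0, X 1, X 3, X 2, X 4],
           ![X 0, X 1, X 2, X 4, X 3],
           ![X 0, X 1, X 2, -X 4, -X 3]] k)

theorem polyGen_liftable : D5.IsLiftable polyGen := by
  intro i j
  apply MvPolynomial.algHom_ext
  intro m
  fin_cases i <;> fin_cases j <;> fin_cases m <;>
    simp [D5, polyGen, pow_succ]

/-- The action of `W(D₅)` on `ℂ[x₁, …, x₅]` by signed permutations of the variables. -/
def polyRep : Representation ℂ WD5 (MvPolynomial (Fin 5) ℂ) :=
  (⟨⟨fun φ => φ.toLinearMap, rfl⟩, fun _ _ => rfl⟩ :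
    (MvPolynomial (Fin 5) ℂ →ₐ[ℂ] MvPolynomial (Fin 5) ℂ) →* Module.End ℂ
      (MvPolynomial (Fin 5) ℂ)).comp (D5.toCoxeterSystem.lift ⟨polyGen, polyGen_liftable⟩)

/-- The product of the `x_{T a}² - x_{T b}²`, for `a` above `b` in a column of the diagram. -/
def colProd (lam : YoungDiagram) (T : lam.cells → Fin 5) : MvPolynomial (Fin 5) ℂ :=
  ∏ a : lam.cells, ∏ b : lam.cells,
    if a.1.2 = b.1.2 ∧ a.1.1 < b.1.1 then X (T a) ^ 2 - X (T b) ^ 2 else 1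

/-- The Specht module of the bipartition `(λ, μ)` of 5 (in its polynomial realisation): the span
of the Specht polynomials of all bitableaux of shape `(λ, μ)`. Sign changes act trivially
on the `λ`-variables, and by `-1` on each `μ`-variable. For `λ ≠ μ` it is, as a representation of
`W(D₅)`, the irreducible representation `V_[λ,μ]`. -/
def spechtModule (lam mu : YoungDiagram) : Submodule ℂ (MvPolynomial (Fin 5) ℂ) :=
  Submodule.span ℂ {f | ∃ T : (lam.cells ⊕ mu.cells) ≃ Fin 5,
    f = colProd lam (fun a => T (Sum.inl a)) * colProd mu (fun a => T (Sum.inr a)) *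
      ∏ a : mu.cells, X (T (Sum.inr a))}

/-- `V_[2,21]`. -/
def V2_21 : Submodule ℂ (MvPolynomial (Fin 5) ℂ) :=
  spechtModule (YoungDiagram.ofRowLens [2] (by decide)) (YoungDiagram.ofRowLens [2, 1] (by decide))

/-- `V_[-,221]`. -/
def V0_221 : Submodule ℂ (MvPolynomial (Fin 5) ℂ) :=
  spechtModule ⊥ (YoungDiagram.ofRowLens [2, 2, 1] (by decide))

end

end GMWeb

open GMWeb

/-! The space of 0-abelian relations is caught between two bounds, both equal to 25 = 20 + 5.

Upper bound. Each `U_l` is a submersion on `Ystar`, so a basic function is locally an analytic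
function of the two differences `U_{l,s} - U_{l,s}(y)` (`IsBasic.exists_factor`). Restricting `∑ f_l
= 0` to the lines through `y` gives linear equations between the Taylor coefficients of the `f_l`
(`IsExp.hasSer_sum`). Jets of order at most 5 without constant term have 200 coordinates; 25 of them
are declared free, and at a generic point the equations determine the other 175
(`exists_generic_point`). These equations have coefficients in `ℤ[y][1/(ζ₁⋯ζ₁₀)]`, so injectivity at
one point over the field with 31 elements gives injectivity at some complex point of every non-empty
open subset of `Ystar` (`exists_injective_of_zmod`); at that point it is a verified Gaussian
elimination (`rankCheck_eq_true`). In particular no symbol of order 5 survives, hence, by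
differentiation, none of higher order (`IsGeneric.symbol`). A relation whose free coordinates vanish
is therefore constant to infinite order at the point, and trivial on the connected set `D`: this is
`finrank_AR0_le`.

Lower bound. The thirty functions `Log U_{l,s}` are integral combinations of the ten `Log ζ_k`,
which leaves at least 20 linear relations; ten explicit quadratic identities, formal in the `Log
ζ_k`, span 5 more dimensions. Within one foliation the logarithms and their differentials are
independent enough for these 25 relations to be independent (`IsLogDet.independent`). Thus
`IsLogDet.rel_bijective` parametrises all of `AR0 D` by `linRel × (Fin 5 → ℂ)`.

What remains is finite linear algebra on these coefficients. The involutions act on the `ζ_j` by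
monomials up to sign (`zeta_sigma`), so the pull-back is a linear substitution of the functions `log
|U_{l,s}|`. Two explicit equivariant maps, `phi` and `theta`, send the coefficients isomorphically
onto the Specht modules, from which the group action is transported. A relation carried by three
foliations has no quadratic part (`eq_zero_of_coefComb`), so the 3-subwebs reduce to small linear
systems. Finally, the residue along `ζ_k = 0` acts as the derivative with respect to `Log ζ_k`, and
so turns the formal quadratic identities into linear ones. -/

namespace GMWeb

noncomputable section

/-! ### Taylor series of the first integrals along lines, over an arbitrary ring -/

/-- The values of `ζ₁, …, ζ₁₀` at a point with coordinates in a ring. -/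
def zetaR {R : Type*} [CommRing R] (y : Fin 5 → R) : Fin 10 → R :=
  ![y 0, y 1, y 2, y 3, y 4,
    1 + y 3 - y 2 * y 4, 1 + y 0 - y 4 * y 1, 1 + y 2 - y 1 * y 3,
    1 + y 4 - y 0 * y 3, 1 + y 1 - y 0 * y 2]

theorem map_zetaR {R S : Type*} [CommRing R] [CommRing S] (f : R →+* S) (y : Fin 5 → R)
    (k : Fin 10) : f (zetaR y k) = zetaR (fun i => f (y i)) k := by
  fin_cases k <;> simp [zetaR]

theorem zeta_eq_zetaR (k : Fin 10) (y : C5) : zeta k y = zetaR y k := by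
  fin_cases k <;> simp [zetaR, zeta, zetaPoly]

/-- The line through `y` with direction `v`. -/
def lineSer {R : Type*} [CommRing R] (y v : Fin 5 → R) (i : Fin 5) : PowerSeries R :=
  PowerSeries.C (y i) + PowerSeries.C (v i) * PowerSeries.X

/-- A power series is invertible as soon as its constant term is. Negative exponents can thus be
expanded over any commutative ring, in particular over the generic ring and over the field with 31
elements. -/
theorem isUnit_zetaSer {R : Type*} [CommRing R] {y : Fin 5 → R} (hy : ∀ k, IsUnit (zetaR y k))
    (v : Fin 5 → R) (k : Fin 10) : IsUnit (zetaR (lineSer y v) k) := by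
  rw [PowerSeries.isUnit_iff_constantCoeff, map_zetaR]
  simpa [lineSer] using hy k

/-- The Taylor series of `ζ_k` along a line, as a unit. -/
def zetaUnit {R : Type*} [CommRing R] {y : Fin 5 → R} (hy : ∀ k, IsUnit (zetaR y k))
    (v : Fin 5 → R) (k : Fin 10) : (PowerSeries R)ˣ := (isUnit_zetaSer hy v k).unit

theorem coe_zetaUnit {R : Type*} [CommRing R] {y : Fin 5 → R} (hy : ∀ k, IsUnit (zetaR y k))
    (v : Fin 5 → R) (k : Fin 10) : (zetaUnit hy v k : PowerSeries R) = zetaR (lineSer y v) k := rfl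

/-- The Taylor series of `U_{l,s}` along a line. -/
def USer {R : Type*} [CommRing R] {y : Fin 5 → R} (hy : ∀ k, IsUnit (zetaR y k))
    (v : Fin 5 → R) (l : Fin 10) (s : Fin 3) : PowerSeries R :=
  ((∏ k, zetaUnit hy v k ^ expo l s k : (PowerSeries R)ˣ) : PowerSeries R)

/-- The Taylor series of `U_{l,s} - U_{l,s}(y)` along a line through `y`. -/
def uSer {R : Type*} [CommRing R] {y : Fin 5 → R} (hy : ∀ k, IsUnit (zetaR y k))
    (v : Fin 5 → R) (l : Fin 10) (s : Fin 3) : PowerSeries R :=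
  USer hy v l s - PowerSeries.C (PowerSeries.constantCoeff (USer hy v l s))

theorem constantCoeff_uSer {R : Type*} [CommRing R] {y : Fin 5 → R}
    (hy : ∀ k, IsUnit (zetaR y k)) (v : Fin 5 → R) (l : Fin 10) (s : Fin 3) :
    PowerSeries.constantCoeff (uSer hy v l s) = 0 := by
  simp [uSer]

theorem X_dvd_uSer {R : Type*} [CommRing R] {y : Fin 5 → R}
    (hy : ∀ k, IsUnit (zetaR y k)) (v : Fin 5 → R) (l : Fin 10) (s : Fin 3) :
    PowerSeries.X ∣ uSer hy v l s :=
  PowerSeries.X_dvd_iff.2 (constantCoeff_uSer hy v l s)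

theorem isUnit_map {R S : Type*} [CommRing R] [CommRing S] (f : R →+* S) {y : Fin 5 → R}
    (hy : ∀ k, IsUnit (zetaR y k)) (k : Fin 10) : IsUnit (zetaR (fun i => f (y i)) k) := by
  rw [← map_zetaR]; exact (hy k).map f

theorem map_USer {R S : Type*} [CommRing R] [CommRing S] (f : R →+* S) {y : Fin 5 → R}
    (hy : ∀ k, IsUnit (zetaR y k)) (v : Fin 5 → R) (l : Fin 10) (s : Fin 3) :
    PowerSeries.map f (USer hy v l s) = USer (isUnit_map f hy) (fun i => f (v i)) l s := by
  have h (k : Fin 10) : Units.map (PowerSeries.map f : PowerSeries R →* PowerSeries S)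
      (zetaUnit hy v k) = zetaUnit (isUnit_map f hy) (fun i => f (v i)) k := by
    ext1
    rw [Units.coe_map, MonoidHom.coe_coe, coe_zetaUnit, coe_zetaUnit, map_zetaR]
    congr 1
    funext i
    simp [lineSer]
  have := congrArg Units.val (map_prod (Units.map (PowerSeries.map f : PowerSeries R →* PowerSeries S))
    (fun k => zetaUnit hy v k ^ expo l s k) Finset.univ)
  simp only [map_zpow, h] at this
  exact this

theorem map_uSer {R S : Type*} [CommRing R] [CommRing S] (f : R →+* S) {y : Fin 5 → R}
    (hy : ∀ k, IsUnit (zetaR y k)) (v : Fin 5 → R) (l : Fin 10) (s : Fin 3) :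
    PowerSeries.map f (uSer hy v l s) = uSer (isUnit_map f hy) (fun i => f (v i)) l s := by
  rw [uSer, uSer, map_sub, PowerSeries.map_C, ← map_USer f hy,
    ← PowerSeries.coeff_zero_eq_constantCoeff_apply, ← PowerSeries.coeff_zero_eq_constantCoeff_apply,
    PowerSeries.coeff_map]

/-- The `d`-th Taylor coefficient of `(U_{l,1} - U_{l,1}(y))ⁱ (U_{l,2} - U_{l,2}(y))ʲ` along the line
through `y` with direction `v`. -/
def tcoef {R : Type*} [CommRing R] {y : Fin 5 → R} (hy : ∀ k, IsUnit (zetaR y k))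
    (v : Fin 5 → R) (d : ℕ) (l : Fin 10) (i j : ℕ) : R :=
  PowerSeries.coeff d (uSer hy v l 0 ^ i * uSer hy v l 1 ^ j)

/-- One universal formula gives the Taylor coefficients over all rings, so they commute with
specialisation. This is what gives a computation at a point over a finite field a meaning over `ℂ`.
-/
theorem map_tcoef {R S : Type*} [CommRing R] [CommRing S] (f : R →+* S) {y : Fin 5 → R}
    (hy : ∀ k, IsUnit (zetaR y k)) (v : Fin 5 → R) (d : ℕ) (l : Fin 10) (i j : ℕ) :
    f (tcoef hy v d l i j) = tcoef (isUnit_map f hy) (fun i => f (v i)) d l i j := by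
  rw [tcoef, tcoef, ← map_uSer, ← map_uSer, ← map_pow, ← map_pow, ← map_mul, PowerSeries.coeff_map]

/-- Both series vanish at `t = 0`, so a monomial of order `i + j` starts at `t ^ (i + j)`. The
linear system on jets is therefore block triangular with respect to the order. -/
theorem tcoef_of_lt {R : Type*} [CommRing R] {y : Fin 5 → R} (hy : ∀ k, IsUnit (zetaR y k))
    (v : Fin 5 → R) {d : ℕ} (l : Fin 10) {i j : ℕ} (h : d < i + j) : tcoef hy v d l i j = 0 := by
  have : PowerSeries.X ^ (i + j) ∣ uSer hy v l 0 ^ i * uSer hy v l 1 ^ j := by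
    rw [pow_add]
    exact mul_dvd_mul (pow_dvd_pow_of_dvd (X_dvd_uSer hy v l 0) i)
      (pow_dvd_pow_of_dvd (X_dvd_uSer hy v l 1) j)
  exact PowerSeries.X_pow_dvd_iff.1 this d h

theorem tcoef_add {R : Type*} [CommRing R] {y : Fin 5 → R} (hy : ∀ k, IsUnit (zetaR y k))
    (v : Fin 5 → R) (l : Fin 10) (i j : ℕ) : tcoef hy v (i + j) l i j =
      PowerSeries.coeff 1 (uSer hy v l 0) ^ i * PowerSeries.coeff 1 (uSer hy v l 1) ^ j := by
  obtain ⟨a, ha⟩ := X_dvd_uSer hy v l 0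
  obtain ⟨b, hb⟩ := X_dvd_uSer hy v l 1
  have h1 (c : PowerSeries R) : PowerSeries.coeff 1 (PowerSeries.X * c) =
      PowerSeries.constantCoeff c := by
    rw [← zero_add 1, PowerSeries.coeff_succ_X_mul, PowerSeries.coeff_zero_eq_constantCoeff_apply]
  rw [tcoef, ha, hb, h1, h1, mul_pow, mul_pow, mul_mul_mul_comm, ← pow_add,
    PowerSeries.coeff_X_pow_mul', if_pos le_rfl, Nat.sub_self]
  simp

/-! ### Passing from one point over a finite field to a generic complex point -/

/-- The generic ring `ℤ[y][1 / (ζ₁ ⋯ ζ₁₀)]`. -/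
abbrev GenRing : Type :=
  Localization.Away (∏ k, zetaR (MvPolynomial.X : Fin 5 → MvPolynomial (Fin 5) ℤ) k)

/-- The coordinates of the generic point. -/
def genPt (i : Fin 5) : GenRing := algebraMap (MvPolynomial (Fin 5) ℤ) GenRing (MvPolynomial.X i)

theorem isUnit_genPt (k : Fin 10) : IsUnit (zetaR genPt k) := by
  have h : zetaR genPt k = algebraMap (MvPolynomial (Fin 5) ℤ) GenRing (zetaR MvPolynomial.X k) :=
    (map_zetaR _ _ _).symm
  rw [h]
  refine isUnit_of_dvd_unit (map_dvd _ (Finset.dvd_prod_of_mem _ (Finset.mem_univ k)))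
    (IsLocalization.Away.algebraMap_isUnit (S := GenRing)
      (∏ k, zetaR (MvPolynomial.X : Fin 5 → MvPolynomial (Fin 5) ℤ) k))

/-- Specialisation of the generic point. -/
def specialize {K : Type*} [CommRing K] {y : Fin 5 → K} (hy : ∀ k, IsUnit (zetaR y k)) :
    GenRing →+* K :=
  IsLocalization.Away.lift (∏ k, zetaR (MvPolynomial.X : Fin 5 → MvPolynomial (Fin 5) ℤ) k)
    (g := MvPolynomial.eval₂Hom (Int.castRingHom K) y) (by
      rw [map_prod]
      refine (IsUnit.prod_univ_iff).2 fun k => ?_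
      rw [map_zetaR]
      simpa using hy k)

theorem specialize_algebraMap {K : Type*} [CommRing K] {y : Fin 5 → K}
    (hy : ∀ k, IsUnit (zetaR y k)) (a : MvPolynomial (Fin 5) ℤ) :
    specialize hy (algebraMap _ GenRing a) = MvPolynomial.eval₂Hom (Int.castRingHom K) y a :=
  IsLocalization.Away.lift_eq _ _ a

theorem specialize_genPt {K : Type*} [CommRing K] {y : Fin 5 → K}
    (hy : ∀ k, IsUnit (zetaR y k)) (i : Fin 5) : specialize hy (genPt i) = y i := by
  rw [genPt, specialize_algebraMap]; simp

theorem specialize_tcoef {K : Type*} [CommRing K] {y : Fin 5 → K}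
    (hy : ∀ k, IsUnit (zetaR y k)) (v : Fin 5 → ℤ) (d : ℕ) (l : Fin 10) (i j : ℕ) :
    specialize hy (tcoef isUnit_genPt (fun i => (v i : GenRing)) d l i j) =
      tcoef hy (fun i => (v i : K)) d l i j := by
  rw [map_tcoef]
  have h : (fun i => specialize hy (genPt i)) = y := funext (specialize_genPt hy)
  simp only [map_intCast]
  congr 1

theorem isUnit_of_mem_Ystar {y : C5} (hy : y ∈ Ystar) (k : Fin 10) : IsUnit (zetaR y k) := by
  rw [← zeta_eq_zetaR]; exact (hy k).isUnit

/-- A nonzero element of the generic ring is nonzero at some point of any non-empty open set. -/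
theorem exists_specialize_ne_zero {D : Set C5} (hD : IsOpen D) (hne : D.Nonempty)
    (hDY : D ⊆ Ystar) {r : GenRing} (hr : r ≠ 0) :
    ∃ (y : C5) (hy : y ∈ Ystar), y ∈ D ∧ specialize (isUnit_of_mem_Ystar hy) r ≠ 0 := by
  -- Clearing the denominator reduces the question to an integral polynomial.
  obtain ⟨n, a, ha⟩ := IsLocalization.Away.surj
    (∏ k, zetaR (MvPolynomial.X : Fin 5 → MvPolynomial (Fin 5) ℤ) k) r
  have ha0 : a ≠ 0 := by
    rintro rfl
    rw [map_zero] at ha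
    refine hr (((IsLocalization.Away.algebraMap_isUnit (S := GenRing)
      (∏ k, zetaR (MvPolynomial.X : Fin 5 → MvPolynomial (Fin 5) ℤ) k)).pow n).mul_left_eq_zero.1 ha)
  have hmap : MvPolynomial.map (Int.castRingHom ℂ) a ≠ 0 := fun h =>
    ha0 (MvPolynomial.map_injective _ (RingHom.injective_int _) (h.trans (map_zero _).symm))
  obtain ⟨y₀, hy₀⟩ := hne
  obtain ⟨ε, hε, hball⟩ := Metric.isOpen_iff.1 hD y₀ hy₀
  by_contra hcon
  push Not at hcon
  -- A ball for the sup norm is a product of discs, which are infinite sets; a polynomial vanishing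
  -- on such a product is zero.
  refine hmap (MvPolynomial.funext_set (fun i => Metric.ball (y₀ i) ε) (fun i => ?_) fun y hy => ?_)
  · exact infinite_of_mem_nhds (y₀ i) (Metric.ball_mem_nhds _ hε)
  · have hyD : y ∈ D := hball (by
      rw [Metric.mem_ball, dist_pi_lt_iff hε]
      exact fun i => hy i trivial)
    have h0 := hcon y (hDY hyD) hyD
    have h1 := congrArg (specialize (isUnit_of_mem_Ystar (hDY hyD))) ha
    rw [map_mul, h0, zero_mul, specialize_algebraMap] at h1
    rw [map_zero, MvPolynomial.eval_map]
    exact h1.symm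

/-- If an integral matrix of regular functions is injective at a point over a prime field, then it
is injective at some point of any non-empty open set. -/
theorem exists_injective_of_zmod {D : Set C5} (hD : IsOpen D) (hne : D.Nonempty)
    (hDY : D ⊆ Ystar) {p : ℕ} [Fact p.Prime] {y₀ : Fin 5 → ZMod p} (hy₀ : ∀ k, IsUnit (zetaR y₀ k))
    {ι κ : Type*} [Fintype ι] [Fintype κ] [DecidableEq ι] [DecidableEq κ] (M : Matrix ι κ GenRing)
    (hM : ∀ x, (M.map (specialize hy₀)).mulVec x = 0 → x = 0) :
    ∃ (y : C5) (hy : y ∈ Ystar), y ∈ D ∧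
      ∀ x, (M.map (specialize (isUnit_of_mem_Ystar hy))).mulVec x = 0 → x = 0 := by
  obtain ⟨g, hg⟩ := LinearMap.exists_leftInverse_of_injective
    (Matrix.mulVecLin (M.map (specialize hy₀))) (LinearMap.ker_eq_bot'.2 hM)
  have hN : LinearMap.toMatrix' g * M.map (specialize hy₀) = 1 := by
    have := congrArg LinearMap.toMatrix' hg
    rwa [LinearMap.toMatrix'_comp, LinearMap.toMatrix'_id, ← Matrix.toLin'_apply',
      LinearMap.toMatrix'_toLin'] at this
  -- A left inverse modulo `p` is lifted entrywise to integers. The determinant of `N * M`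
  -- specialises to 1, so it is a nonzero element of the generic ring, and `M` is injective at each
  -- complex point where this determinant does not vanish.
  let N : Matrix κ ι GenRing :=
    (LinearMap.toMatrix' g).map fun a => ((a.val : ℕ) : GenRing)
  have hNs : N.map (specialize hy₀) = LinearMap.toMatrix' g := by
    ext i j
    simp [N]
  have hdet : (N * M).det ≠ 0 := by
    intro h
    have := congrArg (specialize hy₀) h
    rw [RingHom.map_det, RingHom.mapMatrix_apply, Matrix.map_mul, hNs, hN, map_zero,
      Matrix.det_one] at this
    exact one_ne_zero this
  obtain ⟨y, hy, hyD, hne⟩ := exists_specialize_ne_zero hD hne hDY hdet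
  refine ⟨y, hy, hyD, fun x hx => ?_⟩
  rw [RingHom.map_det, RingHom.mapMatrix_apply, Matrix.map_mul] at hne
  refine Matrix.eq_zero_of_mulVec_eq_zero hne ?_
  rw [← Matrix.mulVec_mulVec, hx, Matrix.mulVec_zero]

end

end GMWeb

namespace GMWeb

noncomputable section

/-! ### Gaussian elimination modulo 31 on rows packed into natural numbers -/

instance fact_prime_31 : Fact (Nat.Prime 31) := ⟨by norm_num⟩

/-- `f n`, arranged so that the kernel evaluates `n` first. -/
def force {α : Type} (n : ℕ) (f : ℕ → α) : α :=
  Nat.rec (f 0) (fun m _ => f m) (Nat.add n 1)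

theorem force_eq {α : Type} (n : ℕ) (f : ℕ → α) : force n f = f n := rfl

/-- `f l`, arranged so that the kernel evaluates the entries of `l` first. -/
def forceList {α : Type} : List ℕ → (List ℕ → α) → α
  | [], f => f []
  | x :: l, f => force x fun y => forceList l fun m => f (y :: m)

theorem forceList_eq {α : Type} (l : List ℕ) (f : List ℕ → α) : forceList l f = f l := by
  induction l generalizing f with
  | nil => rfl
  | cons x l ih => rw [forceList, force_eq, ih]

/-- Clear the first entry of a packed row with the pivot row `a, t`. -/
def elimRow (B a t R : ℕ) : ℕ :=
  force (Nat.mod (Nat.mod R B) 31) fun h => bif Nat.beq h 0 then Nat.div R B else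
    -- Cross-multiplication instead of division, with `31 - h` in the role of `-h`. Only leading
    -- entries are ever reduced modulo 31; the other digits are allowed to grow.
    Nat.add (Nat.mul a (Nat.div R B)) (Nat.mul (Nat.sub 31 h) t)

/-- Clear the first entries of several packed rows. -/
def elimRows (B a t : ℕ) : List ℕ → List ℕ
  | [] => []
  | R :: rs => force (elimRow B a t R) fun R' => R' :: elimRows B a t rs

/-- One step of the elimination. -/
def elimStep (B : ℕ) : List ℕ → Option (List ℕ)
  | [] => none
  | R :: rs => force (Nat.mod (Nat.mod R B) 31) fun h => force (Nat.div R B) fun t =>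
      bif Nat.beq h 0 then (elimStep B rs).map (t :: ·) else some (elimRows B h t rs)

/-- Elimination of the first `n` columns. -/
def elimN (B : ℕ) : ℕ → List ℕ → Option (List ℕ)
  | 0, rs => some rs
  | n + 1, rs => (elimStep B rs).bind (elimN B n)

/-- The value of a row on a vector. -/
def rowDot (r : List ℕ) (X : List (ZMod 31)) : ZMod 31 :=
  (List.zipWith (fun (a : ℕ) x => (a : ZMod 31) * x) r X).sum

/-- The packed row `R`, with entries at most `b`, vanishes on `X`. -/
def RowSol (B b R : ℕ) (X : List (ZMod 31)) : Prop :=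
  ∃ r : List ℕ, r.length = X.length ∧ (∀ a ∈ r, a ≤ b) ∧ R = Nat.ofDigits B r ∧ rowDot r X = 0

theorem RowSol.mono {B b b' R : ℕ} {X : List (ZMod 31)} (h : RowSol B b R X) (hb : b ≤ b') :
    RowSol B b' R X := by
  obtain ⟨r, h1, h2, h3, h4⟩ := h
  exact ⟨r, h1, fun a ha => (h2 a ha).trans hb, h3, h4⟩

/-- Digits below the base produce no carry, so `R % B` is the first entry of the row and `R / B`
packs the remaining ones. -/
theorem RowSol.cons {B b R : ℕ} {x : ZMod 31} {X : List (ZMod 31)} (h : RowSol B b R (x :: X))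
    (hb : b < B) : ∃ r : List ℕ, r.length = X.length ∧ (∀ a ∈ r, a ≤ b) ∧
      R / B = Nat.ofDigits B r ∧ ((R % B : ℕ) : ZMod 31) * x + rowDot r X = 0 := by
  obtain ⟨r, h1, h2, h3, h4⟩ := h
  match r, h1 with
  | a :: r, h1 =>
    have ha : a < B := (h2 a (by simp)).trans_lt hb
    rw [Nat.ofDigits_cons] at h3
    refine ⟨r, by simpa using h1, fun c hc => h2 c (by simp [hc]), ?_, ?_⟩
    · rw [h3, Nat.add_mul_div_left _ _ (by omega), Nat.div_eq_of_lt ha, zero_add]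
    · rw [h3, Nat.add_mul_mod_self_left, Nat.mod_eq_of_lt ha]
      simpa [rowDot] using h4

/-- `Nat.ofDigits` is linear in the digits whatever their size; the bound on the digits matters only
when one of them is read back. -/
theorem ofDigits_comb (B a c : ℕ) (r t : List ℕ) (h : r.length = t.length) :
    a * Nat.ofDigits B r + c * Nat.ofDigits B t =
      Nat.ofDigits B (List.zipWith (fun x y => a * x + c * y) r t) := by
  induction r generalizing t with
  | nil => cases t with
    | nil => simp
    | cons => simp at h
  | cons x r ih => cases t with
    | nil => simp at h
    | cons y t =>
      simp only [List.length_cons, Nat.add_right_cancel_iff] at h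
      simp only [Nat.ofDigits_cons, List.zipWith_cons_cons, ← ih t h]
      ring

theorem rowDot_comb (a c : ℕ) (r t : List ℕ) (X : List (ZMod 31)) (h : r.length = t.length) :
    rowDot (List.zipWith (fun x y => a * x + c * y) r t) X = a * rowDot r X + c * rowDot t X := by
  induction r generalizing t X with
  | nil => cases t with
    | nil => simp [rowDot]
    | cons => simp at h
  | cons x r ih => cases t with
    | nil => simp at h
    | cons y t =>
      simp only [List.length_cons, Nat.add_right_cancel_iff] at h
      cases X with
      | nil => simp [rowDot]
      | cons z X =>
        have := ih t X h
        simp only [rowDot] at this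
        simp only [rowDot, List.zipWith_cons_cons, List.sum_cons, this]
        push_cast
        ring

/-- Both multipliers are at most 31, whence the growth factor 62 = 31 + 31 of the entries. -/
theorem elimRow_sound {B b R a : ℕ} {t : List ℕ} {x : ZMod 31} {X : List (ZMod 31)}
    (hR : RowSol B b R (x :: X)) (hb : b < B) (ha : a ≤ 31) (ht : t.length = X.length)
    (htb : ∀ c ∈ t, c ≤ b) (h0 : (a : ZMod 31) * x + rowDot t X = 0) :
    RowSol B (62 * b) (elimRow B a (Nat.ofDigits B t) R) X := by
  obtain ⟨r, h1, h2, h3, h4⟩ := hR.cons hb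
  rw [elimRow, force_eq]
  change RowSol B (62 * b) (bif Nat.beq (R % B % 31) 0 then R / B else
    a * (R / B) + (31 - R % B % 31) * Nat.ofDigits B t) X
  by_cases hh : R % B % 31 = 0
  · rw [hh]
    have h5 : ((R % B : ℕ) : ZMod 31) = 0 := by
      rw [ZMod.natCast_eq_zero_iff]; exact Nat.dvd_of_mod_eq_zero hh
    rw [h5, zero_mul, zero_add] at h4
    exact ⟨r, h1, fun c hc => (h2 c hc).trans (by omega), h3, h4⟩
  · have h6 : Nat.beq (R % B % 31) 0 = false := by
      rw [Bool.eq_false_iff]; intro h; exact hh (Nat.eq_of_beq_eq_true h)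
    rw [h6, cond_false, h3, ofDigits_comb _ _ _ _ _ (h1.trans ht.symm)]
    refine ⟨_, by simp [h1, ht], ?_, rfl, ?_⟩
    · intro c hc
      obtain ⟨i, hi, rfl⟩ := List.mem_iff_getElem.1 hc
      rw [List.getElem_zipWith]
      have e1 := h2 _ (List.getElem_mem (l := r) (n := i) (by simp at hi; omega))
      have e2 := htb _ (List.getElem_mem (l := t) (n := i) (by simp at hi; omega))
      calc _ ≤ 31 * b + 31 * b := by gcongr; omega
        _ = 62 * b := by ring
    · rw [rowDot_comb _ _ _ _ _ (h1.trans ht.symm)]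
      have h7 : ((31 - R % B % 31 : ℕ) : ZMod 31) = -((R % B : ℕ) : ZMod 31) := by
        rw [Nat.cast_sub (Nat.mod_lt _ (by norm_num)).le, ZMod.natCast_mod]
        rw [show ((31 : ℕ) : ZMod 31) = 0 from ZMod.natCast_self 31, zero_sub]
      rw [h7]
      linear_combination (a : ZMod 31) * h4 - ((R % B : ℕ) : ZMod 31) * h0

theorem elimRows_sound {B b a : ℕ} {t : List ℕ} {x : ZMod 31} {X : List (ZMod 31)} {rs : List ℕ}
    (hR : ∀ R ∈ rs, RowSol B b R (x :: X)) (hb : b < B) (ha : a ≤ 31) (ht : t.length = X.length)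
    (htb : ∀ c ∈ t, c ≤ b) (h0 : (a : ZMod 31) * x + rowDot t X = 0) :
    ∀ R ∈ elimRows B a (Nat.ofDigits B t) rs, RowSol B (62 * b) R X := by
  induction rs with
  | nil => simp [elimRows]
  | cons R rs ih =>
    rw [elimRows, force_eq]
    intro R' hR'
    rcases List.mem_cons.1 hR' with rfl | h
    · exact elimRow_sound (hR R (by simp)) hb ha ht htb h0
    · exact ih (fun R hR' => hR R (by simp [hR'])) R' h

theorem rowDot_zero (r : List ℕ) {X : List (ZMod 31)} (hX : ∀ z ∈ X, z = 0) : rowDot r X = 0 := by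
  rw [rowDot]
  refine List.sum_eq_zero fun a ha => ?_
  obtain ⟨i, hi, rfl⟩ := List.mem_iff_getElem.1 ha
  rw [List.getElem_zipWith, hX _ (List.getElem_mem _), mul_zero]

/-- Only soundness is needed. Every new row is a consequence of the old ones, and the pivot, nonzero
modulo 31, forces the eliminated unknown to vanish once all later unknowns do. -/
theorem elimStep_sound {B b : ℕ} {x : ZMod 31} {X : List (ZMod 31)} {rs rs' : List ℕ}
    (hR : ∀ R ∈ rs, RowSol B b R (x :: X)) (hb : b < B) (h : elimStep B rs = some rs') :
    (∀ R ∈ rs', RowSol B (62 * b) R X) ∧ ((∀ z ∈ X, z = 0) → x = 0) := by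
  induction rs generalizing rs' with
  | nil => simp [elimStep] at h
  | cons R rs ih =>
    rw [elimStep, force_eq, force_eq] at h
    change (bif Nat.beq (R % B % 31) 0 then (elimStep B rs).map ((R / B) :: ·)
      else some (elimRows B (R % B % 31) (R / B) rs)) = some rs' at h
    obtain ⟨r, h1, h2, h3, h4⟩ := (hR R (by simp)).cons hb
    by_cases hh : R % B % 31 = 0
    · rw [hh] at h
      change (elimStep B rs).map ((R / B) :: ·) = some rs' at h
      obtain ⟨rs'', h5, rfl⟩ := Option.map_eq_some_iff.1 h
      obtain ⟨h6, h7⟩ := ih (fun R hR' => hR R (by simp [hR'])) h5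
      refine ⟨fun R' hR' => ?_, h7⟩
      rcases List.mem_cons.1 hR' with rfl | h8
      · have h9 : ((R % B : ℕ) : ZMod 31) = 0 := by
          rw [ZMod.natCast_eq_zero_iff]; exact Nat.dvd_of_mod_eq_zero hh
        rw [h9, zero_mul, zero_add] at h4
        exact ⟨r, h1, fun c hc => (h2 c hc).trans (by omega), h3, h4⟩
      · exact h6 R' h8
    · have h6 : Nat.beq (R % B % 31) 0 = false := by
        rw [Bool.eq_false_iff]; intro h; exact hh (Nat.eq_of_beq_eq_true h)
      rw [h6, cond_false, h3, Option.some_inj] at h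
      subst h
      have h9 : ((R % B % 31 : ℕ) : ZMod 31) = ((R % B : ℕ) : ZMod 31) := ZMod.natCast_mod _ _
      refine ⟨elimRows_sound (fun R hR' => hR R (by simp [hR'])) hb (Nat.mod_lt _ (by norm_num)).le
        h1 h2 (by rw [h9]; exact h4), fun hX => ?_⟩
      rw [rowDot_zero r hX, add_zero] at h4
      refine (mul_eq_zero.1 h4).resolve_left fun h10 => hh ?_
      rw [ZMod.natCast_eq_zero_iff] at h10
      exact Nat.mod_eq_zero_of_dvd h10

theorem elimN_sound {B : ℕ} (n : ℕ) {b : ℕ} {X : List (ZMod 31)} {rs rs' : List ℕ}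
    (hR : ∀ R ∈ rs, RowSol B b R X) (hn : n ≤ X.length) (hb : 62 ^ n * b < B)
    (h : elimN B n rs = some rs') :
    (∀ R ∈ rs', RowSol B (62 ^ n * b) R (X.drop n)) ∧
      ((∀ z ∈ X.drop n, z = 0) → ∀ z ∈ X, z = 0) := by
  induction n generalizing b X rs with
  | zero =>
    rw [elimN, Option.some_inj] at h
    subst h
    simpa using hR
  | succ n ih =>
    cases X with
    | nil => simp at hn
    | cons x X =>
      rw [elimN, Option.bind_eq_some_iff] at h
      obtain ⟨rs₁, h1, h2⟩ := h
      have hb' : 62 ^ n * (62 * b) < B := by rwa [← mul_assoc, ← pow_succ]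
      have hb1 : b < B := lt_of_le_of_lt (Nat.le_mul_of_pos_left b (by positivity)) hb
      obtain ⟨h3, h4⟩ := elimStep_sound hR hb1 h1
      obtain ⟨h5, h6⟩ := ih h3 (by simpa using hn) hb' h2
      refine ⟨fun R hR => ?_, fun h7 z hz => ?_⟩
      · have := h5 R hR
        rwa [← mul_assoc, ← pow_succ] at this
      · have h8 := h6 (by simpa using h7)
        rcases List.mem_cons.1 hz with rfl | h9
        · exact h4 h8
        · exact h8 z h9

/-- If elimination on packed rows succeeds, the only solution is zero. -/
theorem eq_zero_of_elimN {B n b : ℕ} {X : List (ZMod 31)} {rs rs' : List ℕ}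
    (hR : ∀ R ∈ rs, RowSol B b R X) (hn : n = X.length) (hb : 62 ^ n * b < B)
    (h : elimN B n rs = some rs') : ∀ z ∈ X, z = 0 := by
  refine (elimN_sound n hR hn.le hb h).2 ?_
  rw [hn, List.drop_length]
  simp

/-- Packing of a row whose entries are reduced modulo 31. -/
def packRow (B : ℕ) (e : ℕ → ℕ) : List ℕ → ℕ
  | [] => 0
  | P :: t => Nat.add (Nat.mod (e P) 31) (Nat.mul B (packRow B e t))

theorem packRow_eq (B : ℕ) (e : ℕ → ℕ) (t : List ℕ) :
    packRow B e t = Nat.ofDigits B (t.map fun P => e P % 31) := by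
  induction t with
  | nil => rfl
  | cons P t ih =>
    rw [List.map_cons, Nat.ofDigits_cons, ← ih]
    rfl

theorem rowSol_packRow {B : ℕ} {e : ℕ → ℕ} {t : List ℕ} {X : List (ZMod 31)}
    (hl : t.length = X.length) (h : rowDot (t.map e) X = 0) : RowSol B 31 (packRow B e t) X := by
  refine ⟨t.map fun P => e P % 31, by simpa using hl, ?_, packRow_eq B e t, ?_⟩
  · intro a ha
    obtain ⟨P, _, rfl⟩ := List.mem_map.1 ha
    exact (Nat.mod_lt _ (by norm_num)).le
  · rw [← h, rowDot, rowDot, List.zipWith_map_left, List.zipWith_map_left]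
    simp only [ZMod.natCast_mod]

end

end GMWeb

namespace GMWeb

noncomputable section

/-! ### Power series modulo 31, packed into natural numbers -/

/-- `x` is, modulo `S⁶`, the packing in base `S` of the first six coefficients of `φ`, with digits
at most `186 ^ n`. -/
def Packed (S n x : ℕ) (φ : PowerSeries (ZMod 31)) : Prop :=
  ∃ f : ℕ → ℕ, x % S ^ 6 = ∑ i ∈ Finset.range 6, f i * S ^ i ∧ (∀ i, f i ≤ 186 ^ n) ∧
    ∀ i < 6, (f i : ZMod 31) = PowerSeries.coeff i φ

theorem sum_digits_lt {S : ℕ} {f : ℕ → ℕ} (h : ∀ i, f i < S) (n : ℕ) :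
    ∑ i ∈ Finset.range n, f i * S ^ i < S ^ n := by
  induction n with
  | zero => simp
  | succ n ih =>
    rw [Finset.sum_range_succ, pow_succ]
    have : (f n + 1) * S ^ n ≤ S * S ^ n := Nat.mul_le_mul_right _ (h n)
    linarith

theorem digit_eq {S : ℕ} {f : ℕ → ℕ} (h : ∀ i, f i < S) {n d : ℕ} (hd : d < n) :
    (∑ i ∈ Finset.range n, f i * S ^ i) / S ^ d % S = f d := by
  have hS : 0 < S := (Nat.zero_le _).trans_lt (h 0)
  induction d generalizing n f with
  | zero =>
    obtain ⟨m, rfl⟩ : ∃ m, n = m + 1 := ⟨n - 1, by omega⟩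
    rw [Finset.sum_range_succ', pow_zero, Nat.div_one, mul_one]
    simp_rw [pow_succ, ← mul_assoc]
    rw [← Finset.sum_mul, Nat.mul_add_mod_self_right, Nat.mod_eq_of_lt (h 0)]
  | succ d ih =>
    obtain ⟨m, rfl⟩ : ∃ m, n = m + 1 := ⟨n - 1, by omega⟩
    rw [Finset.sum_range_succ', pow_zero, mul_one]
    simp_rw [pow_succ, ← mul_assoc]
    rw [← Finset.sum_mul, mul_comm (S ^ d) S, ← Nat.div_div_eq_div_mul, mul_comm _ S,
      Nat.mul_add_div hS, Nat.div_eq_of_lt (h 0), add_zero]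
    exact ih (f := fun i => f (i + 1)) (fun i => h (i + 1)) (by omega)

/-- A coefficient of the product modulo `t ^ 6` has at most six terms, and 6 ≤ 186: this is the
extra unit in the exponent. -/
theorem Packed.mul {S n m x y : ℕ} {φ ψ : PowerSeries (ZMod 31)} (hx : Packed S n x φ)
    (hy : Packed S m y ψ) (hS : 186 ^ (n + m + 1) < S) : Packed S (n + m + 1) (x * y) (φ * ψ) := by
  obtain ⟨f, f1, f2, f3⟩ := hx
  obtain ⟨g, g1, g2, g3⟩ := hy
  set h : ℕ → ℕ := fun d =>
    if d < 6 then ∑ ij ∈ Finset.HasAntidiagonal.antidiagonal d, f ij.1 * g ij.2 else 0 with hh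
  have hb (d : ℕ) : h d ≤ 186 ^ (n + m + 1) := by
    simp only [hh]
    split_ifs with hd
    · calc ∑ ij ∈ Finset.HasAntidiagonal.antidiagonal d, f ij.1 * g ij.2
          ≤ ∑ ij ∈ Finset.HasAntidiagonal.antidiagonal d, 186 ^ n * 186 ^ m :=
            Finset.sum_le_sum fun ij _ => Nat.mul_le_mul (f2 _) (g2 _)
        _ = (d + 1) * (186 ^ n * 186 ^ m) := by
            rw [Finset.sum_const, Finset.Nat.card_antidiagonal, smul_eq_mul]
        _ ≤ 186 * (186 ^ n * 186 ^ m) := by gcongr; omega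
        _ = _ := by ring
    · exact Nat.zero_le _
  refine ⟨h, ?_, hb, fun d hd => ?_⟩
  · have hlt := sum_digits_lt (fun i => (hb i).trans_lt hS) 6
    rw [← Nat.mod_eq_of_lt hlt, Nat.mul_mod, f1, g1]
    change Nat.ModEq _ _ _
    -- The terms of degree at least 6 are multiples of `S ^ 6`, hence invisible in the truncation.
    have : (∑ i ∈ Finset.range 6, f i * S ^ i) * (∑ i ∈ Finset.range 6, g i * S ^ i) =
        (∑ i ∈ Finset.range 6, h i * S ^ i) + S ^ 6 * (
          (f 1 * g 5 + f 2 * g 4 + f 3 * g 3 + f 4 * g 2 + f 5 * g 1) +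
          (f 2 * g 5 + f 3 * g 4 + f 4 * g 3 + f 5 * g 2) * S +
          (f 3 * g 5 + f 4 * g 4 + f 5 * g 3) * S ^ 2 +
          (f 4 * g 5 + f 5 * g 4) * S ^ 3 + f 5 * g 5 * S ^ 4) := by
      simp [hh, Finset.sum_range_succ, Finset.Nat.antidiagonal_succ]
      ring
    rw [this]
    exact Nat.ModEq.symm (by simp [Nat.ModEq])
  · simp only [hh, if_pos hd]
    rw [PowerSeries.coeff_mul]
    push_cast
    refine Finset.sum_congr rfl fun ij hij => ?_
    have := Finset.HasAntidiagonal.mem_antidiagonal.1 hij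
    rw [f3 _ (by omega), g3 _ (by omega)]

theorem Packed.one {S : ℕ} (hS : 1 < S) : Packed S 0 1 1 := by
  refine ⟨fun i => if i = 0 then 1 else 0, ?_, fun i => ?_, fun i _ => ?_⟩
  · rw [Nat.mod_eq_of_lt (Nat.one_lt_pow (by norm_num) hS)]
    simp
  · dsimp only; split_ifs <;> simp
  · rw [PowerSeries.coeff_one]; split_ifs with h <;> simp [h]

theorem Packed.mono {S n m x : ℕ} {φ : PowerSeries (ZMod 31)} (hx : Packed S n x φ) (h : n ≤ m) :
    Packed S m x φ := by
  obtain ⟨f, f1, f2, f3⟩ := hx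
  exact ⟨f, f1, fun i => (f2 i).trans (Nat.pow_le_pow_right (by norm_num) h), f3⟩

theorem Packed.pow {S n x : ℕ} {φ : PowerSeries (ZMod 31)} (hx : Packed S n x φ) (k : ℕ)
    (hS : 186 ^ ((n + 1) * k) < S) : Packed S ((n + 1) * k) (x ^ k) (φ ^ k) := by
  induction k with
  | zero => simpa using Packed.one (by simpa using hS)
  | succ k ih =>
    have h := ih (lt_of_le_of_lt (Nat.pow_le_pow_right (by norm_num) (by gcongr; simp)) hS)
    rw [pow_succ, pow_succ]
    have h2 := h.mul hx (by rw [show (n + 1) * k + n + 1 = (n + 1) * (k + 1) by ring]; exact hS)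
    rwa [show (n + 1) * k + n + 1 = (n + 1) * (k + 1) by ring] at h2

theorem Packed.mod {S n x : ℕ} {φ : PowerSeries (ZMod 31)} (hx : Packed S n x φ) :
    Packed S n (x % S ^ 6) φ := by
  obtain ⟨f, f1, f2, f3⟩ := hx
  exact ⟨f, by rw [Nat.mod_mod]; exact f1, f2, f3⟩

theorem Packed.digit {S n x d : ℕ} {φ : PowerSeries (ZMod 31)} (hx : Packed S n x φ) (hd : d < 6)
    (hS : 186 ^ n < S) : ((x % S ^ 6 / S ^ d % S : ℕ) : ZMod 31) = PowerSeries.coeff d φ := by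
  obtain ⟨f, f1, f2, f3⟩ := hx
  rw [f1, digit_eq (fun i => (f2 i).trans_lt hS) hd, f3 d hd]

theorem Packed.sub_const {S n x : ℕ} {φ : PowerSeries (ZMod 31)} (hx : Packed S n (x % S ^ 6) φ)
    (hS : 186 ^ n < S) : Packed S n (x % S ^ 6 - x % S ^ 6 % S)
      (φ - PowerSeries.C (PowerSeries.constantCoeff φ)) := by
  obtain ⟨f, f1, f2, f3⟩ := hx
  rw [Nat.mod_mod] at f1
  refine ⟨fun i => if i = 0 then 0 else f i, ?_, fun i => ?_, fun i hi => ?_⟩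
  · have h0 : x % S ^ 6 % S = f 0 := by
      have := digit_eq (fun i => (f2 i).trans_lt hS) (n := 6) (d := 0) (by norm_num)
      rwa [pow_zero, Nat.div_one, ← f1] at this
    have h1 : x % S ^ 6 - x % S ^ 6 % S = ∑ i ∈ Finset.range 6, (if i = 0 then 0 else f i) * S ^ i := by
      rw [h0, f1]
      simp only [Finset.sum_range_succ', ↓reduceIte]
      simp
    rw [h1, Nat.mod_eq_of_lt]
    refine sum_digits_lt (fun i => ?_) 6
    split_ifs
    · exact (Nat.zero_le _).trans_lt hS
    · exact (f2 i).trans_lt hS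
  · dsimp only
    split_ifs
    · exact Nat.zero_le _
    · exact f2 i
  · dsimp only
    split_ifs with h
    · subst h; simp
    · rw [f3 i hi, map_sub, PowerSeries.coeff_C, if_neg h, sub_zero]

/-! ### Packed Taylor polynomials of the `ζ_k` and of their inverses -/

/-- The three coefficients of `ζ_k` along the line through `y` with direction `v`, modulo 31. -/
def zetaCoef (y v : Fin 5 → ℕ) : Fin 10 → ℕ × ℕ × ℕ :=
  let f := fun i => (y i, v i, 0)
  let g := fun a b c => ((1 + y a + 30 * (y b * y c)) % 31,
    (v a + 30 * (y b * v c + v b * y c)) % 31, 30 * (v b * v c) % 31)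
  ![f 0, f 1, f 2, f 3, f 4, g 3 2 4, g 0 4 1, g 2 1 3, g 4 0 3, g 1 0 2]

theorem zetaR_lineSer (y v : Fin 5 → ℕ) (k : Fin 10) :
    zetaR (lineSer (fun i => (y i : ZMod 31)) (fun i => (v i : ZMod 31))) k =
      PowerSeries.C ((zetaCoef y v k).1 : ZMod 31) +
      PowerSeries.C ((zetaCoef y v k).2.1 : ZMod 31) * PowerSeries.X +
      PowerSeries.C ((zetaCoef y v k).2.2 : ZMod 31) * PowerSeries.X ^ 2 := by
  have h30 : (30 : ZMod 31) = -1 := by decide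
  fin_cases k <;> simp [zetaR, lineSer, zetaCoef, h30] <;> ring

theorem zetaCoef_le {y v : Fin 5 → ℕ} (hy : ∀ i, y i ≤ 31) (hv : ∀ i, v i ≤ 31) (k : Fin 10) :
    (zetaCoef y v k).1 ≤ 31 ∧ (zetaCoef y v k).2.1 ≤ 31 ∧ (zetaCoef y v k).2.2 ≤ 31 := by
  have h (a : ℕ) : a % 31 ≤ 31 := (Nat.mod_lt a (by norm_num)).le
  fin_cases k <;> simp [zetaCoef, hy, hv, h]

/-- The packed Taylor polynomial of `ζ_k`. -/
def zetaPack (S : ℕ) (z : ℕ × ℕ × ℕ) : ℕ :=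
  Nat.add z.1 (Nat.mul S (Nat.add z.2.1 (Nat.mul S z.2.2)))

/-- The packed Taylor polynomial of `1 / ζ_k`. -/
def invPack (S : ℕ) (z : ℕ × ℕ × ℕ) : ℕ :=
  -- By Fermat, the power 29 = 31 - 2 is the inverse of the constant term. The next digits follow
  -- the recurrence `r_{n+2} = -r₀ (b r_{n+1} + c r_n)` for the reciprocal of `a + b t + c t²`, with
  -- `31 - r₀` for `-r₀`.
  force (Nat.mod (Nat.pow z.1 29) 31) fun r0 =>
  force (Nat.mod (Nat.mul (Nat.sub 31 r0) (Nat.mul z.2.1 r0)) 31) fun r1 =>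
  force (Nat.mod (Nat.mul (Nat.sub 31 r0) (Nat.add (Nat.mul z.2.1 r1) (Nat.mul z.2.2 r0))) 31) fun r2 =>
  force (Nat.mod (Nat.mul (Nat.sub 31 r0) (Nat.add (Nat.mul z.2.1 r2) (Nat.mul z.2.2 r1))) 31) fun r3 =>
  force (Nat.mod (Nat.mul (Nat.sub 31 r0) (Nat.add (Nat.mul z.2.1 r3) (Nat.mul z.2.2 r2))) 31) fun r4 =>
  force (Nat.mod (Nat.mul (Nat.sub 31 r0) (Nat.add (Nat.mul z.2.1 r4) (Nat.mul z.2.2 r3))) 31) fun r5 =>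
  Nat.add r0 (Nat.mul S (Nat.add r1 (Nat.mul S (Nat.add r2 (Nat.mul S (Nat.add r3
    (Nat.mul S (Nat.add r4 (Nat.mul S r5)))))))))

theorem packed_of_digits {S : ℕ} (hS : 186 < S) {φ : PowerSeries (ZMod 31)} {x : ℕ} (f : ℕ → ℕ)
    (h1 : x = ∑ i ∈ Finset.range 6, f i * S ^ i) (h2 : ∀ i, f i ≤ 31)
    (h3 : ∀ i < 6, (f i : ZMod 31) = PowerSeries.coeff i φ) : Packed S 1 x φ :=
  ⟨f, by rw [h1, Nat.mod_eq_of_lt (sum_digits_lt (fun i => (h2 i).trans_lt (by omega)) 6)],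
    fun i => (h2 i).trans (by norm_num), h3⟩

theorem packed_zetaPack {S : ℕ} (hS : 186 < S) {z : ℕ × ℕ × ℕ} (h1 : z.1 ≤ 31) (h2 : z.2.1 ≤ 31)
    (h3 : z.2.2 ≤ 31) : Packed S 1 (zetaPack S z) (PowerSeries.C (z.1 : ZMod 31) +
      PowerSeries.C (z.2.1 : ZMod 31) * PowerSeries.X +
      PowerSeries.C (z.2.2 : ZMod 31) * PowerSeries.X ^ 2) := by
  refine packed_of_digits hS (fun i => match i with | 0 => z.1 | 1 => z.2.1 | 2 => z.2.2 | _ => 0)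
    ?_ ?_ ?_
  · change z.1 + S * (z.2.1 + S * z.2.2) = _
    simp [Finset.sum_range_succ]
    ring
  · intro i
    rcases i with _ | _ | _ | i <;> simp [h1, h2, h3]
  · intro i hi
    simp only [map_add, PowerSeries.coeff_C_mul, PowerSeries.coeff_X_pow, PowerSeries.coeff_X,
      PowerSeries.coeff_C]
    interval_cases i <;> simp

theorem packed_invPack {S : ℕ} (hS : 186 < S) {z : ℕ × ℕ × ℕ}
    {W : PowerSeries (ZMod 31)} (hW : (PowerSeries.C (z.1 : ZMod 31) +
      PowerSeries.C (z.2.1 : ZMod 31) * PowerSeries.X +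
      PowerSeries.C (z.2.2 : ZMod 31) * PowerSeries.X ^ 2) * W = 1) :
    Packed S 1 (invPack S z) W := by
  have hc (n : ℕ) := congrArg (PowerSeries.coeff n) hW
  have c0 : (z.1 : ZMod 31) * PowerSeries.coeff 0 W = 1 := by
    have := hc 0
    simp only [add_mul, mul_assoc, map_add, PowerSeries.coeff_C_mul] at this
    simpa using this
  have c1 : (z.1 : ZMod 31) * PowerSeries.coeff 1 W +
      (z.2.1 : ZMod 31) * PowerSeries.coeff 0 W = 0 := by
    have := hc 1
    have h1 : PowerSeries.coeff 1 (PowerSeries.X * W) = PowerSeries.coeff 0 W :=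
      PowerSeries.coeff_succ_X_mul 0 W
    simp only [add_mul, mul_assoc, map_add, PowerSeries.coeff_C_mul, PowerSeries.coeff_X_pow_mul',
      h1, PowerSeries.coeff_one] at this
    simpa using this
  have c2 (n : ℕ) : (z.1 : ZMod 31) * PowerSeries.coeff (n + 2) W +
      (z.2.1 : ZMod 31) * PowerSeries.coeff (n + 1) W +
      (z.2.2 : ZMod 31) * PowerSeries.coeff n W = 0 := by
    have := hc (n + 2)
    simp only [add_mul, mul_assoc, map_add, PowerSeries.coeff_C_mul, PowerSeries.coeff_X_pow_mul',
      PowerSeries.coeff_succ_X_mul, PowerSeries.coeff_one] at this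
    simpa using this
  have hz : (z.1 : ZMod 31) ≠ 0 := left_ne_zero_of_mul_eq_one c0
  have hf : (z.1 : ZMod 31) ^ 29 * (z.1 : ZMod 31) = 1 := by
    rw [← pow_succ]; exact ZMod.pow_card_sub_one_eq_one hz
  set c : ZMod 31 := (z.1 : ZMod 31) ^ 29 with hcdef
  set r0 := z.1 ^ 29 % 31 with hr0
  set r1 := (31 - r0) * (z.2.1 * r0) % 31 with hr1
  set r2 := (31 - r0) * (z.2.1 * r1 + z.2.2 * r0) % 31 with hr2
  set r3 := (31 - r0) * (z.2.1 * r2 + z.2.2 * r1) % 31 with hr3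
  set r4 := (31 - r0) * (z.2.1 * r3 + z.2.2 * r2) % 31 with hr4
  set r5 := (31 - r0) * (z.2.1 * r4 + z.2.2 * r3) % 31 with hr5
  have e0 : (r0 : ZMod 31) = c := by rw [hr0, ZMod.natCast_mod, Nat.cast_pow]
  have hm : ((31 - r0 : ℕ) : ZMod 31) = -c := by
    rw [Nat.cast_sub (Nat.mod_lt _ (by norm_num)).le, e0,
      show ((31 : ℕ) : ZMod 31) = 0 from ZMod.natCast_self 31, zero_sub]
  have w0 : (r0 : ZMod 31) = PowerSeries.coeff 0 W := by
    rw [e0]; linear_combination -c * c0 + PowerSeries.coeff 0 W * hf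
  have w1 : (r1 : ZMod 31) = PowerSeries.coeff 1 W := by
    rw [hr1, ZMod.natCast_mod]; push_cast; rw [hm, w0]
    linear_combination -c * c1 + PowerSeries.coeff 1 W * hf
  have w2 : (r2 : ZMod 31) = PowerSeries.coeff 2 W := by
    rw [hr2, ZMod.natCast_mod]; push_cast; rw [hm, w0, w1]
    linear_combination -c * c2 0 + PowerSeries.coeff 2 W * hf
  have w3 : (r3 : ZMod 31) = PowerSeries.coeff 3 W := by
    rw [hr3, ZMod.natCast_mod]; push_cast; rw [hm, w1, w2]
    linear_combination -c * c2 1 + PowerSeries.coeff 3 W * hf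
  have w4 : (r4 : ZMod 31) = PowerSeries.coeff 4 W := by
    rw [hr4, ZMod.natCast_mod]; push_cast; rw [hm, w2, w3]
    linear_combination -c * c2 2 + PowerSeries.coeff 4 W * hf
  have w5 : (r5 : ZMod 31) = PowerSeries.coeff 5 W := by
    rw [hr5, ZMod.natCast_mod]; push_cast; rw [hm, w3, w4]
    linear_combination -c * c2 3 + PowerSeries.coeff 5 W * hf
  have hm31 (a : ℕ) : a % 31 ≤ 31 := (Nat.mod_lt a (by norm_num)).le
  refine packed_of_digits hS (fun i => match i with
    | 0 => r0 | 1 => r1 | 2 => r2 | 3 => r3 | 4 => r4 | 5 => r5 | _ => 0) ?_ ?_ ?_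
  · change r0 + S * (r1 + S * (r2 + S * (r3 + S * (r4 + S * r5)))) = _
    simp [Finset.sum_range_succ]
    ring
  · intro i
    rcases i with _ | _ | _ | _ | _ | _ | i
    exacts [hm31 _, hm31 _, hm31 _, hm31 _, hm31 _, hm31 _, Nat.zero_le _]
  · intro i hi
    interval_cases i
    exacts [w0, w1, w2, w3, w4, w5]

end

end GMWeb

namespace GMWeb

noncomputable section

/-! ### The rank of the system of Taylor coefficients at a point over `𝔽₃₁` -/

/-- The exponents `1` and `-1` in the factorisation of `U_{l,s}`, for `s = 1, 2`. -/
def expoFac : Fin 10 → Fin 2 → List (Fin 10) × List (Fin 10) :=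
  ![![([3], []), ([2, 4], [])], ![([], [0]), ([1, 4], [0])], ![([2], []), ([1, 3], [])],
    ![([], [4]), ([0, 3], [4])], ![([1], []), ([0, 2], [])], ![([6], [1, 8]), ([0, 7], [1, 8])],
    ![([5], [2, 8]), ([7], [2, 8])], ![([0, 5], [8]), ([6], [8])], ![([1, 5], [7]), ([2, 6], [7])],
    ![([5], [4, 7]), ([3, 6], [4, 7])]]

theorem prod_fin_ten {M : Type*} [CommMonoid M] (f : Fin 10 → M) :
    ∏ k, f k = f 0 * f 1 * f 2 * f 3 * f 4 * f 5 * f 6 * f 7 * f 8 * f 9 := by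
  rw [Fin.prod_univ_castSucc, Fin.prod_univ_castSucc, Fin.prod_univ_eight]
  rfl

theorem sum_fin_ten {M : Type*} [AddCommMonoid M] (f : Fin 10 → M) :
    ∑ k, f k = f 0 + f 1 + f 2 + f 3 + f 4 + f 5 + f 6 + f 7 + f 8 + f 9 := by
  rw [Fin.sum_univ_castSucc, Fin.sum_univ_castSucc, Fin.sum_univ_eight]
  rfl

theorem prod_expoFac {G : Type*} [CommGroup G] (g : Fin 10 → G) (l : Fin 10) (s : Fin 2) :
    ∏ k, g k ^ expo l s.castSucc k =
      ((expoFac l s).1.map g).prod * ((expoFac l s).2.map fun k => (g k)⁻¹).prod := by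
  fin_cases l <;> fin_cases s <;>
    simp [expo, expoFac, prod_fin_ten, mul_assoc, mul_comm, mul_left_comm]

/-- Each factor costs two units of digit exponent, one for its own digits and one for the product.
Four factors give the exponent 8 used for the differences `U_{l,s} - U_{l,s}(y)`. -/
theorem length_expoFac (l : Fin 10) (s : Fin 2) :
    (expoFac l s).1.length + (expoFac l s).2.length ≤ 4 := by
  fin_cases l <;> fin_cases s <;> simp [expoFac]

/-- The product of packed series prescribed by `expoFac`. -/
def prodPack (zs zi : List ℕ) (a : List (Fin 10) × List (Fin 10)) : ℕ :=
  a.2.foldr (fun (k : Fin 10) x => Nat.mul (zi.getD k 0) x)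
    (a.1.foldr (fun (k : Fin 10) x => Nat.mul (zs.getD k 0) x) 1)

theorem packed_foldr {S : ℕ} {zs : List ℕ} {φ : Fin 10 → PowerSeries (ZMod 31)}
    (hz : ∀ k : Fin 10, Packed S 1 (zs.getD k 0) (φ k)) (a : List (Fin 10)) {n x : ℕ}
    {ψ : PowerSeries (ZMod 31)} (hx : Packed S n x ψ) (hS : 186 ^ (n + 2 * a.length) < S) :
    Packed S (n + 2 * a.length) (a.foldr (fun (k : Fin 10) x => Nat.mul (zs.getD k 0) x) x)
      ((a.map φ).prod * ψ) := by
  induction a with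
  | nil => simpa using hx
  | cons k a ih =>
    have h := ih (lt_of_le_of_lt (Nat.pow_le_pow_right (by norm_num) (by simp)) hS)
    rw [List.foldr_cons, List.map_cons, List.prod_cons, mul_assoc]
    have e : n + 2 * (k :: a).length = 1 + (n + 2 * a.length) + 1 := by
      rw [List.length_cons]; ring
    rw [e] at hS ⊢
    exact (hz k).mul h hS

/-- The packed Taylor polynomial of `U_{l,s} - U_{l,s}(y)`. -/
def uPack (S : ℕ) (zs zi : List ℕ) (a : List (Fin 10) × List (Fin 10)) : ℕ :=
  force (Nat.mod (prodPack zs zi a) (Nat.pow S 6)) fun u => Nat.sub u (Nat.mod u S)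

theorem packed_uPack {S : ℕ} {zs zi : List ℕ} {y v : Fin 5 → ZMod 31}
    (hy : ∀ k, IsUnit (zetaR y k))
    (hzs : ∀ k : Fin 10, Packed S 1 (zs.getD k 0) (zetaUnit hy v k : PowerSeries (ZMod 31)))
    (hzi : ∀ k : Fin 10, Packed S 1 (zi.getD k 0)
      (((zetaUnit hy v k)⁻¹ : (PowerSeries (ZMod 31))ˣ) : PowerSeries (ZMod 31)))
    (hS : 186 ^ 8 < S) (l : Fin 10) (s : Fin 2) :
    Packed S 8 (uPack S zs zi (expoFac l s)) (uSer hy v l s.castSucc) := by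
  have hlen := length_expoFac l s
  have h1 := packed_foldr hzs (expoFac l s).1 (n := 0) (x := 1) (ψ := 1)
    (Packed.one (lt_of_le_of_lt (by norm_num) hS))
    (lt_of_le_of_lt (Nat.pow_le_pow_right (by norm_num) (by omega)) hS)
  have h2 := packed_foldr hzi (expoFac l s).2 h1
    (lt_of_le_of_lt (Nat.pow_le_pow_right (by norm_num) (by omega)) hS)
  have e : USer hy v l s.castSucc =
      ((expoFac l s).2.map fun k =>
        (((zetaUnit hy v k)⁻¹ : (PowerSeries (ZMod 31))ˣ) : PowerSeries (ZMod 31))).prod *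
      (((expoFac l s).1.map fun k => (zetaUnit hy v k : PowerSeries (ZMod 31))).prod * 1) := by
    rw [USer, prod_expoFac, mul_one, mul_comm, Units.val_mul]
    congr 1
    · rw [← Units.coeHom_apply, map_list_prod, List.map_map]; rfl
    · rw [← Units.coeHom_apply, map_list_prod, List.map_map]; rfl
  rw [← e] at h2
  exact ((h2.mono (by omega : _ ≤ 8)).mod.sub_const hS)

/-- The coordinates of the 2-jets used to parametrise abelian relations. -/
def freeCoord (l : Fin 10) (i j : ℕ) : Bool :=
  -- Fifteen free coordinates of order 1 and ten of order 2, which makes 25. None has order 3 or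
  -- more.
  bif Nat.beq (Nat.add i j) 1 then Nat.ble 3 l || (Nat.beq l 2 && Nat.beq j 1)
  else bif Nat.beq (Nat.add i j) 2 then
    Nat.ble 8 l || (Nat.beq l 7 && Nat.ble 1 j) || (Nat.ble 5 l && Nat.beq j 2)
  else false

/-- The other coordinates, by decreasing order. -/
def jetCols : List (Fin 10 × ℕ × ℕ) :=
  ([5, 4, 3, 2, 1] : List ℕ).flatMap fun e => (List.finRange 10).flatMap fun l =>
    ((List.range (e + 1)).map fun j => (l, e - j, j)).filter fun c => !freeCoord c.1 c.2.1 c.2.2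

/-- The directions of the lines, written in base 3. -/
def dirCodes : List ℕ :=
  [1, 3, 9, 27, 81, 4, 10, 28, 82, 12, 30, 84, 36, 90, 108, 5, 11, 29, 83, 15, 33, 87, 45, 99, 135,
    13, 31, 85, 37, 91, 109, 39, 93, 111, 117, 7, 19, 55, 163, 21, 57, 165, 63, 171, 189, 14, 32,
    86, 38, 92, 110, 16, 34, 88, 46, 100, 136, 42, 96, 22, 58]

/-- The direction with a given code. -/
def dirVec (n : ℕ) : Fin 5 → ℕ :=
  ![Nat.mod n 3, Nat.mod (Nat.div n 3) 3, Nat.mod (Nat.div n 9) 3, Nat.mod (Nat.div n 27) 3,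
    Nat.mod (Nat.div n 81) 3]

/-- The base point. -/
def basePt : Fin 5 → ℕ := ![1, 3, 3, 1, 2]

/-- The packed Taylor polynomials of the monomials in the `U_{l,s} - U_{l,s}(y)`. -/
def taylorTable (S n : ℕ) : List ℕ :=
  forceList ((List.finRange 10).map fun k => zetaPack S (zetaCoef basePt (dirVec n) k)) fun zs =>
  forceList ((List.finRange 10).map fun k => invPack S (zetaCoef basePt (dirVec n) k)) fun zi =>
  forceList ((List.finRange 10).map fun l => uPack S zs zi (expoFac l 0)) fun u =>
  forceList ((List.finRange 10).map fun l => uPack S zs zi (expoFac l 1)) fun w =>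
  jetCols.map fun c =>
    Nat.mod (Nat.mul (Nat.pow (u.getD c.1 0) c.2.1) (Nat.pow (w.getD c.1 0) c.2.2)) (Nat.pow S 6)

/-- Evaluate `f` at the list of the tables of several directions. -/
def withTables {α : Type} (S : ℕ) : List ℕ → (List (List ℕ) → α) → α
  | [], f => f []
  | n :: ns, f => forceList (taylorTable S n) fun t => withTables S ns fun T => f (t :: T)

theorem withTables_eq {α : Type} (S : ℕ) (ns : List ℕ) (f : List (List ℕ) → α) :
    withTables S ns f = f (ns.map (taylorTable S)) := by
  induction ns generalizing f with
  | nil => rfl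
  | cons n ns ih => rw [withTables, forceList_eq, ih]; rfl

/-- Elimination of a block of columns, using Taylor coefficients of order `d` along `m` lines. -/
def elimBlock (B S n d k m : ℕ) (T : List (List ℕ)) (left : List ℕ) : Option (List ℕ) :=
  force (Nat.pow S d) fun Sd =>
    forceList (left ++ ((T.take m).map fun t =>
      packRow B (fun P => Nat.mod (Nat.div P Sd) S) (t.drop k))) fun rows => elimN B n rows

/-- The elimination succeeds. -/
def rankCheck : Bool :=
  -- The bases are large enough for digits never to overflow: `186 ^ 50 < 2 ^ 400` for the packed
  -- series and `62 ^ 175 * 31 < 2 ^ 1100` for the packed rows.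
  force (Nat.add (Nat.pow 2 400) 1) fun S => force (Nat.add (Nat.pow 2 1100) 1) fun B =>
    withTables S dirCodes fun T =>
      -- The 175 columns are sorted by decreasing order, in blocks of 60, 50, 40, 20 and 5.
      -- Coefficients of degree `d` see only the columns of order at most `d`, so the first 0, 60,
      -- 110, 150 and 170 columns are skipped. The rows left over from one block join the next; the
      -- 61 + 59 + 35 + 15 + 5 rows form a square system.
      ((((((elimBlock B S 60 5 0 61 T []).bind fun r => elimBlock B S 50 4 60 59 T r).bind
        fun r => elimBlock B S 40 3 110 35 T r).bind fun r => elimBlock B S 20 2 150 15 T r).bind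
        fun r => elimBlock B S 5 1 170 5 T r)).isSome

set_option maxRecDepth 1000000 in
theorem rankCheck_eq_true : rankCheck = true := by decide +kernel

end

end GMWeb

namespace GMWeb

noncomputable section

/-! ### Jets of abelian relations are determined by 25 coordinates -/

theorem basePt_le (i : Fin 5) : basePt i ≤ 31 := by
  fin_cases i <;> decide

theorem dirVec_le (n : ℕ) (i : Fin 5) : dirVec n i ≤ 31 := by
  have h (a : ℕ) : a % 3 ≤ 31 := (Nat.mod_lt a (by norm_num)).le.trans (by norm_num)
  fin_cases i <;> exact h _

theorem isUnit_basePt (k : Fin 10) : IsUnit (zetaR (fun i => (basePt i : ZMod 31)) k) := by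
  rw [isUnit_iff_ne_zero]
  revert k
  decide

theorem getD_map_finRange (f : Fin 10 → ℕ) (k : Fin 10) :
    ((List.finRange 10).map f).getD k 0 = f k := by
  simp [List.getD_eq_getElem?_getD]

theorem order_le_of_mem_jetCols {c : Fin 10 × ℕ × ℕ} (hc : c ∈ jetCols) : c.2.1 + c.2.2 ≤ 5 := by
  revert c; decide +kernel

/-- The Taylor coefficients over `𝔽₃₁` at the base point. -/
def tcoefBase (n d : ℕ) (c : Fin 10 × ℕ × ℕ) : ZMod 31 :=
  tcoef isUnit_basePt (fun i => (dirVec n i : ZMod 31)) d c.1 c.2.1 c.2.2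

/-- The differences have digit exponent 8, so powers `i` and `j` have exponents `9 * i` and `9 * j`.
A monomial of order at most 5 stays below `9 * 5 + 1 = 46`, within the margin of 50. -/
theorem taylorTable_spec {S : ℕ} (hS : 186 ^ 50 < S) (n : ℕ) :
    ∃ g : Fin 10 × ℕ × ℕ → ℕ, taylorTable S n = jetCols.map g ∧
      ∀ c ∈ jetCols, ∀ d < 6, ((g c / S ^ d % S : ℕ) : ZMod 31) = tcoefBase n d c := by
  have hS1 : 186 < S := lt_of_le_of_lt (by norm_num) hS
  have hS8 : 186 ^ 8 < S := lt_of_le_of_lt (Nat.pow_le_pow_right (by norm_num) (by norm_num)) hS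
  have hz (k : Fin 10) := zetaCoef_le basePt_le (dirVec_le n) k
  have hzs (k : Fin 10) : Packed S 1
      (((List.finRange 10).map fun k => zetaPack S (zetaCoef basePt (dirVec n) k)).getD k 0)
      (zetaUnit isUnit_basePt (fun i => (dirVec n i : ZMod 31)) k : PowerSeries (ZMod 31)) := by
    rw [getD_map_finRange, coe_zetaUnit, zetaR_lineSer]
    exact packed_zetaPack hS1 (hz k).1 (hz k).2.1 (hz k).2.2
  have hzi (k : Fin 10) : Packed S 1
      (((List.finRange 10).map fun k => invPack S (zetaCoef basePt (dirVec n) k)).getD k 0)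
      (((zetaUnit isUnit_basePt (fun i => (dirVec n i : ZMod 31)) k)⁻¹ : (PowerSeries (ZMod 31))ˣ) :
        PowerSeries (ZMod 31)) := by
    rw [getD_map_finRange]
    refine packed_invPack hS1 ?_
    rw [← zetaR_lineSer, ← coe_zetaUnit isUnit_basePt, Units.mul_inv]
  rw [taylorTable, forceList_eq, forceList_eq, forceList_eq, forceList_eq]
  refine ⟨_, rfl, fun c hc d hd => ?_⟩
  have hu (s : Fin 2) := packed_uPack isUnit_basePt hzs hzi hS8 c.1 s
  have hc5 := order_le_of_mem_jetCols hc
  have hp (m : ℕ) (hm : m ≤ 50) : 186 ^ m < S :=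
    lt_of_le_of_lt (Nat.pow_le_pow_right (by norm_num) hm) hS
  have h := ((hu 0).pow c.2.1 (hp _ (by omega))).mul ((hu 1).pow c.2.2 (hp _ (by omega)))
    (hp _ (by omega))
  rw [getD_map_finRange, getD_map_finRange]
  exact h.digit hd (hp _ (by omega))

theorem rowDot_map {α : Type*} (L : List α) (f : α → ℕ) (x : α → ZMod 31) :
    rowDot (L.map f) (L.map x) = (L.map fun a => (f a : ZMod 31) * x a).sum := by
  rw [rowDot, List.zipWith_map, List.zipWith_self]

/-- The skipped columns have order larger than `d`, so their coefficients in the equations of degree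
`d` are zero, and the shortened rows still vanish on the remaining unknowns. -/
theorem elimBlock_sound {B S n d k m b : ℕ} (hS : 186 ^ 50 < S) (hd : d < 6)
    {x : Fin 10 × ℕ × ℕ → ZMod 31}
    (hx : ∀ n ∈ dirCodes, (jetCols.map fun c => tcoefBase n d c * x c).sum = 0)
    (hk : ∀ c ∈ jetCols.take k, d < c.2.1 + c.2.2) (hn : k + n ≤ 175)
    {left r : List ℕ} (hleft : ∀ R ∈ left, RowSol B b R ((jetCols.drop k).map x)) (hb31 : 31 ≤ b)
    (hb : 62 ^ n * b < B)
    (h : elimBlock B S n d k m (dirCodes.map (taylorTable S)) left = some r) :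
    (∀ R ∈ r, RowSol B (62 ^ n * b) R ((jetCols.drop (k + n)).map x)) ∧
      ((∀ z ∈ (jetCols.drop (k + n)).map x, z = 0) → ∀ z ∈ (jetCols.drop k).map x, z = 0) := by
  rw [elimBlock, force_eq, forceList_eq] at h
  have hlen : jetCols.length = 175 := by decide +kernel
  have := elimN_sound n (b := b) (X := (jetCols.drop k).map x) (fun R hR => ?_)
    (by rw [List.length_map, List.length_drop, hlen]; omega) hb h
  · rwa [← List.map_drop, List.drop_drop] at this
  · rcases List.mem_append.1 hR with h1 | h1
    · exact hleft R h1
    · obtain ⟨t, ht, rfl⟩ := List.mem_map.1 h1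
      obtain ⟨ν, hν, rfl⟩ := List.mem_map.1 (List.mem_of_mem_take ht)
      obtain ⟨g, hg, hg'⟩ := taylorTable_spec hS ν
      rw [hg, ← List.map_drop]
      refine (rowSol_packRow (by simp) ?_).mono hb31
      rw [List.map_map, rowDot_map]
      have h2 := hx ν hν
      rw [← List.take_append_drop k jetCols, List.map_append, List.sum_append] at h2
      have h3 : ((jetCols.take k).map fun c => tcoefBase ν d c * x c).sum = 0 := by
        refine List.sum_eq_zero fun a ha => ?_
        obtain ⟨c, hc, rfl⟩ := List.mem_map.1 ha
        rw [tcoefBase, tcoef_of_lt _ _ _ (hk c hc), zero_mul]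
      rw [h3, zero_add] at h2
      rw [← h2]
      refine congrArg List.sum (List.map_congr_left fun c hc => ?_)
      congr 1
      exact hg' c (List.mem_of_mem_drop hc) d hd

/-- The blocks are chained forwards, each handing its unused rows to the next one. The vanishing of
the unknowns is then read backwards, from order 1 up to order 5. -/
theorem eq_zero_of_tcoefBase {x : Fin 10 × ℕ × ℕ → ZMod 31}
    (hx : ∀ n ∈ dirCodes, ∀ d < 6, (jetCols.map fun c => tcoefBase n d c * x c).sum = 0) :
    ∀ c ∈ jetCols, x c = 0 := by
  have h := rankCheck_eq_true
  rw [rankCheck, force_eq, force_eq, withTables_eq, Option.isSome_iff_exists] at h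
  obtain ⟨r, h⟩ := h
  obtain ⟨r4, h, h1⟩ := Option.bind_eq_some_iff.1 h
  obtain ⟨r3, h, h2⟩ := Option.bind_eq_some_iff.1 h
  obtain ⟨r2, h, h3⟩ := Option.bind_eq_some_iff.1 h
  obtain ⟨r1, h5, h4⟩ := Option.bind_eq_some_iff.1 h
  have hS : 186 ^ 50 < Nat.add (Nat.pow 2 400) 1 := by decide +kernel
  have hx' (d : ℕ) (hd : d < 6) (n : ℕ) (hn : n ∈ dirCodes) := hx n hn d hd
  obtain ⟨a1, b1⟩ := elimBlock_sound (b := 31) hS (by norm_num) (hx' 5 (by norm_num))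
    (by decide +kernel) (by norm_num) (by simp) le_rfl (by decide +kernel) h5
  obtain ⟨a2, b2⟩ := elimBlock_sound hS (by norm_num) (hx' 4 (by norm_num))
    (by decide +kernel) (by norm_num) a1 (by decide +kernel) (by decide +kernel) h4
  obtain ⟨a3, b3⟩ := elimBlock_sound hS (by norm_num) (hx' 3 (by norm_num))
    (by decide +kernel) (by norm_num) a2 (by decide +kernel) (by decide +kernel) h3
  obtain ⟨a4, b4⟩ := elimBlock_sound hS (by norm_num) (hx' 2 (by norm_num))
    (by decide +kernel) (by norm_num) a3 (by decide +kernel) (by decide +kernel) h2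
  obtain ⟨-, b5⟩ := elimBlock_sound hS (by norm_num) (hx' 1 (by norm_num))
    (by decide +kernel) (by norm_num) a4 (by decide +kernel) (by decide +kernel) h1
  have hlen : jetCols.length = 175 := by decide +kernel
  have h0 := b1 (b2 (b3 (b4 (b5 (by
    rw [List.drop_eq_nil_of_le (by rw [hlen])]; simp)))))
  exact fun c hc => h0 (x c) (List.mem_map_of_mem (by simpa using hc))

/-- The indices of the coordinates of 5-jets. -/
def jetIndex : Finset (Fin 10 × ℕ × ℕ) :=
  (Finset.univ ×ˢ (Finset.range 6 ×ˢ Finset.range 6)).filter fun c =>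
    1 ≤ c.2.1 + c.2.2 ∧ c.2.1 + c.2.2 ≤ 5

theorem specialize_dirVec {K : Type*} [CommRing K] {y : Fin 5 → K} (hy : ∀ k, IsUnit (zetaR y k))
    (n d : ℕ) (c : Fin 10 × ℕ × ℕ) :
    specialize hy (tcoef isUnit_genPt (fun i => (((dirVec n i : ℕ) : ℤ) : GenRing)) d
      c.1 c.2.1 c.2.2) = tcoef hy (fun i => (dirVec n i : K)) d c.1 c.2.1 c.2.2 := by
  rw [specialize_tcoef]
  simp only [Int.cast_natCast]

/-- Every non-empty open set contains a point where the 5-jets of abelian relations are determined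
by their free coordinates. -/
theorem exists_generic_point {D : Set C5} (hD : IsOpen D) (hne : D.Nonempty) (hDY : D ⊆ Ystar) :
    ∃ (y : C5) (hy : y ∈ Ystar), y ∈ D ∧ ∀ x : Fin 10 × ℕ × ℕ → ℂ,
      (∀ c ∈ jetIndex, freeCoord c.1 c.2.1 c.2.2 = true → x c = 0) →
      (∀ (v : C5) (d : ℕ), d ≤ 5 → ∑ c ∈ jetIndex,
        tcoef (isUnit_of_mem_Ystar hy) v d c.1 c.2.1 c.2.2 * x c = 0) →
      ∀ c ∈ jetIndex, x c = 0 := by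
  have hnd : jetCols.Nodup := by decide +kernel
  have hset : jetCols.toFinset = jetIndex.filter fun c => ¬ freeCoord c.1 c.2.1 c.2.2 = true := by
    decide +kernel
  let M : Matrix (dirCodes.toFinset × Fin 6) jetCols.toFinset GenRing := fun r c =>
    tcoef isUnit_genPt (fun i => (((dirVec r.1 i : ℕ) : ℤ) : GenRing)) r.2 c.1.1 c.1.2.1 c.1.2.2
  obtain ⟨y, hy, hyD, hinj⟩ := exists_injective_of_zmod hD hne hDY isUnit_basePt M (by
    intro x hx
    let x' : Fin 10 × ℕ × ℕ → ZMod 31 := fun c => if h : c ∈ jetCols.toFinset then x ⟨c, h⟩ else 0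
    have hx' := eq_zero_of_tcoefBase (x := x') (fun n hn d hd => by
      have := congrFun hx (⟨n, List.mem_toFinset.2 hn⟩, ⟨d, hd⟩)
      rw [← List.sum_toFinset _ hnd, ← Finset.sum_coe_sort]
      rw [Matrix.mulVec, dotProduct] at this
      refine Eq.trans (Finset.sum_congr rfl fun c _ => ?_) this
      simp only [x', dif_pos c.2]
      exact congrArg (· * x c) (specialize_dirVec isUnit_basePt n d c.1).symm)
    funext c
    have := hx' c.1 (List.mem_toFinset.1 c.2)
    simp only [x', dif_pos c.2] at this
    exact this)
  refine ⟨y, hy, hyD, fun x hx0 hx => ?_⟩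
  have h0 := hinj (fun c => x c) (by
    funext r
    have := hx (fun i => (dirVec r.1 i : ℂ)) r.2 (by omega)
    rw [← Finset.sum_filter_add_sum_filter_not _ (fun c => freeCoord c.1 c.2.1 c.2.2 = true),
      Finset.sum_eq_zero (fun c hc => by
        rw [Finset.mem_filter] at hc; rw [hx0 c hc.1 hc.2, mul_zero]), zero_add, ← hset,
      ← Finset.sum_coe_sort] at this
    rw [Matrix.mulVec, dotProduct]
    refine Eq.trans (Finset.sum_congr rfl fun c _ => ?_) this
    exact congrArg (· * x c) (specialize_dirVec (isUnit_of_mem_Ystar hy) r.1 r.2 c.1))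
  intro c hc
  by_cases hf : freeCoord c.1 c.2.1 c.2.2 = true
  · exact hx0 c hc hf
  · have hc' : c ∈ jetCols.toFinset := by rw [hset, Finset.mem_filter]; exact ⟨hc, hf⟩
    exact congrFun h0 ⟨c, hc'⟩

end

end GMWeb

namespace GMWeb

open scoped Topology
open Filter

noncomputable section

/-! ### Differentials of the first integrals -/

theorem analyticAt_zeta (k : Fin 10) (y : C5) : AnalyticAt ℂ (zeta k) y := by
  have h (i : Fin 5) : AnalyticAt ℂ (fun y : C5 => y i) y :=
    (ContinuousLinearMap.proj (R := ℂ) (φ := fun _ : Fin 5 => ℂ) i).analyticAt y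
  have hz : zeta k = fun y => zetaR y k := funext fun y => zeta_eq_zetaR k y
  rw [hz]
  fin_cases k
  exacts [h 0, h 1, h 2, h 3, h 4,
    (analyticAt_const.add (h 3)).sub ((h 2).mul (h 4)),
    (analyticAt_const.add (h 0)).sub ((h 4).mul (h 1)),
    (analyticAt_const.add (h 2)).sub ((h 1).mul (h 3)),
    (analyticAt_const.add (h 4)).sub ((h 0).mul (h 3)),
    (analyticAt_const.add (h 1)).sub ((h 0).mul (h 2))]

theorem isOpen_Ystar : IsOpen Ystar := by
  rw [show Ystar = ⋂ k, {y | zeta k y ≠ 0} by ext; simp [Ystar]]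
  refine isOpen_iInter_of_finite fun k => isOpen_ne_fun ?_ continuous_const
  exact continuous_iff_continuousAt.2 fun y => (analyticAt_zeta k y).continuousAt

/-- The differential of `ζ_k` at `y`, applied to `v`. -/
def dzeta (y v : C5) : Fin 10 → ℂ :=
  ![v 0, v 1, v 2, v 3, v 4,
    v 3 - (y 2 * v 4 + v 2 * y 4), v 0 - (y 4 * v 1 + v 4 * y 1), v 2 - (y 1 * v 3 + v 1 * y 3),
    v 4 - (y 0 * v 3 + v 0 * y 3), v 1 - (y 0 * v 2 + v 0 * y 2)]

theorem fderiv_zeta_apply (k : Fin 10) (y v : C5) : fderiv ℂ (zeta k) y v = dzeta y v k := by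
  have h (i : Fin 5) : HasFDerivAt (fun y : C5 => y i)
      (ContinuousLinearMap.proj (R := ℂ) (φ := fun _ : Fin 5 => ℂ) i) y :=
    (ContinuousLinearMap.proj (R := ℂ) (φ := fun _ : Fin 5 => ℂ) i).hasFDerivAt
  have hq (a b c : Fin 5) := ((h a).const_add 1).sub ((h b).mul (h c))
  have hz : zeta k = fun y => zetaR y k := funext fun y => zeta_eq_zetaR k y
  rw [hz]
  fin_cases k
  · exact congrArg (· v) (h 0).fderiv
  · exact congrArg (· v) (h 1).fderiv
  · exact congrArg (· v) (h 2).fderiv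
  · exact congrArg (· v) (h 3).fderiv
  · exact congrArg (· v) (h 4).fderiv
  · refine (congrArg (· v) (hq 3 2 4).fderiv).trans ?_
    simp [dzeta, mul_comm]
  · refine (congrArg (· v) (hq 0 4 1).fderiv).trans ?_
    simp [dzeta, mul_comm]
  · refine (congrArg (· v) (hq 2 1 3).fderiv).trans ?_
    simp [dzeta, mul_comm]
  · refine (congrArg (· v) (hq 4 0 3).fderiv).trans ?_
    simp [dzeta, mul_comm]
  · refine (congrArg (· v) (hq 1 0 2).fderiv).trans ?_
    simp [dzeta, mul_comm]

theorem U_eventuallyEq {y : C5} (hy : y ∈ Ystar) (l : Fin 10) (s : Fin 3) :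
    U l s =ᶠ[𝓝 y] fun y => ∏ k, zeta k y ^ expo l s k :=
  Filter.eventuallyEq_of_mem (isOpen_Ystar.mem_nhds hy) fun _ hz => U_eq_prod hz l s

theorem U_ne_zero {y : C5} (hy : y ∈ Ystar) (l : Fin 10) (s : Fin 3) : U l s y ≠ 0 := by
  rw [U_eq_prod hy]
  exact Finset.prod_ne_zero_iff.2 fun k _ => zpow_ne_zero _ (hy k)

theorem analyticAt_U {y : C5} (hy : y ∈ Ystar) (l : Fin 10) (s : Fin 3) :
    AnalyticAt ℂ (U l s) y := by
  refine AnalyticAt.congr ?_ (U_eventuallyEq hy l s).symm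
  exact Finset.analyticAt_fun_prod _ fun k _ => (analyticAt_zeta k y).zpow (hy k)

/-- The logarithmic differential of a product of powers. -/
theorem hasFDerivAt_prod_zpow {ι : Type*} (I : Finset ι) {g : ι → C5 → ℂ} {y : C5}
    (hg : ∀ k, DifferentiableAt ℂ (g k) y) (h0 : ∀ k, g k y ≠ 0) (n : ι → ℤ) :
    HasFDerivAt (fun y => ∏ k ∈ I, g k y ^ n k)
      ((∏ k ∈ I, g k y ^ n k) • ∑ k ∈ I, (n k : ℂ) • (g k y)⁻¹ • fderiv ℂ (g k) y) y := by
  classical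
  induction I using Finset.induction_on with
  | empty => simpa using hasFDerivAt_const (1 : ℂ) y
  | insert a I ha ih =>
    simp only [Finset.prod_insert ha, Finset.sum_insert ha]
    have h1 : HasFDerivAt (fun y => g a y ^ n a)
        (((n a : ℂ) * g a y ^ (n a - 1)) • fderiv ℂ (g a) y) y :=
      (hasDerivAt_zpow (n a) _ (Or.inl (h0 a))).comp_hasFDerivAt y (hg a).hasFDerivAt
    refine (h1.mul ih).congr_fderiv ?_
    rw [zpow_sub_one₀ (h0 a)]
    ext v
    simp only [add_apply, smul_apply, smul_eq_mul]
    ring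

theorem dlogU_eq {y : C5} (hy : y ∈ Ystar) (l : Fin 10) (s : Fin 3) :
    dlogU l s y = ∑ k, (expo l s k : ℂ) • (zeta k y)⁻¹ • fderiv ℂ (zeta k) y := by
  have h := (hasFDerivAt_prod_zpow Finset.univ (fun k => (analyticAt_zeta k y).differentiableAt)
    hy (expo l s)).congr_of_eventuallyEq (U_eventuallyEq hy l s)
  rw [dlogU, h.fderiv, ← U_eq_prod hy, smul_smul, inv_mul_cancel₀ (U_ne_zero hy l s), one_smul]

theorem dlogU_apply {y : C5} (hy : y ∈ Ystar) (l : Fin 10) (s : Fin 3) (v : C5) :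
    dlogU l s y v = ∑ k, (expo l s k : ℂ) * (dzeta y v k / zeta k y) := by
  rw [dlogU_eq hy, sum_apply]
  refine Finset.sum_congr rfl fun k _ => ?_
  rw [smul_apply, smul_apply, fderiv_zeta_apply]
  simp only [smul_eq_mul]
  ring

theorem fderiv_U {y : C5} (hy : y ∈ Ystar) (l : Fin 10) (s : Fin 3) :
    fderiv ℂ (U l s) y = U l s y • dlogU l s y := by
  rw [dlogU, smul_smul, mul_inv_cancel₀ (U_ne_zero hy l s), one_smul]

/-- Two coordinates in which the Jacobian matrix of `U_l` is triangular. -/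
def transCoord : Fin 10 → Fin 5 × Fin 5 :=
  ![(2, 3), (1, 0), (1, 2), (0, 4), (0, 1), (2, 3), (1, 0), (1, 2), (0, 4), (0, 1)]

/-- A triangular 2 × 2 minor with nonzero diagonal: `U_l` is a submersion at every point of `Ystar`.
-/
theorem dlogU_transCoord {y : C5} (hy : y ∈ Ystar) (l : Fin 10) :
    dlogU l 0 y (Pi.single (transCoord l).1 1) = 0 ∧
      dlogU l 1 y (Pi.single (transCoord l).1 1) ≠ 0 ∧
      dlogU l 0 y (Pi.single (transCoord l).2 1) ≠ 0 := by
  have h0 := hy 0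
  have h1 := hy 1
  have h2 := hy 2
  have h3 := hy 3
  have h4 := hy 4
  have h5 := hy 5
  have h6 := hy 6
  have h7 := hy 7
  have h8 := hy 8
  simp only [dlogU_apply hy, sum_fin_ten]
  have hz0 : zeta 0 y = y 0 := zeta_eq_zetaR 0 y
  have hz1 : zeta 1 y = y 1 := zeta_eq_zetaR 1 y
  have hz2 : zeta 2 y = y 2 := zeta_eq_zetaR 2 y
  have hz3 : zeta 3 y = y 3 := zeta_eq_zetaR 3 y
  have hz4 : zeta 4 y = y 4 := zeta_eq_zetaR 4 y
  rw [hz0] at h0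
  rw [hz1] at h1
  rw [hz2] at h2
  rw [hz3] at h3
  rw [hz4] at h4
  fin_cases l <;> simp [expo, transCoord, dzeta, h0, h1, h2, h3, h4, h5, h6, h7, h8, hz0, hz1, hz2, hz3, hz4]

/-- Vectors dual to the differentials of `U_{l,1}` and `U_{l,2}`. -/
theorem exists_dual_vectors {y : C5} (hy : y ∈ Ystar) (l : Fin 10) : ∃ e₀ e₁ : C5,
    fderiv ℂ (U l 0) y e₀ = 1 ∧ fderiv ℂ (U l 1) y e₀ = 0 ∧
    fderiv ℂ (U l 0) y e₁ = 0 ∧ fderiv ℂ (U l 1) y e₁ = 1 := by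
  obtain ⟨h1, h2, h3⟩ := dlogU_transCoord hy l
  set a : C5 := Pi.single (transCoord l).1 1
  set b : C5 := Pi.single (transCoord l).2 1
  have ha0 : fderiv ℂ (U l 0) y a = 0 := by rw [fderiv_U hy, smul_apply, h1, smul_zero]
  have ha1 : fderiv ℂ (U l 1) y a ≠ 0 := by
    rw [fderiv_U hy, smul_apply]; exact mul_ne_zero (U_ne_zero hy _ _) h2
  have hb0 : fderiv ℂ (U l 0) y b ≠ 0 := by
    rw [fderiv_U hy, smul_apply]; exact mul_ne_zero (U_ne_zero hy _ _) h3
  refine ⟨(fderiv ℂ (U l 0) y b)⁻¹ • (b - (fderiv ℂ (U l 1) y b / fderiv ℂ (U l 1) y a) • a),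
    (fderiv ℂ (U l 1) y a)⁻¹ • a, ?_, ?_, ?_, ?_⟩ <;>
  simp only [map_smul, map_sub, smul_eq_mul, ha0] <;> field_simp <;> ring

end

end GMWeb

namespace GMWeb

open scoped Topology
open Filter Asymptotics

noncomputable section

/-! ### Local structure of basic functions -/

/-- Local factorisation of a basic function through `(U_{l,1}, U_{l,2})`. -/
theorem IsBasic.exists_factor {D : TopologicalSpace.Opens C5} {l : Fin 10} {f : C5 → ℂ}
    (hf : IsBasic D l f) (hDY : (D : Set C5) ⊆ Ystar) {y : C5} (hy : y ∈ D) :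
    ∃ g : ℂ × ℂ → ℂ, AnalyticAt ℂ g 0 ∧
      ∀ᶠ x in 𝓝 y, f x = g (U l 0 x - U l 0 y, U l 1 x - U l 1 y) := by
  have hyY := hDY hy
  obtain ⟨e₀, e₁, h00, h10, h01, h11⟩ := exists_dual_vectors hyY l
  set a := fderiv ℂ (U l 0) y with ha
  set b := fderiv ℂ (U l 1) y with hb
  -- A straightening map: its derivative at `y` is the identity, and the affine functions `a (· -
  -- y)` and `b (· - y)` pull back under it to `U_{l,s} - U_{l,s}(y)`. Its local inverse `χ` turns
  -- the first integrals into linear functions.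
  let θ : C5 → C5 := fun x => x + ((U l 0 x - U l 0 y - a (x - y)) • e₀ +
    (U l 1 x - U l 1 y - b (x - y)) • e₁)
  have hθy : θ y = y := by simp [θ]
  have hθan : AnalyticAt ℂ θ y := by
    have hl (c : C5 →L[ℂ] ℂ) : AnalyticAt ℂ (fun x => c (x - y)) y :=
      (c.analyticAt _).comp (analyticAt_id.sub analyticAt_const)
    exact analyticAt_id.add
      (((((analyticAt_U hyY l 0).sub analyticAt_const).sub (hl a)).smul analyticAt_const).add
        ((((analyticAt_U hyY l 1).sub analyticAt_const).sub (hl b)).smul analyticAt_const))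
  have hθ' : HasFDerivAt θ ((ContinuousLinearEquiv.refl ℂ C5 : C5 ≃L[ℂ] C5) : C5 →L[ℂ] C5) y := by
    have hs (s : Fin 3) (e : C5) : HasFDerivAt
        (fun x => (U l s x - U l s y - fderiv ℂ (U l s) y (x - y)) • e) (0 : C5 →L[ℂ] C5) y := by
      have h1 := (analyticAt_U hyY l s).differentiableAt.hasFDerivAt
      have h2 : HasFDerivAt (fun x => fderiv ℂ (U l s) y (x - y)) (fderiv ℂ (U l s) y) y :=
        (fderiv ℂ (U l s) y).hasFDerivAt.comp y ((hasFDerivAt_id y).sub_const y)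
      refine (((h1.sub_const (U l s y)).sub h2).smul_const e).congr_fderiv ?_
      ext; simp
    refine ((hasFDerivAt_id y).add ((hs 0 e₀).add (hs 1 e₁))).congr_fderiv ?_
    ext; simp
  have hcd : ContDiffAt ℂ ⊤ θ y := hθan.contDiffAt
  have hst := hcd.hasStrictFDerivAt' hθ' (by simp)
  let χ : C5 → C5 := hcd.localInverse hθ' (by simp)
  have hχan : AnalyticAt ℂ χ y := by
    have := (hcd.to_localInverse hθ' (by simp)).analyticAt
    rwa [hθy] at this
  have hχy : χ y = y := by
    have := hcd.localInverse_apply_image hθ' (by simp)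
    rwa [hθy] at this
  have hl : ∀ᶠ x in 𝓝 y, χ (θ x) = x := hst.eventually_left_inverse
  have hr : ∀ᶠ z in 𝓝 y, θ (χ z) = z := by
    have := hst.eventually_right_inverse
    rwa [hθy] at this
  have haθ (x : C5) : a (θ x - y) = U l 0 x - U l 0 y := by
    simp only [θ, map_sub, map_add, map_smul, h00, h01, smul_eq_mul]; ring
  have hbθ (x : C5) : b (θ x - y) = U l 1 x - U l 1 y := by
    simp only [θ, map_sub, map_add, map_smul, h10, h11, smul_eq_mul]; ring
  have hχD : ∀ᶠ z in 𝓝 y, χ z ∈ D := by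
    have := hχan.continuousAt.tendsto
    rw [hχy] at this
    exact this (D.isOpen.mem_nhds hy)
  have hgood : ∀ᶠ z in 𝓝 y, AnalyticAt ℂ χ z ∧ χ z ∈ D ∧ ∀ᶠ z' in 𝓝 z, θ (χ z') = z' :=
    hχan.eventually_analyticAt.and (hχD.and hr.eventually_nhds)
  obtain ⟨ε, hε, hball⟩ := Metric.eventually_nhds_iff_ball.1 hgood
  -- A direction killed by `a` and `b` is sent by the derivative of `χ` into the tangent space of a
  -- leaf, where the differential of `f` vanishes.
  have hker (z : C5) (hz : z ∈ Metric.ball y ε) (k : C5) (hak : a k = 0) (hbk : b k = 0) :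
      fderiv ℂ (fun z => f (χ z)) z k = 0 := by
    obtain ⟨hz1, hz2, hz3⟩ := hball z hz
    have hχd := hz1.differentiableAt.hasFDerivAt
    have hfd := (hf.1 _ hz2).differentiableAt.hasFDerivAt
    have hU (s : Fin 3) (c : C5 →L[ℂ] ℂ) (hc : ∀ x, c (θ x - y) = U l s x - U l s y) (hck : c k = 0) :
        fderiv ℂ (U l s) (χ z) (fderiv ℂ χ z k) = 0 := by
      have h1 := (analyticAt_U (hDY hz2) l s).differentiableAt.hasFDerivAt.comp z hχd
      have h2 : HasFDerivAt (fun z => c (z - y) + U l s y) c z :=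
        (c.hasFDerivAt.comp z ((hasFDerivAt_id z).sub_const y)).add_const _
      have h3 : (fun z => c (z - y) + U l s y) =ᶠ[𝓝 z] U l s ∘ χ := by
        filter_upwards [hz3] with z' hz'
        rw [Function.comp_apply, ← sub_add_cancel (U l s (χ z')) (U l s y), ← hc, hz']
      have := h1.unique (h2.congr_of_eventuallyEq h3.symm)
      rw [← hck, ← this]; rfl
    have := (hfd.comp z hχd).fderiv
    rw [Function.comp_def] at this
    rw [this]
    exact hf.2 _ hz2 _ (hU 0 a haθ hak) (hU 1 b hbθ hbk)
  -- Convexity of the ball keeps the whole segment in the domain, so a zero derivative along it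
  -- gives equal values at its ends.
  have hconst (z z' : C5) (hz : z ∈ Metric.ball y ε) (hz' : z' ∈ Metric.ball y ε)
      (hak : a (z' - z) = 0) (hbk : b (z' - z) = 0) : f (χ z) = f (χ z') := by
    have hseg (t : ℝ) (ht : t ∈ Set.Icc (0 : ℝ) 1) : z + t • (z' - z) ∈ Metric.ball y ε :=
      (convex_ball y ε).add_smul_sub_mem hz hz' ht
    have hd (t : ℝ) (ht : t ∈ Set.Icc (0 : ℝ) 1) :
        HasDerivAt (fun t : ℝ => f (χ (z + t • (z' - z)))) 0 t := by
      have h1 : HasDerivAt (fun t : ℝ => z + t • (z' - z)) (z' - z) t := by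
        simpa using ((hasDerivAt_id t).smul_const (z' - z)).const_add z
      obtain ⟨hz1, hz2, -⟩ := hball _ (hseg t ht)
      have h2 : HasFDerivAt (fun z => f (χ z)) (fderiv ℂ (fun z => f (χ z)) (z + t • (z' - z)))
          (z + t • (z' - z)) :=
        ((hf.1 _ hz2).differentiableAt.comp _ hz1.differentiableAt).hasFDerivAt
      have := (h2.restrictScalars ℝ).comp_hasDerivAt t h1
      rwa [ContinuousLinearMap.coe_restrictScalars', hker _ (hseg t ht) _ hak hbk] at this
    have := constant_of_has_deriv_right_zero (a := 0) (b := 1)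
      (f := fun t : ℝ => f (χ (z + t • (z' - z))))
      (fun t ht => (hd t ht).continuousAt.continuousWithinAt)
      (fun t ht => (hd t ⟨ht.1, ht.2.le⟩).hasDerivWithinAt) 1 (by simp)
    simpa using this.symm
  -- An affine section of `(a, b)`. The points `θ x` and `ι (U x - U y)` differ by a vector killed
  -- by `a` and `b`, so `f ∘ χ` takes the same value at both.
  let ι : ℂ × ℂ → C5 := fun p => y + (p.1 • e₀ + p.2 • e₁)
  have hι : AnalyticAt ℂ ι 0 :=
    analyticAt_const.add ((analyticAt_fst.smul analyticAt_const).add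
      (analyticAt_snd.smul analyticAt_const))
  have hι0 : ι 0 = y := by simp [ι]
  refine ⟨fun p => f (χ (ι p)), ?_, ?_⟩
  · have h1 : AnalyticAt ℂ χ (ι 0) := by rwa [hι0]
    have h2 : AnalyticAt ℂ f (χ (ι 0)) := by rw [hι0, hχy]; exact hf.1 y hy
    exact AnalyticAt.comp (g := f) (f := fun p => χ (ι p)) h2 (AnalyticAt.comp (g := χ) h1 hι)
  · have h1 : Tendsto θ (𝓝 y) (𝓝 y) := by
      have := hθan.continuousAt.tendsto
      rwa [hθy] at this
    have h2 : Tendsto (fun x => ι (U l 0 x - U l 0 y, U l 1 x - U l 1 y)) (𝓝 y) (𝓝 y) := by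
      have hc : ContinuousAt (fun x => ι (U l 0 x - U l 0 y, U l 1 x - U l 1 y)) y :=
        continuousAt_const.add
          ((((analyticAt_U hyY l 0).continuousAt.sub continuousAt_const).smul continuousAt_const).add
            (((analyticAt_U hyY l 1).continuousAt.sub continuousAt_const).smul continuousAt_const))
      simpa [ContinuousAt, ι] using hc
    filter_upwards [hl, h1 (Metric.ball_mem_nhds y hε), h2 (Metric.ball_mem_nhds y hε)]
      with x hx1 hx2 hx3
    rw [← hconst _ _ hx2 hx3, hx1]
    · rw [← sub_sub_sub_cancel_right _ _ y, map_sub, haθ]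
      simp [ι, h00, h01]
    · rw [← sub_sub_sub_cancel_right _ _ y, map_sub, hbθ]
      simp [ι, h10, h11]

/-- The Taylor expansion of an analytic function of two variables. -/
theorem exists_expansion_of_analyticAt {g : ℂ × ℂ → ℂ} (hg : AnalyticAt ℂ g 0) :
    ∃ w : ℕ → ℕ → ℂ, ∀ N, (fun p : ℂ × ℂ => g p - ∑ n ∈ Finset.range N,
      ∑ ij ∈ Finset.HasAntidiagonal.antidiagonal n, w ij.1 ij.2 * (p.1 ^ ij.1 * p.2 ^ ij.2)) =O[𝓝 0]
        fun p => ‖p‖ ^ N := by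
  obtain ⟨P, hP⟩ := hg
  let e : Fin 2 → ℂ × ℂ := ![(1, 0), (0, 1)]
  -- Expanding the `n`-linear term at `p.1 • e 0 + p.2 • e 1`, this collects the summands with `i`
  -- entries equal to `e 0` and `j` equal to `e 1`; no symmetry of the multilinear map is needed.
  let w : ℕ → ℕ → ℂ := fun i j => ∑ s ∈ (Finset.univ : Finset (Fin (i + j))).powersetCard i,
    P (i + j) (s.piecewise (fun _ => e 0) (fun _ => e 1))
  refine ⟨w, fun N => ?_⟩
  have key (n : ℕ) (p : ℂ × ℂ) : P n (fun _ => p) =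
      ∑ ij ∈ Finset.HasAntidiagonal.antidiagonal n, w ij.1 ij.2 * (p.1 ^ ij.1 * p.2 ^ ij.2) := by
    have hp : (fun _ : Fin n => p) = (fun _ => p.1 • e 0) + fun _ => p.2 • e 1 := by
      funext i; ext <;> simp [e]
    have h1 (s : Finset (Fin n)) : P n (s.piecewise (fun _ => p.1 • e 0) (fun _ => p.2 • e 1)) =
        P n (s.piecewise (fun _ => e 0) (fun _ => e 1)) * (p.1 ^ s.card * p.2 ^ (n - s.card)) := by
      have : s.piecewise (fun _ => p.1 • e 0) (fun _ => p.2 • e 1) = fun i =>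
          (s.piecewise (fun _ => p.1) (fun _ => p.2) i : ℂ) •
            s.piecewise (fun _ => e 0) (fun _ => e 1) i := by
        funext i; by_cases hi : i ∈ s <;> simp [hi]
      rw [this, ContinuousMultilinearMap.map_smul_univ, Finset.prod_piecewise]
      simp [Finset.card_sdiff, mul_comm]
    rw [hp, ContinuousMultilinearMap.map_add_univ, ← Finset.powerset_univ,
      Finset.sum_powerset, Finset.Nat.sum_antidiagonal_eq_sum_range_succ_mk, Finset.card_univ,
      Fintype.card_fin]
    refine Finset.sum_congr rfl fun i hi => ?_
    obtain ⟨j, rfl⟩ := Nat.exists_eq_add_of_le (Nat.lt_succ_iff.1 (Finset.mem_range.1 hi))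
    simp only [Nat.add_sub_cancel_left, w, Finset.sum_mul]
    refine Finset.sum_congr rfl fun s hs => ?_
    rw [h1, (Finset.mem_powersetCard.1 hs).2, Nat.add_sub_cancel_left]
  have := hP.isBigO_sub_partialSum_pow N
  simpa only [zero_add, FormalMultilinearSeries.partialSum, key] using this

/-- An analytic function which vanishes to infinite order vanishes identically. -/
theorem eventually_eq_zero_of_flat {f : C5 → ℂ} {y : C5} (hf : AnalyticAt ℂ f y)
    (h : ∀ N : ℕ, (fun z => f (y + z)) =O[𝓝 0] fun z => ‖z‖ ^ N) : ∀ᶠ x in 𝓝 y, f x = 0 := by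
  obtain ⟨P, hP⟩ := hf
  have h0 (n : ℕ) : ∀ z, P n (fun _ => z) = 0 := by
    induction n using Nat.strong_induction_on with
    | _ n ih =>
      -- Once the lower terms vanish, the homogeneous term of degree `n` is itself `O(‖z‖ ^ (n +
      -- 1))`, which is possible only for zero.
      refine IsBigO.continuousMultilinearMap_apply_eq_zero ?_
      have h1 := (h (n + 1)).sub (hP.isBigO_sub_partialSum_pow (n + 1))
      refine h1.congr_left fun z => ?_
      rw [sub_sub_cancel, FormalMultilinearSeries.partialSum, Finset.sum_range_succ,
        Finset.sum_eq_zero (fun k hk => ih k (Finset.mem_range.1 hk) z), zero_add]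
  filter_upwards [hP.eventually_hasSum_sub] with x hx
  exact hx.unique (by simpa only [h0] using hasSum_zero)

end

end GMWeb

namespace GMWeb

open scoped Topology
open Filter Asymptotics Finset.HasAntidiagonal

noncomputable section

/-! ### Asymptotic power series -/

/-- `φ` is the asymptotic expansion of `h` at `0`. -/
def HasSer (h : ℂ → ℂ) (φ : PowerSeries ℂ) : Prop :=
  ∀ N : ℕ, (fun t => h t - (φ.trunc N).eval t) =O[𝓝 0] fun t => t ^ N

theorem Polynomial.isBigO_one (p : Polynomial ℂ) :
    (fun t => p.eval t) =O[𝓝 0] fun _ => (1 : ℂ) :=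
  (p.continuous.tendsto 0).isBigO_one ℂ

theorem isBigO_pow_of_X_pow_dvd {p : Polynomial ℂ} {N : ℕ} (h : Polynomial.X ^ N ∣ p) :
    (fun t => p.eval t) =O[𝓝 0] fun t => t ^ N := by
  obtain ⟨q, rfl⟩ := h
  simpa using (isBigO_refl (fun t : ℂ => t ^ N) (𝓝 0)).mul (Polynomial.isBigO_one q)

theorem HasSer.isBigO_one {h : ℂ → ℂ} {φ : PowerSeries ℂ} (hh : HasSer h φ) :
    h =O[𝓝 0] fun _ => (1 : ℂ) := by
  simpa using hh 0

theorem HasSer.congr {h k : ℂ → ℂ} {φ : PowerSeries ℂ} (hh : HasSer h φ) (e : h =ᶠ[𝓝 0] k) :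
    HasSer k φ := fun N => (hh N).congr' (e.sub (EventuallyEq.refl _ _)) (EventuallyEq.refl _ _)

theorem HasSer.add {h k : ℂ → ℂ} {φ ψ : PowerSeries ℂ} (hh : HasSer h φ) (hk : HasSer k ψ) :
    HasSer (fun t => h t + k t) (φ + ψ) := fun N =>
  ((hh N).add (hk N)).congr_left fun t => by
    rw [map_add, Polynomial.eval_add]; ring

theorem HasSer.sub {h k : ℂ → ℂ} {φ ψ : PowerSeries ℂ} (hh : HasSer h φ) (hk : HasSer k ψ) :
    HasSer (fun t => h t - k t) (φ - ψ) := fun N =>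
  ((hh N).sub (hk N)).congr_left fun t => by
    rw [map_sub, Polynomial.eval_sub]; ring

theorem X_pow_dvd_trunc_mul (φ ψ : PowerSeries ℂ) (N : ℕ) :
    Polynomial.X ^ N ∣ φ.trunc N * ψ.trunc N - (φ * ψ).trunc N := by
  rw [Polynomial.X_pow_dvd_iff]
  intro d hd
  have := congrArg (fun p : Polynomial ℂ => p.coeff d)
    (PowerSeries.trunc_trunc_mul_trunc (n := N) φ ψ)
  simp only [PowerSeries.coeff_trunc, if_pos hd, ← Polynomial.coe_mul, Polynomial.coeff_coe] at this
  rw [Polynomial.coeff_sub, PowerSeries.coeff_trunc, if_pos hd, this, sub_self]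

theorem HasSer.mul {h k : ℂ → ℂ} {φ ψ : PowerSeries ℂ} (hh : HasSer h φ) (hk : HasSer k ψ) :
    HasSer (fun t => h t * k t) (φ * ψ) := fun N => by
  have h1 := (hh N).mul hk.isBigO_one
  have h2 := (hk N).mul (Polynomial.isBigO_one (φ.trunc N))
  simp only [mul_one] at h1 h2
  refine ((h1.add h2).add (isBigO_pow_of_X_pow_dvd (X_pow_dvd_trunc_mul φ ψ N))).congr_left
    fun t => ?_
  rw [Polynomial.eval_sub, Polynomial.eval_mul]
  ring

theorem HasSer.const (c : ℂ) : HasSer (fun _ => c) (PowerSeries.C c) := fun N => by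
  cases N with
  | zero => simpa using (isBigO_const_const c (one_ne_zero (α := ℂ)) (𝓝 0))
  | succ N =>
    have : (PowerSeries.C c).trunc (N + 1) = Polynomial.C c := by simp
    simp only [this, Polynomial.eval_C, sub_self]
    exact isBigO_zero _ _

theorem HasSer.X : HasSer (fun t => t) PowerSeries.X := fun N => by
  have h : Polynomial.X ^ N ∣ Polynomial.X - (PowerSeries.X : PowerSeries ℂ).trunc N := by
    rw [Polynomial.X_pow_dvd_iff]
    intro d hd
    rw [Polynomial.coeff_sub, PowerSeries.coeff_trunc, if_pos hd, Polynomial.coeff_X,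
      PowerSeries.coeff_X]
    simp [eq_comm]
  simpa using isBigO_pow_of_X_pow_dvd h

theorem HasSer.pow {h : ℂ → ℂ} {φ : PowerSeries ℂ} (hh : HasSer h φ) (n : ℕ) :
    HasSer (fun t => h t ^ n) (φ ^ n) := by
  induction n with
  | zero => simpa using HasSer.const 1
  | succ n ih => simpa only [pow_succ] using ih.mul hh

theorem HasSer.sum {ι : Type*} (I : Finset ι) {h : ι → ℂ → ℂ} {φ : ι → PowerSeries ℂ}
    (hh : ∀ i ∈ I, HasSer (h i) (φ i)) : HasSer (fun t => ∑ i ∈ I, h i t) (∑ i ∈ I, φ i) := by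
  classical
  induction I using Finset.induction_on with
  | empty => simpa using HasSer.const 0
  | insert a I ha ih =>
    simp only [Finset.sum_insert ha]
    exact (hh a (by simp)).add (ih fun i hi => hh i (by simp [hi]))

theorem HasSer.prod {ι : Type*} (I : Finset ι) {h : ι → ℂ → ℂ} {φ : ι → PowerSeries ℂ}
    (hh : ∀ i, HasSer (h i) (φ i)) : HasSer (fun t => ∏ i ∈ I, h i t) (∏ i ∈ I, φ i) := by
  classical
  induction I using Finset.induction_on with
  | empty => simpa using HasSer.const 1
  | insert a I ha ih =>
    simp only [Finset.prod_insert ha]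
    exact (hh a).mul ih

theorem HasSer.apply_zero {h : ℂ → ℂ} {φ : PowerSeries ℂ} (hh : HasSer h φ) :
    h 0 = PowerSeries.constantCoeff φ := by
  obtain ⟨C, hC⟩ := (hh 1).bound
  have := hC.self_of_nhds
  simpa [sub_eq_zero] using this

theorem HasSer.hasDerivAt {h : ℂ → ℂ} {φ : PowerSeries ℂ} (hh : HasSer h φ) :
    HasDerivAt h (PowerSeries.coeff 1 φ) 0 := by
  rw [hasDerivAt_iff_isLittleO_nhds_zero]
  have h1 : (fun t : ℂ => t ^ 2) =o[𝓝 0] fun t => t := by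
    simpa using isLittleO_pow_pow (𝕜 := ℂ) (m := 1) (n := 2) (by norm_num)
  refine ((hh 2).trans_isLittleO h1).congr_left fun t => ?_
  rw [PowerSeries.trunc_succ, PowerSeries.trunc_succ, hh.apply_zero]
  simp
  ring

/-- Uniqueness of asymptotic expansions. By induction the lower coefficients vanish, so the monomial
of degree `d` is `O(t ^ (d + 1))`; viewed as the diagonal of a `d`-linear map, it must be zero. -/
theorem HasSer.coeff_eq_zero {h : ℂ → ℂ} {φ : PowerSeries ℂ} (hh : HasSer h φ) {N : ℕ}
    (h0 : h =O[𝓝 0] fun t => t ^ N) {d : ℕ} (hd : d < N) : PowerSeries.coeff d φ = 0 := by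
  induction d using Nat.strong_induction_on with
  | _ d ih =>
    have ht : φ.trunc (d + 1) = Polynomial.monomial d (PowerSeries.coeff d φ) := by
      have : φ.trunc d = 0 := by
        ext i
        rw [PowerSeries.coeff_trunc]
        split_ifs with hi
        · rw [ih i hi (hi.trans hd), Polynomial.coeff_zero]
        · simp
      rw [PowerSeries.trunc_succ, this, zero_add]
    have h1 : h =O[𝓝 0] fun t => t ^ (d + 1) := h0.trans (by
      simpa using isBigO_pow_of_X_pow_dvd (pow_dvd_pow Polynomial.X (Nat.succ_le_of_lt hd)))
    have h2 := h1.sub (hh (d + 1))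
    have h3 : (fun t : ℂ => ContinuousMultilinearMap.mkPiRing ℂ (Fin d) (PowerSeries.coeff d φ)
        (fun _ => t)) =O[𝓝 0] fun t => ‖t‖ ^ (d + 1) := by
      refine (h2.norm_right.congr_left fun t => ?_).congr_right fun t => norm_pow _ _
      rw [ht]
      simp [mul_comm]
    simpa using h3.continuousMultilinearMap_apply_eq_zero 1

theorem HasSer.tendsto {h : ℂ → ℂ} {φ : PowerSeries ℂ} (hh : HasSer h φ) :
    Tendsto h (𝓝 0) (𝓝 (h 0)) := hh.hasDerivAt.continuousAt

theorem HasSer.inv {h : ℂ → ℂ} {φ ψ : PowerSeries ℂ} (hh : HasSer h φ) (hφ : φ * ψ = 1) :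
    HasSer (fun t => (h t)⁻¹) ψ := fun N => by
  have h0 : h 0 ≠ 0 := by
    rw [hh.apply_zero]
    intro h0
    have := congrArg PowerSeries.constantCoeff hφ
    rw [map_mul, h0, zero_mul, map_one] at this
    exact zero_ne_one this
  have h1 : (fun t => (h t)⁻¹) =O[𝓝 0] fun _ => (1 : ℂ) := (hh.tendsto.inv₀ h0).isBigO_one ℂ
  cases N with
  | zero => simpa using h1
  | succ N =>
    have h2 := (hh (N + 1)).mul (Polynomial.isBigO_one (ψ.trunc (N + 1)))
    have h3 := isBigO_pow_of_X_pow_dvd (X_pow_dvd_trunc_mul φ ψ (N + 1))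
    simp only [mul_one] at h2
    -- With `ψ_N` the truncation of `ψ`, this rests on `1/h - ψ_N = -(1/h) (h ψ_N - 1)`, where `1/h`
    -- is bounded and `h ψ_N - 1` is of order `N + 1` (the index having been shifted by one).
    have h4 := (h1.mul (h2.add h3)).neg_left
    simp only [one_mul] at h4
    refine h4.congr' ?_ (EventuallyEq.refl _ _)
    filter_upwards [hh.tendsto.eventually_ne h0] with t ht
    rw [hφ, PowerSeries.trunc_one, Polynomial.eval_sub, Polynomial.eval_mul, Polynomial.eval_one]
    field_simp
    ring

theorem HasSer.zpow {h : ℂ → ℂ} {u : (PowerSeries ℂ)ˣ} (hh : HasSer h u) (n : ℤ) :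
    HasSer (fun t => h t ^ n) (u ^ n : (PowerSeries ℂ)ˣ) := by
  cases n with
  | ofNat n => simpa using hh.pow n
  | negSucc n =>
    have h1 := (hh.pow (n + 1)).inv (ψ := ((u ^ (n + 1))⁻¹ : (PowerSeries ℂ)ˣ)) (by
      rw [← Units.val_pow_eq_pow_val, Units.mul_inv])
    simpa [zpow_negSucc] using h1

/-! ### Expansions along lines -/

theorem hasSer_zeta (y v : C5) (k : Fin 10) :
    HasSer (fun t => zeta k (y + t • v)) (zetaR (lineSer y v) k) := by
  have hc (i : Fin 5) : HasSer (fun t => (y + t • v) i) (lineSer y v i) :=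
    ((HasSer.const (y i)).add ((HasSer.const (v i)).mul HasSer.X)).congr
      (Eventually.of_forall fun t => by simp [mul_comm])
  have hq (a b c : Fin 5) :
      HasSer (fun t => 1 + (y + t • v) a - (y + t • v) b * (y + t • v) c)
        (1 + lineSer y v a - lineSer y v b * lineSer y v c) := by
    have := ((HasSer.const 1).add (hc a)).sub ((hc b).mul (hc c))
    rwa [map_one] at this
  simp only [zeta_eq_zetaR]
  fin_cases k
  exacts [hc 0, hc 1, hc 2, hc 3, hc 4, hq 3 2 4, hq 0 4 1, hq 2 1 3, hq 4 0 3, hq 1 0 2]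

theorem tendsto_line (y v : C5) : Tendsto (fun t : ℂ => y + t • v) (𝓝 0) (𝓝 y) := by
  have : Continuous fun t : ℂ => y + t • v := by fun_prop
  simpa using this.tendsto 0

/-- The link between the algebraic series and the analytic function: both are the same monomial in
the `ζ_k`. -/
theorem hasSer_U {y : C5} (hy : y ∈ Ystar) (v : C5) (l : Fin 10) (s : Fin 3) :
    HasSer (fun t => U l s (y + t • v)) (USer (isUnit_of_mem_Ystar hy) v l s) := by
  have h := HasSer.prod Finset.univ fun k =>
    (show HasSer (fun t => zeta k (y + t • v)) (zetaUnit (isUnit_of_mem_Ystar hy) v k) from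
      hasSer_zeta y v k).zpow (expo l s k)
  rw [← Units.coe_prod] at h
  refine h.congr ?_
  filter_upwards [tendsto_line y v (isOpen_Ystar.mem_nhds hy)] with t ht
  exact (U_eq_prod ht l s).symm

theorem hasSer_u {y : C5} (hy : y ∈ Ystar) (v : C5) (l : Fin 10) (s : Fin 3) :
    HasSer (fun t => U l s (y + t • v) - U l s y) (uSer (isUnit_of_mem_Ystar hy) v l s) := by
  have h := hasSer_U hy v l s
  have h0 := h.apply_zero
  rw [zero_smul, add_zero] at h0
  rw [uSer, ← h0]
  exact h.sub (HasSer.const _)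

theorem coeff_one_uSer {y : C5} (hy : y ∈ Ystar) (v : C5) (l : Fin 10) (s : Fin 3) :
    PowerSeries.coeff 1 (uSer (isUnit_of_mem_Ystar hy) v l s) = fderiv ℂ (U l s) y v := by
  have h1 := (hasSer_u hy v l s).hasDerivAt
  have h2 : HasDerivAt (fun t : ℂ => y + t • v) v 0 := by
    simpa using ((hasDerivAt_id (0 : ℂ)).smul_const v).const_add y
  have h3 : HasFDerivAt (U l s) (fderiv ℂ (U l s) y) (y + (0 : ℂ) • v) := by
    simpa using (analyticAt_U hy l s).differentiableAt.hasFDerivAt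
  exact h1.unique ((h3.comp_hasDerivAt 0 h2).sub_const _)

/-! ### Expansions of basic functions in terms of their first integrals -/

/-- The expansion at `y` of a function which is basic for `U_l`. -/
def IsExp (y : C5) (l : Fin 10) (f : C5 → ℂ) (w : ℕ → ℕ → ℂ) : Prop :=
  ∀ N, (fun z => f (y + z) - ∑ n ∈ Finset.range N, ∑ ij ∈ antidiagonal n,
    w ij.1 ij.2 * ((U l 0 (y + z) - U l 0 y) ^ ij.1 * (U l 1 (y + z) - U l 1 y) ^ ij.2))
      =O[𝓝 0] fun z => ‖z‖ ^ N

theorem IsExp.zero (y : C5) (l : Fin 10) : IsExp y l 0 0 := fun N => by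
  simpa using isBigO_zero _ _

theorem IsExp.add {y : C5} {l : Fin 10} {f f' : C5 → ℂ} {w w' : ℕ → ℕ → ℂ} (h : IsExp y l f w)
    (h' : IsExp y l f' w') : IsExp y l (f + f') (w + w') := fun N =>
  ((h N).add (h' N)).congr_left fun z => by
    simp only [Pi.add_apply, add_mul, Finset.sum_add_distrib]; ring

theorem IsExp.smul {y : C5} {l : Fin 10} {f : C5 → ℂ} {w : ℕ → ℕ → ℂ} (h : IsExp y l f w)
    (c : ℂ) : IsExp y l (c • f) (c • w) := fun N =>
  ((h N).const_mul_left c).congr_left fun z => by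
    simp only [Pi.smul_apply, smul_eq_mul, mul_sub, Finset.mul_sum, mul_assoc]

theorem IsBasic.exists_isExp {D : TopologicalSpace.Opens C5} {l : Fin 10} {f : C5 → ℂ}
    (hf : IsBasic D l f) (hDY : (D : Set C5) ⊆ Ystar) {y : C5} (hy : y ∈ D) :
    ∃ w, IsExp y l f w := by
  obtain ⟨g, hg, hfg⟩ := hf.exists_factor hDY hy
  obtain ⟨w, hw⟩ := exists_expansion_of_analyticAt hg
  refine ⟨w, fun N => ?_⟩
  have ht : Tendsto (fun z : C5 => y + z) (𝓝 0) (𝓝 y) := by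
    simpa using (continuous_const_add y).tendsto 0
  have hu (s : Fin 3) : (fun z => U l s (y + z) - U l s y) =O[𝓝 0] fun z => z := by
    have := (analyticAt_U (hDY hy) l s).differentiableAt.isBigO_sub.comp_tendsto ht
    simpa [Function.comp_def] using this
  have hu2 : (fun z => (U l 0 (y + z) - U l 0 y, U l 1 (y + z) - U l 1 y)) =O[𝓝 0] fun z => z :=
    (hu 0).prod_left (hu 1)
  have htu : Tendsto (fun z => (U l 0 (y + z) - U l 0 y, U l 1 (y + z) - U l 1 y)) (𝓝 0) (𝓝 0) :=
    hu2.trans_tendsto tendsto_id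
  have h1 := ((hw N).comp_tendsto htu).trans (hu2.norm_norm.pow N)
  refine h1.congr' ?_ (EventuallyEq.refl _ _)
  filter_upwards [ht hfg] with z hz
  rw [hz]
  rfl

/-- Along the line the sum of the `f_l` is zero, so the sum of the truncated expansions is `O(t ^
N)`, and its coefficients below degree `N` vanish. -/
theorem IsExp.hasSer_sum {y : C5} (hy : y ∈ Ystar) {f : Fin 10 → C5 → ℂ} {w : Fin 10 → ℕ → ℕ → ℂ}
    (h : ∀ l, IsExp y l (f l) (w l)) (h0 : ∀ᶠ x in 𝓝 y, ∑ l, f l x = 0) (v : C5) {d N : ℕ}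
    (hd : d < N) : ∑ l, ∑ n ∈ Finset.range N, ∑ ij ∈ antidiagonal n,
      w l ij.1 ij.2 * tcoef (isUnit_of_mem_Ystar hy) v d l ij.1 ij.2 = 0 := by
  have hs := HasSer.sum Finset.univ fun l (_ : l ∈ Finset.univ) => HasSer.sum (Finset.range N)
    fun n (_ : n ∈ Finset.range N) => HasSer.sum (antidiagonal n) fun ij (_ : ij ∈ antidiagonal n) =>
      (HasSer.const (w l ij.1 ij.2)).mul
        (((hasSer_u hy v l 0).pow ij.1).mul ((hasSer_u hy v l 1).pow ij.2))
  have ht : Tendsto (fun t : ℂ => t • v) (𝓝 0) (𝓝 0) := by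
    have : Continuous fun t : ℂ => t • v := by fun_prop
    simpa using this.tendsto 0
  have hO : (fun t : ℂ => ‖t • v‖ ^ N) =O[𝓝 0] fun t => t ^ N :=
    ((isBigO_of_le' (c := ‖v‖) (𝓝 0) fun t : ℂ => by
      rw [norm_norm, norm_smul, mul_comm]).pow N)
  have hb := IsBigO.sum (s := Finset.univ) fun l (_ : l ∈ Finset.univ) =>
    ((h l N).comp_tendsto ht).trans hO
  have h1 := hs.coeff_eq_zero (N := N) (hb.neg_left.congr' ?_ (EventuallyEq.refl _ _)) hd
  · simp only [map_sum, PowerSeries.coeff_C_mul] at h1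
    exact h1
  · filter_upwards [tendsto_line y v h0] with t ht
    change -(∑ l, (f l (y + t • v) - ∑ n ∈ Finset.range N, ∑ ij ∈ antidiagonal n, w l ij.1 ij.2 *
      ((U l 0 (y + t • v) - U l 0 y) ^ ij.1 * (U l 1 (y + t • v) - U l 1 y) ^ ij.2))) = _
    rw [Finset.sum_sub_distrib, ht, zero_sub, neg_neg]

end

end GMWeb

namespace GMWeb

open scoped Topology
open Filter Asymptotics Finset.HasAntidiagonal

noncomputable section

/-! ### The bound on the 0-rank -/

/-- `y` is a point at which 5-jets of abelian relations are determined by their free coordinates. -/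
def IsGeneric (y : C5) (hy : y ∈ Ystar) : Prop :=
  ∀ x : Fin 10 × ℕ × ℕ → ℂ,
    (∀ c ∈ jetIndex, freeCoord c.1 c.2.1 c.2.2 = true → x c = 0) →
    (∀ (v : C5) (d : ℕ), d ≤ 5 → ∑ c ∈ jetIndex,
      tcoef (isUnit_of_mem_Ystar hy) v d c.1 c.2.1 c.2.2 * x c = 0) →
    ∀ c ∈ jetIndex, x c = 0

theorem mem_jetIndex {c : Fin 10 × ℕ × ℕ} :
    c ∈ jetIndex ↔ 1 ≤ c.2.1 + c.2.2 ∧ c.2.1 + c.2.2 ≤ 5 := by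
  simp only [jetIndex, Finset.mem_filter, Finset.mem_product, Finset.mem_univ, Finset.mem_range,
    true_and]
  omega

theorem sum_jetIndex (F : Fin 10 × ℕ × ℕ → ℂ) (h0 : ∀ l, F (l, 0, 0) = 0) :
    ∑ c ∈ jetIndex, F c = ∑ l, ∑ n ∈ Finset.range 6, ∑ ij ∈ antidiagonal n, F (l, ij) := by
  have h1 (l : Fin 10) : ∑ n ∈ Finset.range 6, ∑ ij ∈ antidiagonal n, F (l, ij) =
      ∑ ij ∈ (Finset.range 6).biUnion antidiagonal, F (l, ij) := by
    rw [Finset.sum_biUnion]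
    intro a _ b _ hab
    rw [Function.onFun, Finset.disjoint_left]
    intro ij ha hb
    exact hab ((mem_antidiagonal.1 ha).symm.trans (mem_antidiagonal.1 hb))
  simp only [h1]
  rw [← Finset.sum_product']
  refine Finset.sum_subset (fun c hc => ?_) fun c hc hc' => ?_
  · rw [mem_jetIndex] at hc
    simp only [Finset.mem_product, Finset.mem_univ, Finset.mem_biUnion, Finset.mem_range,
      mem_antidiagonal, true_and]
    exact ⟨_, by omega, rfl⟩
  · obtain ⟨l, i, j⟩ := c
    simp only [Finset.mem_product, Finset.mem_univ, Finset.mem_biUnion, Finset.mem_range,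
      mem_antidiagonal, true_and] at hc
    rw [mem_jetIndex] at hc'
    obtain ⟨n, hn, hij⟩ := hc
    obtain rfl : i = 0 := by dsimp only at hc' hij; omega
    obtain rfl : j = 0 := by dsimp only at hc' hij; omega
    exact h0 l

theorem freeCoord_eq_false {l : Fin 10} {i j : ℕ} (h : 3 ≤ i + j) : freeCoord l i j = false := by
  have h1 : Nat.beq (Nat.add i j) 1 = false := by
    rw [Bool.eq_false_iff]; intro h'; have : i + j = 1 := Nat.eq_of_beq_eq_true h'; omega
  have h2 : Nat.beq (Nat.add i j) 2 = false := by
    rw [Bool.eq_false_iff]; intro h'; have : i + j = 2 := Nat.eq_of_beq_eq_true h'; omega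
  rw [freeCoord, h1, h2]
  rfl

theorem tcoef_symbol {y : C5} (hy : y ∈ Ystar) (v : C5) (l : Fin 10) {m : ℕ} {ij : ℕ × ℕ}
    (h : ij ∈ antidiagonal m) : tcoef (isUnit_of_mem_Ystar hy) v m l ij.1 ij.2 =
      fderiv ℂ (U l 0) y v ^ ij.1 * fderiv ℂ (U l 1) y v ^ ij.2 := by
  rw [← mem_antidiagonal.1 h, tcoef_add, coeff_one_uSer hy, coeff_one_uSer hy]

theorem tcoef_zero_zero {y : C5} (hy : y ∈ Ystar) (v : C5) (l : Fin 10) {m : ℕ} (h : m ≠ 0) :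
    tcoef (isUnit_of_mem_Ystar hy) v m l 0 0 = 0 := by
  rw [tcoef, pow_zero, pow_zero, mul_one, PowerSeries.coeff_one, if_neg h]

/-- At a generic point, the symbols of order at least 5 vanish. -/
theorem IsGeneric.symbol {y : C5} {hy : y ∈ Ystar} (hg : IsGeneric y hy) (m : ℕ) (hm : 5 ≤ m) :
    ∀ x : Fin 10 → ℕ → ℕ → ℂ, (∀ v, ∑ l, ∑ ij ∈ antidiagonal m, x l ij.1 ij.2 *
      (fderiv ℂ (U l 0) y v ^ ij.1 * fderiv ℂ (U l 1) y v ^ ij.2) = 0) →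
      ∀ l, ∀ ij ∈ antidiagonal m, x l ij.1 ij.2 = 0 := by
  induction m, hm using Nat.le_induction with
  | base =>
    intro x hx l ij hij
    have h5 := mem_antidiagonal.1 hij
    -- A jet concentrated in order 5. Its equations of degree less than 5 are void and those of
    -- degree 5 are exactly the symbol equations, so genericity applies to it.
    let x' : Fin 10 × ℕ × ℕ → ℂ := fun c => if c.2.1 + c.2.2 = 5 then x c.1 c.2.1 c.2.2 else 0
    have := hg x' (fun c hc hf => ?_) (fun v d hd => ?_) (l, ij) (mem_jetIndex.2 (by
      dsimp only; omega))
    · simpa only [x', h5, if_true] using this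
    · simp only [x']
      rw [if_neg]
      intro h
      rw [freeCoord_eq_false (by omega)] at hf
      exact Bool.noConfusion hf
    · by_cases hd5 : d = 5
      · subst hd5
        rw [sum_jetIndex _ fun l => by simp [x'], ← hx v]
        refine Finset.sum_congr rfl fun l _ => ?_
        rw [Finset.sum_range_succ, Finset.sum_eq_zero, zero_add]
        · refine Finset.sum_congr rfl fun ij hij => ?_
          simp only [x', mem_antidiagonal.1 hij, if_true]
          rw [tcoef_symbol hy v l hij, mul_comm]
        · intro n hn
          refine Finset.sum_eq_zero fun ij hij => ?_
          have h1 := mem_antidiagonal.1 hij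
          have h2 := Finset.mem_range.1 hn
          simp only [x']
          rw [if_neg (by omega), mul_zero]
      · refine Finset.sum_eq_zero fun c hc => ?_
        simp only [x']
        split_ifs with h
        · rw [tcoef_of_lt _ _ _ (by omega), zero_mul]
        · rw [mul_zero]
  | succ m hm ih =>
    intro x hx
    -- Differentiating the identity of degree `m + 1` with respect to `v` in the direction `e` gives
    -- an identity of degree `m`, whose coefficients vanish by induction. Taking for `e` the vectors
    -- dual to `dU_{l,1}` and `dU_{l,2}` then isolates each coefficient of degree `m + 1`.
    have hx' (e : C5) := ih (fun l i j =>
      (i + 1) * x l (i + 1) j * fderiv ℂ (U l 0) y e +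
        (j + 1) * x l i (j + 1) * fderiv ℂ (U l 1) y e) fun v => by
      have hl (c : C5 →L[ℂ] ℂ) (n : ℕ) :
          HasDerivAt (fun t : ℂ => c (v + t • e) ^ n) (n * c v ^ (n - 1) * c e) 0 := by
        have h1 : HasDerivAt (fun t : ℂ => v + t • e) e 0 := by
          simpa using ((hasDerivAt_id (0 : ℂ)).smul_const e).const_add v
        have h2 := (c.hasFDerivAt.comp_hasDerivAt (0 : ℂ) h1).pow n
        simp only [Function.comp_apply, zero_smul, add_zero] at h2
        exact h2
      have hd := HasDerivAt.fun_sum (u := Finset.univ) fun l (_ : l ∈ Finset.univ) =>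
        HasDerivAt.fun_sum (u := antidiagonal (m + 1)) fun ij (_ : ij ∈ antidiagonal (m + 1)) =>
          ((hl (fderiv ℂ (U l 0) y) ij.1).mul (hl (fderiv ℂ (U l 1) y) ij.2)).const_mul
            (x l ij.1 ij.2)
      have h0 := hd.unique ((hasDerivAt_const (0 : ℂ) (0 : ℂ)).congr_of_eventuallyEq
        (Eventually.of_forall fun t => hx (v + t • e)))
      rw [← h0]
      refine Finset.sum_congr rfl fun l _ => ?_
      simp only [zero_smul, add_zero, mul_add, Finset.sum_add_distrib, add_mul]
      congr 1
      · rw [Finset.Nat.sum_antidiagonal_succ]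
        simp only [Nat.cast_zero, zero_mul, mul_zero, zero_add, Nat.add_sub_cancel, Nat.cast_add,
          Nat.cast_one]
        rw [← Finset.sum_add_distrib]
        exact Finset.sum_congr rfl fun ij _ => by ring
      · rw [Finset.Nat.sum_antidiagonal_succ']
        simp only [Nat.cast_zero, zero_mul, mul_zero, zero_add, Nat.add_sub_cancel, Nat.cast_add,
          Nat.cast_one]
        rw [← Finset.sum_add_distrib]
        exact Finset.sum_congr rfl fun ij _ => by ring
    rintro l ⟨i, j⟩ hij
    have hij' : i + j = m + 1 := mem_antidiagonal.1 hij
    obtain ⟨e₀, e₁, h00, h10, h01, h11⟩ := exists_dual_vectors hy l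
    rcases i with _ | i
    · obtain rfl : j = m + 1 := by omega
      have := hx' e₁ l (0, m) (mem_antidiagonal.2 (by simp))
      simp only [h01, h11, mul_zero, zero_add, mul_one] at this
      exact (mul_eq_zero.1 this).resolve_left (by exact_mod_cast Nat.succ_ne_zero m)
    · have := hx' e₀ l (i, j) (mem_antidiagonal.2 (by dsimp only; omega))
      simp only [h00, h10, mul_zero, add_zero, mul_one] at this
      exact (mul_eq_zero.1 this).resolve_left (by exact_mod_cast Nat.succ_ne_zero i)

/-- Genericity handles the orders up to 5. Beyond, once the lower coefficients are known to vanish,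
those of order `m` satisfy the symbol equations, which have only the zero solution. -/
theorem IsGeneric.exp_eq_zero {y : C5} {hy : y ∈ Ystar} (hg : IsGeneric y hy)
    {f : Fin 10 → C5 → ℂ} {w : Fin 10 → ℕ → ℕ → ℂ} (h : ∀ l, IsExp y l (f l) (w l))
    (h0 : ∀ᶠ x in 𝓝 y, ∑ l, f l x = 0)
    (hfree : ∀ c ∈ jetIndex, freeCoord c.1 c.2.1 c.2.2 = true → w c.1 c.2.1 c.2.2 = 0) (m : ℕ) :
    1 ≤ m → ∀ l, ∀ ij ∈ antidiagonal m, w l ij.1 ij.2 = 0 := by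
  -- Setting the constant terms to zero makes the sum over `jetIndex` equal to the full sum; in
  -- positive degree they would contribute nothing anyway.
  have h5 := hg (fun c => if c = (c.1, 0, 0) then 0 else w c.1 c.2.1 c.2.2)
    (fun c hc hf => by split_ifs; exacts [rfl, hfree c hc hf]) (fun v d hd => by
      rw [sum_jetIndex _ fun l => by simp]
      by_cases hd0 : d = 0
      · subst hd0
        refine Finset.sum_eq_zero fun l _ => Finset.sum_eq_zero fun n _ =>
          Finset.sum_eq_zero fun ij _ => ?_
        obtain ⟨i, j⟩ := ij
        dsimp only
        split_ifs with hij
        · rw [mul_zero]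
        · rw [tcoef_of_lt, zero_mul]
          by_contra hcon
          obtain rfl : i = 0 := by omega
          obtain rfl : j = 0 := by omega
          exact hij rfl
      · refine Eq.trans ?_ (IsExp.hasSer_sum hy h h0 v (d := d) (N := 6) (by omega))
        refine Finset.sum_congr rfl fun l _ => Finset.sum_congr rfl fun n _ =>
          Finset.sum_congr rfl fun ij _ => ?_
        dsimp only
        split_ifs with hij
        · obtain ⟨i, j⟩ := ij
          simp only [Prod.mk.injEq, true_and] at hij
          obtain ⟨rfl, rfl⟩ := hij
          rw [tcoef_zero_zero hy v l hd0, mul_zero, mul_zero]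
        · rw [mul_comm])
  induction m using Nat.strong_induction_on with
  | _ m ih =>
    intro hm
    by_cases hm5 : m ≤ 5
    · intro l ij hij
      have hij' := mem_antidiagonal.1 hij
      have := h5 (l, ij) (mem_jetIndex.2 (by dsimp only; omega))
      dsimp only at this
      rwa [if_neg] at this
      intro hc
      obtain ⟨i, j⟩ := ij
      simp only [Prod.mk.injEq, true_and] at hc
      dsimp only at hij'
      omega
    · refine hg.symbol m (by omega) w fun v => ?_
      refine Eq.trans ?_ (IsExp.hasSer_sum hy h h0 v (d := m) (N := m + 1) (by omega))
      refine Finset.sum_congr rfl fun l _ => ?_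
      rw [Finset.sum_range_succ _ m, Finset.sum_eq_zero (s := Finset.range m), zero_add]
      · exact Finset.sum_congr rfl fun ij hij => by rw [tcoef_symbol hy v l hij]
      · intro n hn
        refine Finset.sum_eq_zero fun ij hij => ?_
        rcases Nat.eq_zero_or_pos n with rfl | hn0
        · have h1 := mem_antidiagonal.1 hij
          obtain ⟨i, j⟩ := ij
          dsimp only at h1
          obtain rfl : i = 0 := by omega
          obtain rfl : j = 0 := by omega
          rw [tcoef_zero_zero hy v l (by omega), mul_zero]
        · rw [ih n (Finset.mem_range.1 hn) hn0 l ij hij, zero_mul]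

theorem exists_isGeneric {D : Set C5} (hD : IsOpen D) (hne : D.Nonempty) (hDY : D ⊆ Ystar) :
    ∃ (y : C5) (hy : y ∈ Ystar), y ∈ D ∧ IsGeneric y hy := exists_generic_point hD hne hDY

/-- A function whose expansion is trivial is constant. -/
theorem IsExp.exists_eq_const {D : TopologicalSpace.Opens C5} (hD : IsPreconnected (D : Set C5))
    {y : C5} (hy : y ∈ D) {l : Fin 10} {f : C5 → ℂ} (hf : IsBasic D l f) {w : ℕ → ℕ → ℂ}
    (h : IsExp y l f w) (hw : ∀ m, 1 ≤ m → ∀ ij ∈ antidiagonal m, w ij.1 ij.2 = 0) :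
    ∃ c, ∀ z ∈ D, f z = c := by
  refine ⟨w 0 0, ?_⟩
  have h1 : ∀ᶠ x in 𝓝 y, f x - w 0 0 = 0 := by
    refine eventually_eq_zero_of_flat ((hf.1 y hy).sub analyticAt_const) fun N => ?_
    have hN : (fun z : C5 => ‖z‖ ^ (N + 1)) =O[𝓝 0] fun z => ‖z‖ ^ N := by
      simp only [pow_succ]
      have : (fun z : C5 => ‖z‖) =O[𝓝 0] fun _ => (1 : ℝ) :=
        (continuous_norm.tendsto (0 : C5)).isBigO_one ℝ
      simpa using (isBigO_refl (fun z : C5 => ‖z‖ ^ N) (𝓝 0)).mul this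
    -- Order `N + 1` is used rather than `N`, so that the constant term is present in the partial
    -- sum even for `N = 0`.
    refine ((h (N + 1)).trans hN).congr_left fun z => ?_
    rw [Finset.sum_range_succ', Finset.sum_eq_zero]
    · simp
    · intro n _
      refine Finset.sum_eq_zero fun ij hij => ?_
      rw [hw (n + 1) (by omega) ij hij, zero_mul]
  exact hf.1.eqOn_of_preconnected_of_eventuallyEq (analyticOnNhd_const (v := w 0 0)) hD hy
    (h1.mono fun x hx => sub_eq_zero.1 hx)

/-! ### From free coordinates to a bound on the dimension -/

/-- The indices of the free coordinates. -/
def freeIndex : Finset (Fin 10 × ℕ × ℕ) := jetIndex.filter fun c => freeCoord c.1 c.2.1 c.2.2 = true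

theorem card_freeIndex : freeIndex.card = 25 := by decide +kernel

theorem mem_freeIndex {c : Fin 10 × ℕ × ℕ} :
    c ∈ freeIndex ↔ c ∈ jetIndex ∧ freeCoord c.1 c.2.1 c.2.2 = true := Finset.mem_filter

attribute [irreducible] freeIndex

/-- Expansions are handled as a linear relation `E` between `Z` and `V`, so their uniqueness never
has to be proved. On the graph of `E`, the kernel of `g` is contained in the kernel of the
projection to `Z ⧸ K`, which is onto. -/
theorem finrank_quotient_le {Z V W : Type*} [AddCommGroup Z] [Module ℂ Z] [AddCommGroup V]
    [Module ℂ V] [AddCommGroup W] [Module ℂ W] [Module.Finite ℂ W] (K : Submodule ℂ Z)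
    (E : Z → V → Prop) (h0 : E 0 0) (hadd : ∀ a b v w, E a v → E b w → E (a + b) (v + w))
    (hsmul : ∀ (c : ℂ) a v, E a v → E (c • a) (c • v)) (hE : ∀ a, ∃ v, E a v) (g : V →ₗ[ℂ] W)
    (h : ∀ a v, E a v → g v = 0 → a ∈ K) :
    Module.Finite ℂ (Z ⧸ K) ∧ Module.finrank ℂ (Z ⧸ K) ≤ Module.finrank ℂ W := by
  let P : Submodule ℂ (Z × V) :=
    { carrier := {p | E p.1 p.2}
      zero_mem' := h0
      add_mem' := fun hp hq => hadd _ _ _ _ hp hq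
      smul_mem' := fun c _ hp => hsmul c _ _ hp }
  let π : P →ₗ[ℂ] Z ⧸ K := K.mkQ ∘ₗ LinearMap.fst ℂ Z V ∘ₗ P.subtype
  let γ : P →ₗ[ℂ] W := g ∘ₗ LinearMap.snd ℂ Z V ∘ₗ P.subtype
  have hker : LinearMap.ker γ ≤ LinearMap.ker π := fun p hp => by
    change K.mkQ p.1.1 = 0
    rw [Submodule.mkQ_apply, Submodule.Quotient.mk_eq_zero]
    exact h _ _ p.2 hp
  let q : (P ⧸ LinearMap.ker γ) →ₗ[ℂ] Z ⧸ K := (LinearMap.ker γ).liftQ π hker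
  have hq : Function.Surjective q := fun a => by
    obtain ⟨z, rfl⟩ := K.mkQ_surjective a
    obtain ⟨v, hv⟩ := hE z
    exact ⟨(LinearMap.ker γ).mkQ ⟨(z, v), hv⟩, rfl⟩
  have : Module.Finite ℂ (P ⧸ LinearMap.ker γ) := Module.Finite.equiv γ.quotKerEquivRange.symm
  refine ⟨Module.Finite.of_surjective q hq, (LinearMap.finrank_le_finrank_of_surjective hq).trans ?_⟩
  rw [γ.quotKerEquivRange.finrank_eq]
  exact Submodule.finrank_le _

/-- The free coordinates of an expansion. -/
def freeCoords : (Fin 10 → ℕ → ℕ → ℂ) →ₗ[ℂ] (freeIndex → ℂ) where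
  toFun w := fun c => w c.1.1 c.1.2.1 c.1.2.2
  map_add' _ _ := rfl
  map_smul' _ _ := rfl

/-- The 0-rank of the web is at most 25. -/
theorem finrank_AR0_le {D : TopologicalSpace.Opens C5} (hD : IsConnected (D : Set C5))
    (hDY : (D : Set C5) ⊆ Ystar) : Module.Finite ℂ (AR0 D) ∧ Module.finrank ℂ (AR0 D) ≤ 25 := by
  obtain ⟨y, hy, hyD, hg⟩ := exists_isGeneric D.isOpen hD.nonempty hDY
  have hE (f : Z0 D) : ∃ w : Fin 10 → ℕ → ℕ → ℂ, ∀ l, IsExp y l (f.1 l) (w l) := by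
    choose w hw using fun l => (f.2.1 l).exists_isExp hDY hyD
    exact ⟨w, hw⟩
  have hK (f : Z0 D) (w : Fin 10 → ℕ → ℕ → ℂ) (hp : ∀ l, IsExp y l (f.1 l) (w l))
      (hp0 : freeCoords w = 0) : f ∈ K0 D := by
    have h0 : ∀ᶠ x in 𝓝 y, ∑ l, f.1 l x = 0 :=
      eventually_of_mem (D.isOpen.mem_nhds hyD) f.2.2
    have hw := hg.exp_eq_zero hp h0 fun c hc hf =>
      congrFun hp0 ⟨c, mem_freeIndex.2 ⟨hc, hf⟩⟩
    exact fun l => (hp l).exists_eq_const hD.isPreconnected hyD (f.2.1 l)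
      fun m hm ij hij => hw m hm l ij hij
  let E : Z0 D → (Fin 10 → ℕ → ℕ → ℂ) → Prop := fun f w => ∀ l, IsExp y l (f.1 l) (w l)
  have e0 : E 0 0 := fun l => IsExp.zero y l
  have e1 : ∀ a b v w, E a v → E b w → E (a + b) (v + w) := fun _ _ _ _ h h' l => (h l).add (h' l)
  have e2 : ∀ (c : ℂ) a v, E a v → E (c • a) (c • v) := fun c _ _ h l => (h l).smul c
  have := finrank_quotient_le (Z := Z0 D) (W := freeIndex → ℂ) (K0 D) E e0 e1 e2 hE freeCoords hK
  rwa [Module.finrank_fintype_fun_eq_card, Fintype.card_coe, card_freeIndex] at this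

end

end GMWeb

namespace GMWeb

noncomputable section

/-! ### Injectivity of integral matrices, tested modulo 31 -/

/-- Elimination modulo 31 on the matrix with rows `f i`, `i ∈ I`, finds a pivot in every column. -/
def fullRank {ι : Type} {n : ℕ} (I : List ι) (f : ι → Fin n → ℤ) : Bool :=
  force (Nat.add (Nat.pow 2 1100) 1) fun B =>
    forceList (I.map fun i => packRow B id ((List.finRange n).map fun j => (f i j % 31).toNat))
      fun R => (elimN B n R).isSome

/-- Elimination gives a left inverse modulo 31; lifted to integers, it has a product with the matrix
whose determinant is 1 modulo 31, hence nonzero over `ℂ`. The bound on `n` serves only to exclude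
digit overflow. -/
theorem eq_zero_of_fullRank {ι : Type} {n : ℕ} {I : List ι} {f : ι → Fin n → ℤ}
    (h : fullRank I f = true) (hn : n ≤ 175) {x : Fin n → ℂ}
    (hx : ∀ i ∈ I, ∑ j, (f i j : ℂ) * x j = 0) : x = 0 := by
  classical
  have hB : 62 ^ 175 * 31 < Nat.add (Nat.pow 2 1100) 1 := by decide +kernel
  let M : Matrix (Fin I.length) (Fin n) ℤ := fun i j => f I[i] j
  have hM : ∀ z : Fin n → ZMod 31, (M.map (Int.castRingHom (ZMod 31))).mulVec z = 0 → z = 0 := by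
    intro z hz
    rw [fullRank, force_eq, forceList_eq, Option.isSome_iff_exists] at h
    obtain ⟨r, h⟩ := h
    have h1 := eq_zero_of_elimN (b := 31) (X := (List.finRange n).map z) (fun R hR => ?_)
      (by simp) ?_ h
    · funext j
      exact h1 _ (List.mem_map_of_mem (List.mem_finRange j))
    · obtain ⟨i, hi, rfl⟩ := List.mem_map.1 hR
      refine rowSol_packRow (by simp) ?_
      rw [List.map_map, rowDot_map]
      obtain ⟨m, hm, rfl⟩ := List.mem_iff_getElem.1 hi
      have := congrFun hz ⟨m, hm⟩
      rw [Matrix.mulVec, dotProduct] at this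
      rw [← List.sum_toFinset _ (List.nodup_finRange n), List.toFinset_finRange]
      refine Eq.trans (Finset.sum_congr rfl fun j _ => ?_) this
      congr 1
      change (((f I[m] j % 31).toNat : ℕ) : ZMod 31) = ((f I[m] j : ℤ) : ZMod 31)
      rw [← Int.cast_natCast, Int.toNat_of_nonneg (Int.emod_nonneg _ (by norm_num)),
        ZMod.intCast_eq_intCast_iff]
      exact Int.mod_modEq _ _
    · exact lt_of_le_of_lt (Nat.mul_le_mul_right _ (Nat.pow_le_pow_right (by norm_num) hn)) hB
  obtain ⟨g, hg⟩ := LinearMap.exists_leftInverse_of_injective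
    (Matrix.mulVecLin (M.map (Int.castRingHom (ZMod 31)))) (LinearMap.ker_eq_bot'.2 hM)
  have hN : LinearMap.toMatrix' g * M.map (Int.castRingHom (ZMod 31)) = 1 := by
    have := congrArg LinearMap.toMatrix' hg
    rwa [LinearMap.toMatrix'_comp, LinearMap.toMatrix'_id, ← Matrix.toLin'_apply',
      LinearMap.toMatrix'_toLin'] at this
  let N : Matrix (Fin n) (Fin I.length) ℤ := (LinearMap.toMatrix' g).map fun a => (a.val : ℤ)
  have hNs : N.map (Int.castRingHom (ZMod 31)) = LinearMap.toMatrix' g := by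
    ext i j
    simp [N]
  have hdet : (N * M).det ≠ 0 := by
    intro h
    have := congrArg (Int.castRingHom (ZMod 31)) h
    rw [RingHom.map_det, RingHom.mapMatrix_apply, Matrix.map_mul, hNs, hN, map_zero,
      Matrix.det_one] at this
    exact one_ne_zero this
  have hdet' : (((N * M).map (Int.castRingHom ℂ))).det ≠ 0 := by
    rw [← RingHom.mapMatrix_apply, ← RingHom.map_det]
    exact (map_ne_zero_iff _ (RingHom.injective_int _)).2 hdet
  refine Matrix.eq_zero_of_mulVec_eq_zero hdet' ?_
  rw [Matrix.map_mul, ← Matrix.mulVec_mulVec]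
  have : (M.map (Int.castRingHom ℂ)).mulVec x = 0 := by
    funext i
    exact hx _ (List.getElem_mem _)
  rw [this, Matrix.mulVec_zero]

end

end GMWeb

namespace GMWeb

open scoped Topology
open Filter MvPolynomial

noncomputable section

/-! ### Polynomials in the logarithms -/

theorem IsLogDet.subset_Ystar {D : Set C5} {L : Fin 10 → C5 → ℂ} (hL : IsLogDet D L) : D ⊆ Ystar :=
  fun y hy k => by rw [← (hL k).2 y hy]; exact Complex.exp_ne_zero _

theorem IsLogDet.hasFDerivAt {D : TopologicalSpace.Opens C5} {L : Fin 10 → C5 → ℂ}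
    (hL : IsLogDet (D : Set C5) L) {y : C5} (hy : y ∈ D) (k : Fin 10) :
    HasFDerivAt (L k) ((zeta k y)⁻¹ • fderiv ℂ (zeta k) y) y := by
  have h1 := ((hL k).1 y hy).differentiableAt.hasFDerivAt
  have h2 : zeta k =ᶠ[𝓝 y] fun y => Complex.exp (L k y) :=
    eventuallyEq_of_mem (D.isOpen.mem_nhds hy) fun z hz => ((hL k).2 z hz).symm
  have h3 := h1.cexp.congr_of_eventuallyEq h2
  rw [(hL k).2 y hy] at h3
  rwa [h3.fderiv, smul_smul, inv_mul_cancel₀ (hL.subset_Ystar hy k), one_smul]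

theorem IsLogDet.hasFDerivAt_logU {D : TopologicalSpace.Opens C5} {L : Fin 10 → C5 → ℂ}
    (hL : IsLogDet (D : Set C5) L) {y : C5} (hy : y ∈ D) (l : Fin 10) (s : Fin 3) :
    HasFDerivAt (logU L l s) (dlogU l s y) y := by
  rw [dlogU_eq (hL.subset_Ystar hy)]
  exact HasFDerivAt.fun_sum fun k _ => (hL.hasFDerivAt hy k).const_mul _

theorem IsLogDet.analyticAt_logU {D : TopologicalSpace.Opens C5} {L : Fin 10 → C5 → ℂ}
    (hL : IsLogDet (D : Set C5) L) {y : C5} (hy : y ∈ D) (l : Fin 10) (s : Fin 3) :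
    AnalyticAt ℂ (logU L l s) y :=
  Finset.analyticAt_fun_sum _ fun k _ => analyticAt_const.mul ((hL k).1 y hy)

theorem hasFDerivAt_eval {ι : Type*} [Fintype ι] {g : ι → C5 → ℂ} {g' : ι → C5 →L[ℂ] ℂ} {y : C5}
    (hg : ∀ s, HasFDerivAt (g s) (g' s) y) (Q : MvPolynomial ι ℂ) :
    HasFDerivAt (fun y => eval (fun s => g s y) Q)
      (∑ s, eval (fun s => g s y) (pderiv s Q) • g' s) y := by
  classical
  induction Q using MvPolynomial.induction_on with
  | C a =>
    simp only [eval_C]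
    exact (hasFDerivAt_const (𝕜 := ℂ) a y).congr_fderiv (by
      rw [Finset.sum_eq_zero fun s _ => ?_]
      rw [pderiv_C, map_zero]
      exact zero_smul ℂ (g' s))
  | add p q hp hq =>
    simp only [map_add]
    refine (hp.fun_add hq).congr_fderiv ?_
    rw [← Finset.sum_add_distrib]
    exact Finset.sum_congr rfl fun s _ => (add_smul _ _ _).symm
  | mul_X p i hp =>
    simp only [map_mul, eval_X]
    refine (hp.fun_mul (hg i)).congr_fderiv ?_
    ext v
    simp only [add_apply, smul_apply, sum_apply, smul_eq_mul, Derivation.leibniz, map_add, map_mul,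
      eval_X, add_mul, Finset.sum_add_distrib, Finset.mul_sum, mul_assoc]
    congr 1
    rw [Finset.sum_eq_single i]
    · simp
    · intro j _ hj; simp [pderiv_X_of_ne hj.symm]
    · simp

theorem analyticAt_eval {ι : Type*} {g : ι → C5 → ℂ} {y : C5} (hg : ∀ s, AnalyticAt ℂ (g s) y)
    (Q : MvPolynomial ι ℂ) : AnalyticAt ℂ (fun y => eval (fun s => g s y) Q) y := by
  induction Q using MvPolynomial.induction_on with
  | C a => simpa using analyticAt_const
  | add p q hp hq => simp only [map_add]; exact hp.fun_add hq
  | mul_X p i hp => simp only [map_mul, eval_X]; exact hp.fun_mul (hg i)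

theorem IsLogDet.hasFDerivAt_logFun {D : TopologicalSpace.Opens C5} {L : Fin 10 → C5 → ℂ}
    (hL : IsLogDet (D : Set C5) L) (Q : Fin 10 → MvPolynomial (Fin 3) ℂ) (l : Fin 10) (y : D) :
    HasFDerivAt (logFun L Q l) (logForm D L (fun l s => pderiv s (Q l)) l y) y :=
  hasFDerivAt_eval (fun s => hL.hasFDerivAt_logU y.2 l s) (Q l)

theorem fderiv_U_two {y : C5} (hy : y ∈ Ystar) (l : Fin 10) :
    fderiv ℂ (U l 2) y = fderiv ℂ (U l 0) y - fderiv ℂ (U l 1) y :=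
  (((analyticAt_U hy l 0).differentiableAt.hasFDerivAt.const_add 1).sub
    (analyticAt_U hy l 1).differentiableAt.hasFDerivAt).fderiv

theorem fderiv_U_apply_eq_zero {y : C5} (hy : y ∈ Ystar) (l : Fin 10) (s : Fin 3) {v : C5}
    (h0 : fderiv ℂ (U l 0) y v = 0) (h1 : fderiv ℂ (U l 1) y v = 0) : fderiv ℂ (U l s) y v = 0 := by
  fin_cases s
  · exact h0
  · exact h1
  · change fderiv ℂ (U l 2) y v = 0
    rw [fderiv_U_two hy, sub_apply, h0, h1, sub_zero]

theorem IsLogDet.isBasic_eval {D : TopologicalSpace.Opens C5} {L : Fin 10 → C5 → ℂ}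
    (hL : IsLogDet (D : Set C5) L) (l : Fin 10) (Q : MvPolynomial (Fin 3) ℂ) :
    IsBasic D l (fun y => eval (fun s => logU L l s y) Q) := by
  refine ⟨fun y hy => analyticAt_eval (fun s => hL.analyticAt_logU hy l s) Q,
    fun y hy v h0 h1 => ?_⟩
  rw [(hasFDerivAt_eval (fun s => hL.hasFDerivAt_logU hy l s) Q).fderiv, sum_apply]
  refine Finset.sum_eq_zero fun s _ => ?_
  rw [smul_apply, dlogU, smul_apply, fderiv_U_apply_eq_zero (hL.subset_Ystar hy) l s h0 h1,
    smul_zero, smul_zero]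

theorem IsLogDet.logFun_mem {D : TopologicalSpace.Opens C5} {L : Fin 10 → C5 → ℂ}
    (hL : IsLogDet (D : Set C5) L) {Q : Fin 10 → MvPolynomial (Fin 3) ℂ}
    (h : ∀ y ∈ D, ∑ l, logFun L Q l y = 0) : logFun L Q ∈ Z0 D :=
  ⟨fun l => hL.isBasic_eval l (Q l), h⟩

theorem IsLogDet.d0_logFun {D : TopologicalSpace.Opens C5} {L : Fin 10 → C5 → ℂ}
    (hL : IsLogDet (D : Set C5) L) {Q : Fin 10 → MvPolynomial (Fin 3) ℂ} (h : logFun L Q ∈ Z0 D) :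
    d0 D ((K0 D).mkQ ⟨logFun L Q, h⟩) = logForm D L (fun l s => pderiv s (Q l)) := by
  funext l y
  exact (hL.hasFDerivAt_logFun Q l y).fderiv

theorem IsBasic.mul {D : TopologicalSpace.Opens C5} {l : Fin 10} {f g : C5 → ℂ}
    (hf : IsBasic D l f) (hg : IsBasic D l g) : IsBasic D l (fun y => f y * g y) := by
  refine ⟨hf.1.mul hg.1, fun y hy v h0 h1 => ?_⟩
  rw [((hf.1 y hy).differentiableAt.hasFDerivAt.fun_mul (hg.1 y hy).differentiableAt.hasFDerivAt).fderiv,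
    add_apply, smul_apply, smul_apply, hf.2 y hy v h0 h1, hg.2 y hy v h0 h1, smul_zero, smul_zero,
    add_zero]

theorem isBasic_inv_U {D : TopologicalSpace.Opens C5} (hDY : (D : Set C5) ⊆ Ystar) (l : Fin 10)
    (s : Fin 3) : IsBasic D l (fun y => (U l s y)⁻¹) := by
  refine ⟨fun y hy => (analyticAt_U (hDY hy) l s).inv (U_ne_zero (hDY hy) l s),
    fun y hy v h0 h1 => ?_⟩
  have h := (hasDerivAt_inv (U_ne_zero (hDY hy) l s)).comp_hasFDerivAt y
    (analyticAt_U (hDY hy) l s).differentiableAt.hasFDerivAt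
  rw [Function.comp_def] at h
  rw [h.fderiv, smul_apply, fderiv_U_apply_eq_zero (hDY hy) l s h0 h1, smul_zero]

theorem IsLogDet.logForm_mem {D : TopologicalSpace.Opens C5} {L : Fin 10 → C5 → ℂ}
    (hL : IsLogDet (D : Set C5) L) {P : Fin 10 → Fin 3 → MvPolynomial (Fin 3) ℂ}
    (h : ∑ l, logForm D L P l = 0) : logForm D L P ∈ AR1 D := by
  refine ⟨fun l => ?_, h⟩
  have hb (s : Fin 3) := (hL.isBasic_eval l (P l s)).mul (isBasic_inv_U hL.subset_Ystar l s)
  -- Since `dU_{l,3} = dU_{l,1} - dU_{l,2}`, the third term is distributed over the other two; the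
  -- coefficients `P_s / U_{l,s}` are basic.
  refine ⟨_, _, (hb 0).add (hb 2), (hb 1).add ((hb 2).smul (-1)), fun y => ?_⟩
  rw [logForm, Fin.sum_univ_three, dlogU, dlogU, dlogU, fderiv_U_two (hL.subset_Ystar y.2)]
  ext v
  simp only [add_apply, smul_apply, sub_apply, Pi.add_apply, Pi.smul_apply, smul_eq_mul]
  ring

/-- The form version of the identity attached to an abelian relation. -/
theorem sum_d0 {D : TopologicalSpace.Opens C5} (x : AR0 D) : ∑ l, d0 D x l = 0 := by
  obtain ⟨f, rfl⟩ := (K0 D).mkQ_surjective x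
  funext y
  rw [Finset.sum_apply]
  have h1 := HasFDerivAt.fun_sum (u := Finset.univ) fun l (_ : l ∈ Finset.univ) =>
    ((f.2.1 l).1 y y.2).differentiableAt.hasFDerivAt
  have h2 : (fun z => ∑ l, f.1 l z) =ᶠ[𝓝 (y : C5)] fun _ => 0 :=
    eventuallyEq_of_mem (D.isOpen.mem_nhds y.2) f.2.2
  exact h1.unique ((hasFDerivAt_const (0 : ℂ) (y : C5)).congr_of_eventuallyEq h2)

theorem exists_const_of_fderiv_eq_zero {D : TopologicalSpace.Opens C5}
    (hD : IsPreconnected (D : Set C5)) {f : C5 → ℂ} (hf : AnalyticOnNhd ℂ f D)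
    (h : ∀ y ∈ D, fderiv ℂ f y = 0) : ∃ c, ∀ y ∈ D, f y = c := by
  rcases (D : Set C5).eq_empty_or_nonempty with he | ⟨y₀, hy₀⟩
  · exact ⟨0, fun y hy => absurd (he ▸ hy : y ∈ (∅ : Set C5)) (Set.notMem_empty y)⟩
  · exact ⟨f y₀, fun y hy => D.isOpen.is_const_of_fderiv_eq_zero hD hf.differentiableOn h hy hy₀⟩

theorem d0_injective {D : TopologicalSpace.Opens C5} (hD : IsPreconnected (D : Set C5)) :
    Function.Injective (d0 D) := by
  rw [injective_iff_map_eq_zero]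
  intro x hx
  obtain ⟨f, rfl⟩ := (K0 D).mkQ_surjective x
  rw [Submodule.mkQ_apply, Submodule.Quotient.mk_eq_zero]
  exact fun l => exists_const_of_fderiv_eq_zero hD (f.2.1 l).1 fun y hy =>
    congrFun (congrFun hx l) ⟨y, hy⟩

/-- Integration of a relation between exact logarithmic forms. -/
theorem IsLogDet.exists_primitive {D : TopologicalSpace.Opens C5}
    (hD : IsPreconnected (D : Set C5)) {L : Fin 10 → C5 → ℂ} (hL : IsLogDet (D : Set C5) L)
    {Q : Fin 10 → MvPolynomial (Fin 3) ℂ}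
    (h : ∑ l, logForm D L (fun l s => pderiv s (Q l)) l = 0) :
    ∃ f : Z0 D, d0 D ((K0 D).mkQ f) = logForm D L (fun l s => pderiv s (Q l)) := by
  obtain ⟨c, hc⟩ := exists_const_of_fderiv_eq_zero hD
    (f := fun y => ∑ l, logFun L Q l y)
    (fun y hy => Finset.analyticAt_fun_sum _ fun l _ => (hL.isBasic_eval l (Q l)).1 y hy)
    (fun y hy => by
      have := HasFDerivAt.fun_sum (u := Finset.univ) fun l (_ : l ∈ Finset.univ) =>
        hL.hasFDerivAt_logFun Q l ⟨y, hy⟩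
      rw [this.fderiv]
      have h1 := congrFun h ⟨y, hy⟩
      rwa [Finset.sum_apply] at h1)
  -- The primitives add up to a constant, which is subtracted from one arbitrary component; the
  -- differentials do not see it.
  refine ⟨⟨logFun L (fun l => Q l - if l = 0 then C c else 0), hL.logFun_mem fun y hy => ?_⟩, ?_⟩
  · simp only [logFun, map_sub, Finset.sum_sub_distrib]
    rw [show ∑ l, eval (fun s => logU L l s y) (Q l) = c from hc y hy,
      Finset.sum_eq_single (0 : Fin 10)]
    · simp
    · intro l _ hl; simp [hl]
    · simp
  · rw [hL.d0_logFun]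
    congr 1
    funext l s
    split_ifs <;> simp

/-! ### Independence of the logarithms -/

/-- A submersion is open, so the image of `D` under `U_l` contains a product of discs, on which only
the zero polynomial vanishes. -/
theorem eval_eq_zero_of_U {D : TopologicalSpace.Opens C5} (hDY : (D : Set C5) ⊆ Ystar)
    (hne : (D : Set C5).Nonempty) (l : Fin 10) {p : MvPolynomial (Fin 2) ℂ}
    (h : ∀ y ∈ D, eval ![U l 0 y, U l 1 y] p = 0) (x : Fin 2 → ℂ) : eval x p = 0 := by
  obtain ⟨y, hy⟩ := hne
  let F : C5 → Fin 2 → ℂ := fun y i => U l i.castSucc y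
  have hF : HasStrictFDerivAt F
      (ContinuousLinearMap.pi fun i : Fin 2 => fderiv ℂ (U l i.castSucc) y) y :=
    hasStrictFDerivAt_pi.2 fun i => (analyticAt_U (hDY hy) l _).hasStrictFDerivAt
  obtain ⟨e₀, e₁, h00, h10, h01, h11⟩ := exists_dual_vectors (hDY hy) l
  have hs := hF.map_nhds_eq_of_surj (LinearMap.range_eq_top.2 fun w => ⟨w 0 • e₀ + w 1 • e₁, by
    funext i
    fin_cases i
    · change fderiv ℂ (U l 0) y (w 0 • e₀ + w 1 • e₁) = w 0
      rw [map_add, map_smul, map_smul, h00, h01]; simp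
    · change fderiv ℂ (U l 1) y (w 0 • e₀ + w 1 • e₁) = w 1
      rw [map_add, map_smul, map_smul, h10, h11]; simp⟩)
  have h1 : F '' D ∈ 𝓝 (F y) := by
    rw [← hs]; exact image_mem_map (D.isOpen.mem_nhds hy)
  obtain ⟨ε, hε, hball⟩ := Metric.mem_nhds_iff.1 h1
  have : p = 0 := by
    refine MvPolynomial.funext_set (fun i => Metric.ball (F y i) ε)
      (fun i => infinite_of_mem_nhds (F y i) (Metric.ball_mem_nhds _ hε)) fun w hw => ?_
    obtain ⟨z, hz, rfl⟩ := hball (show w ∈ Metric.ball (F y) ε by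
      rw [Metric.mem_ball, dist_pi_lt_iff hε]
      exact fun i => hw i trivial)
    rw [map_zero, ← h z hz]
    congr 2
    funext i
    fin_cases i <;> rfl
  rw [this, map_zero]

/-- Elimination of the values `p0`, `p1`, `p2`, where logarithms occur. In `g1 - x A0 + (z - x) A1`
and in `A0 + A1 + B0 + B1` these values cancel, which leaves polynomial relations between the
`U_{l,s}` with the constants `b s t` as coefficients. -/
theorem second_order_relations {x w z p0 p1 p2 b00 b01 b02 b11 b12 b22 : ℂ} (hx : x ≠ 0) (hw : w ≠ 0)
    (hz : z ≠ 0) (g1 : z * p0 + x * p2 = 0)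
    (A0 : z * (b00 * x⁻¹ + b02 * z⁻¹) + p0 + x * (b02 * x⁻¹ + b22 * z⁻¹) + p2 = 0)
    (A1 : z * (b01 * w⁻¹ - b02 * z⁻¹) - p0 + x * (b12 * w⁻¹ - b22 * z⁻¹) = 0)
    (B0 : z * (b01 * x⁻¹ + b12 * z⁻¹) + p1 - w * (b02 * x⁻¹ + b22 * z⁻¹) = 0)
    (B1 : z * (b11 * w⁻¹ - b12 * z⁻¹) - p1 - w * (b12 * w⁻¹ - b22 * z⁻¹) - p2 = 0) :
    (z - x) * (z ^ 2 * b01 - w * z * b02 + x * z * b12 - x * w * b22) - w * z ^ 2 * b00 -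
        2 * x * w * z * b02 - x ^ 2 * w * b22 = 0 ∧
      w * z * b01 - x * w * b12 - w ^ 2 * b02 + x * z * b01 + x * w * b02 + x ^ 2 * b12 +
        w * z * b00 + x * z * b11 = 0 := by
  constructor
  · have e : (z - x) * (z ^ 2 * b01 - w * z * b02 + x * z * b12 - x * w * b22) - w * z ^ 2 * b00 -
        2 * x * w * z * b02 - x ^ 2 * w * b22 = w * z * ((z * p0 + x * p2) -
        x * (z * (b00 * x⁻¹ + b02 * z⁻¹) + p0 + x * (b02 * x⁻¹ + b22 * z⁻¹) + p2) +
        (z - x) * (z * (b01 * w⁻¹ - b02 * z⁻¹) - p0 + x * (b12 * w⁻¹ - b22 * z⁻¹))) := by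
      field_simp
      ring
    rw [e, g1, A0, A1]
    ring
  · have e : w * z * b01 - x * w * b12 - w ^ 2 * b02 + x * z * b01 + x * w * b02 + x ^ 2 * b12 +
        w * z * b00 + x * z * b11 = x * w *
        ((z * (b01 * x⁻¹ + b12 * z⁻¹) + p1 - w * (b02 * x⁻¹ + b22 * z⁻¹)) +
        (z * (b11 * w⁻¹ - b12 * z⁻¹) - p1 - w * (b12 * w⁻¹ - b22 * z⁻¹) - p2) +
        (z * (b00 * x⁻¹ + b02 * z⁻¹) + p0 + x * (b02 * x⁻¹ + b22 * z⁻¹) + p2) +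
        (z * (b01 * w⁻¹ - b02 * z⁻¹) - p0 + x * (b12 * w⁻¹ - b22 * z⁻¹))) := by
      field_simp
      ring
    rw [e, A0, A1, B0, B1]
    ring

/-- The coefficients of `dU_{l,1}` and `dU_{l,2}` give two equations between the `p s`.
Differentiating them once makes it possible to eliminate the logarithms; the outcome is polynomial
identities in `U_{l,1}` and `U_{l,2}`, valid for all arguments, which force `b = 0`. The original
equations then have constant `p s` and give `α = 0`. -/
theorem IsLogDet.independent {D : TopologicalSpace.Opens C5} (hne : (D : Set C5).Nonempty)
    {L : Fin 10 → C5 → ℂ} (hL : IsLogDet (D : Set C5) L) (l : Fin 10) {α : Fin 3 → ℂ}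
    {b : Fin 3 → Fin 3 → ℂ} (hb : ∀ s t, b s t = b t s)
    (h : ∀ y ∈ D, ∑ s, (α s + ∑ t, b s t * logU L l t y) • dlogU l s y = 0) : α = 0 ∧ b = 0 := by
  have hDY := hL.subset_Ystar
  obtain ⟨p, hp⟩ : ∃ p : Fin 3 → C5 → ℂ, ∀ s y, p s y = α s + ∑ t, b s t * logU L l t y :=
    ⟨_, fun _ _ => rfl⟩
  have hder {y : C5} (hy : y ∈ D) (s : Fin 3) :
      HasFDerivAt (p s) (∑ t, b s t • dlogU l t y) y := by
    rw [funext (hp s)]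
    exact (HasFDerivAt.fun_sum fun t _ => (hL.hasFDerivAt_logU hy l t).const_mul (b s t)).const_add
      (α s)
  have hG {y : C5} (hy : y ∈ D) : U l 2 y * p 0 y + U l 0 y * p 2 y = 0 ∧
      U l 2 y * p 1 y - U l 1 y * p 2 y = 0 := by
    obtain ⟨e₀, e₁, h00, h10, h01, h11⟩ := exists_dual_vectors (hDY hy) l
    have u0 := U_ne_zero (hDY hy) l 0
    have u1 := U_ne_zero (hDY hy) l 1
    have u2 := U_ne_zero (hDY hy) l 2
    have h := h y hy
    simp only [← hp] at h
    have h0 := congrArg (· e₀) h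
    have h1 := congrArg (· e₁) h
    simp only [Fin.sum_univ_three, dlogU, add_apply, smul_apply, fderiv_U_two (hDY hy), sub_apply,
      h00, h01, h10, h11, zero_apply, smul_eq_mul, mul_zero, mul_one, sub_zero, zero_sub, add_zero,
      zero_add, mul_neg] at h0 h1
    field_simp at h0 h1
    constructor
    · linear_combination h0
    · linear_combination h1
  have key {y : C5} (hy : y ∈ D) :
      (U l 2 y - U l 0 y) * (U l 2 y ^ 2 * b 0 1 - U l 1 y * U l 2 y * b 0 2 +
        U l 0 y * U l 2 y * b 1 2 - U l 0 y * U l 1 y * b 2 2) - U l 1 y * U l 2 y ^ 2 * b 0 0 -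
        2 * U l 0 y * U l 1 y * U l 2 y * b 0 2 - U l 0 y ^ 2 * U l 1 y * b 2 2 = 0 ∧
      U l 1 y * U l 2 y * b 0 1 - U l 0 y * U l 1 y * b 1 2 - U l 1 y ^ 2 * b 0 2 +
        U l 0 y * U l 2 y * b 0 1 + U l 0 y * U l 1 y * b 0 2 + U l 0 y ^ 2 * b 1 2 +
        U l 1 y * U l 2 y * b 0 0 + U l 0 y * U l 2 y * b 1 1 = 0 := by
    obtain ⟨e₀, e₁, h00, h10, h01, h11⟩ := exists_dual_vectors (hDY hy) l
    have u0 := U_ne_zero (hDY hy) l 0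
    have u1 := U_ne_zero (hDY hy) l 1
    have u2 := U_ne_zero (hDY hy) l 2
    have hU (s : Fin 3) := (analyticAt_U (hDY hy) l s).differentiableAt.hasFDerivAt
    have hz {G : C5 → ℂ} {G' : C5 →L[ℂ] ℂ} (hG' : HasFDerivAt G G' y) (h0 : ∀ z ∈ D, G z = 0) :
        G' = 0 :=
      hG'.unique ((hasFDerivAt_const (0 : ℂ) y).congr_of_eventuallyEq
        (eventuallyEq_of_mem (D.isOpen.mem_nhds hy) h0))
    have hA := hz (((hU 2).mul (hder hy 0)).add ((hU 0).mul (hder hy 2))) fun z hz => (hG hz).1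
    have hB := hz (((hU 2).mul (hder hy 1)).sub ((hU 1).mul (hder hy 2))) fun z hz => (hG hz).2
    have A0 := congrArg (· e₀) hA
    have A1 := congrArg (· e₁) hA
    have B0 := congrArg (· e₀) hB
    have B1 := congrArg (· e₁) hB
    simp only [Fin.sum_univ_three, dlogU, add_apply, smul_apply, fderiv_U_two (hDY hy), sub_apply,
      h00, h01, h10, h11, zero_apply, smul_eq_mul, hb 1 0, hb 2 0, hb 2 1] at A0 A1 B0 B1
    obtain ⟨g1, g2⟩ := hG hy
    exact second_order_relations (p1 := p 1 y) u0 u1 u2 g1 (by linear_combination A0) (by linear_combination A1)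
      (by linear_combination B0) (by linear_combination B1)
  have k1 (x : Fin 2 → ℂ) := eval_eq_zero_of_U hDY hne l
    (p := (1 - X 1) * ((1 + X 0 - X 1) ^ 2 * C (b 0 1) - X 1 * (1 + X 0 - X 1) * C (b 0 2) +
        X 0 * (1 + X 0 - X 1) * C (b 1 2) - X 0 * X 1 * C (b 2 2)) -
        X 1 * (1 + X 0 - X 1) ^ 2 * C (b 0 0) - 2 * X 0 * X 1 * (1 + X 0 - X 1) * C (b 0 2) -
        X 0 ^ 2 * X 1 * C (b 2 2))
    (fun y hy => by
      rw [← (key hy).1, show U l 2 y = 1 + U l 0 y - U l 1 y from rfl]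
      simp only [map_add, map_sub, map_mul, map_pow, eval_X, eval_C, map_one, map_ofNat,
        Matrix.cons_val_zero, Matrix.cons_val_one]
      ring) x
  have k2 (x : Fin 2 → ℂ) := eval_eq_zero_of_U hDY hne l
    (p := X 1 * (1 + X 0 - X 1) * C (b 0 1) - X 0 * X 1 * C (b 1 2) - X 1 ^ 2 * C (b 0 2) +
        X 0 * (1 + X 0 - X 1) * C (b 0 1) + X 0 * X 1 * C (b 0 2) + X 0 ^ 2 * C (b 1 2) +
        X 1 * (1 + X 0 - X 1) * C (b 0 0) + X 0 * (1 + X 0 - X 1) * C (b 1 1))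
    (fun y hy => by
      rw [← (key hy).2, show U l 2 y = 1 + U l 0 y - U l 1 y from rfl]
      simp) x
  -- Six evaluations for the six entries of the symmetric matrix. Arguments with a zero coordinate
  -- are legitimate, the identities being polynomial.
  have m1 := k1 ![0, 2]
  have m2 := k1 ![0, -1]
  have m3 := k1 ![1, 0]
  have m4 := k1 ![1, 1]
  have m5 := k2 ![1, 2]
  have m6 := k2 ![1, 1]
  simp only [map_add, map_sub, map_mul, map_pow, eval_X, eval_C, map_one, map_ofNat,
    Matrix.cons_val_zero, Matrix.cons_val_one] at m1 m2 m3 m4 m5 m6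
  norm_num at m1 m2 m3 m4 m5 m6
  have b01 : b 0 1 = 0 := by linear_combination (m2 + 2 * m1) / 6
  have b12 : b 1 2 = 0 := by linear_combination (m3 - 4 * b01) / 2
  have b02 : b 0 2 = 0 := by linear_combination -(m5 + b12) / 2
  have b00 : b 0 0 = 0 := by linear_combination -(m1 + b01 + 2 * b02) / 2
  have b22 : b 2 2 = 0 := by linear_combination -m4 - b00 - 2 * b02
  have b11 : b 1 1 = 0 := by linear_combination m6 - 2 * b01 - b00
  have hb0 : b = 0 := by
    funext s t
    fin_cases s <;> fin_cases t <;> simp [b01, b12, b02, b00, b22, b11, hb 1 0, hb 2 0, hb 2 1]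
  have hpα (s : Fin 3) (y : C5) : p s y = α s := by rw [hp, hb0]; simp
  have hq (x : Fin 2 → ℂ) := eval_eq_zero_of_U hDY hne l
    (p := (1 + X 0 - X 1) * C (α 0) + X 0 * C (α 2))
    (fun y hy => by
      have := (hG hy).1
      rw [hpα, hpα, show U l 2 y = 1 + U l 0 y - U l 1 y from rfl] at this
      simpa using this) x
  have hq' (x : Fin 2 → ℂ) := eval_eq_zero_of_U hDY hne l
    (p := (1 + X 0 - X 1) * C (α 1) - X 1 * C (α 2))
    (fun y hy => by
      have := (hG hy).2
      rw [hpα, hpα, show U l 2 y = 1 + U l 0 y - U l 1 y from rfl] at this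
      simpa using this) x
  have a0 := hq ![0, 0]
  have a2 := hq ![1, 2]
  have a1 := hq' ![0, 0]
  simp only [map_add, map_sub, map_mul, eval_X, eval_C, map_one,
    Matrix.cons_val_zero, Matrix.cons_val_one] at a0 a1 a2
  norm_num at a0 a1 a2
  refine ⟨?_, hb0⟩
  funext s
  fin_cases s
  · exact a0
  · exact a1
  · exact a2

end

end GMWeb

namespace GMWeb

open scoped Topology
open Filter MvPolynomial

noncomputable section

/-! ### The relations of weight one and two -/

/-- The tuple of linear forms with coefficients `α`. -/
def linPoly : (Fin 10 → Fin 3 → ℂ) →ₗ[ℂ] Fin 10 → MvPolynomial (Fin 3) ℂ where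
  toFun α l := ∑ s, C (α l s) * X s
  map_add' α β := by
    funext l
    simp only [Pi.add_apply, C_add, add_mul, Finset.sum_add_distrib]
  map_smul' a α := by
    funext l
    simp only [Pi.smul_apply, smul_eq_mul, C_mul, Finset.smul_sum, smul_eq_C_mul, mul_assoc,
      RingHom.id_apply]

/-- The tuple of quadratic forms with coefficients `c` (without square terms). -/
def quadPoly : (Fin 10 → Pair → ℂ) →ₗ[ℂ] Fin 10 → MvPolynomial (Fin 3) ℂ where
  toFun c l := ∑ p : Pair, C (c l p) * (X p.1.1 * X p.1.2)
  map_add' α β := by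
    funext l
    simp only [Pi.add_apply, C_add, add_mul, Finset.sum_add_distrib]
  map_smul' a α := by
    funext l
    simp only [Pi.smul_apply, smul_eq_mul, C_mul, Finset.smul_sum, smul_eq_C_mul, mul_assoc,
      RingHom.id_apply]

theorem quad_eq_quadPoly (c : Fin 10 → Pair → ℤ) : quad c = quadPoly (fun l p => (c l p : ℂ)) := rfl

/-- `logFun` as a linear map. -/
def logFunₗ (L : Fin 10 → C5 → ℂ) :
    (Fin 10 → MvPolynomial (Fin 3) ℂ) →ₗ[ℂ] Fin 10 → C5 → ℂ where
  toFun := logFun L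
  map_add' P Q := by funext l y; simp [logFun]
  map_smul' a P := by funext l y; simp [logFun, smul_eval]

/-- The tuples of polynomials in the logarithms giving abelian relations. -/
def relations (D : TopologicalSpace.Opens C5) (L : Fin 10 → C5 → ℂ) :
    Submodule ℂ (Fin 10 → MvPolynomial (Fin 3) ℂ) := (Z0 D).comap (logFunₗ L)

/-- The class in `AR⁰` of a tuple of polynomials in the logarithms. -/
def logClass (D : TopologicalSpace.Opens C5) (L : Fin 10 → C5 → ℂ) : relations D L →ₗ[ℂ] AR0 D :=
  (K0 D).mkQ ∘ₗ ((logFunₗ L).restrict fun _ h => h)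

/-- The space of coefficients of the relations of weight one. -/
def linRel : Submodule ℂ (Fin 10 → Fin 3 → ℂ) where
  carrier := {α | ∀ k, ∑ l, ∑ s, α l s * (expo l s k : ℂ) = 0}
  zero_mem' k := by simp
  add_mem' {α β} hα hβ k := by
    simp only [Pi.add_apply, add_mul, Finset.sum_add_distrib, hα k, hβ k, add_zero]
  smul_mem' a α hα k := by
    simp only [Pi.smul_apply, smul_eq_mul, mul_assoc, ← Finset.mul_sum, hα k, mul_zero]

/-- Thirty unknowns and ten equations. Equality is not computed here: it comes later from the bound
on the rank. -/
theorem twenty_le_finrank_linRel : 20 ≤ Module.finrank ℂ linRel := by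
  let f : (Fin 10 → Fin 3 → ℂ) →ₗ[ℂ] (Fin 10 → ℂ) :=
    { toFun := fun α k => ∑ l, ∑ s, α l s * (expo l s k : ℂ)
      map_add' := fun α β => by
        funext k
        simp only [Pi.add_apply, add_mul, Finset.sum_add_distrib]
      map_smul' := fun a α => by
        funext k
        simp only [Pi.smul_apply, smul_eq_mul, mul_assoc, ← Finset.mul_sum, RingHom.id_apply] }
  have h : linRel = LinearMap.ker f := by
    ext α
    exact funext_iff.symm
  have h1 := f.finrank_range_add_finrank_ker
  have h2 := (LinearMap.range f).finrank_le
  rw [← h] at h1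
  simp only [Module.finrank_pi_fintype, Module.finrank_self, Finset.sum_const, Finset.card_univ,
    Fintype.card_fin, smul_eq_mul] at h1 h2
  omega

theorem IsLogDet.linPoly_mem {D : TopologicalSpace.Opens C5} {L : Fin 10 → C5 → ℂ}
    (hL : IsLogDet (D : Set C5) L) {α : Fin 10 → Fin 3 → ℂ} (hα : α ∈ linRel) :
    linPoly α ∈ relations D L := by
  refine hL.logFun_mem fun y _ => ?_
  have h (l : Fin 10) : logFun L (linPoly α) l y = ∑ k, ∑ s, α l s * (expo l s k : ℂ) * L k y := by
    simp only [logFun, linPoly, LinearMap.coe_mk, AddHom.coe_mk, map_sum, map_mul, eval_C, eval_X,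
      logU, Finset.mul_sum, mul_assoc]
    rw [Finset.sum_comm]
  simp only [h]
  rw [Finset.sum_comm]
  refine Finset.sum_eq_zero fun k _ => ?_
  simp only [← Finset.sum_mul, hα k, zero_mul]

/-- The left-hand side is a quadratic form in the values `L k y` whose polarisation is zero by
hypothesis. The identity is therefore formal: it uses no property of the functions `L k`. -/
theorem sum_quad_eq_zero (L : Fin 10 → C5 → ℂ) {c : Fin 10 → Pair → ℤ}
    (h : ∀ k m, ∑ l, ∑ p : Pair,
      c l p * (expo l p.1.1 k * expo l p.1.2 m + expo l p.1.1 m * expo l p.1.2 k) = 0) (y : C5) :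
    ∑ l, ∑ p : Pair, (c l p : ℂ) * (logU L l p.1.1 y * logU L l p.1.2 y) = 0 := by
  have e : ∑ l, ∑ p : Pair, (c l p : ℂ) * (logU L l p.1.1 y * logU L l p.1.2 y) =
      ∑ k, ∑ m, (∑ l, ∑ p : Pair, (c l p : ℂ) * (expo l p.1.1 m * expo l p.1.2 k)) *
        (L k y * L m y) := by
    simp only [logU, Finset.mul_sum, Finset.sum_mul]
    have h1 (l : Fin 10) : ∀ F : Pair → Fin 10 → Fin 10 → ℂ, ∑ p, ∑ k, ∑ m, F p k m =
        ∑ k, ∑ m, ∑ p, F p k m := fun F => by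
      rw [Finset.sum_comm]
      exact Finset.sum_congr rfl fun k _ => Finset.sum_comm
    simp only [h1 0]
    rw [Finset.sum_comm]
    refine Finset.sum_congr rfl fun k _ => ?_
    rw [Finset.sum_comm]
    refine Finset.sum_congr rfl fun m _ => Finset.sum_congr rfl fun l _ =>
      Finset.sum_congr rfl fun p _ => ?_
    ring
  have e2 := e.trans Finset.sum_comm
  have h2 : ∑ k, ∑ m, (∑ l, ∑ p : Pair, (c l p : ℂ) * (expo l p.1.1 m * expo l p.1.2 k)) *
      (L k y * L m y) + ∑ k, ∑ m, (∑ l, ∑ p : Pair, (c l p : ℂ) *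
      (expo l p.1.1 k * expo l p.1.2 m)) * (L m y * L k y) = 0 := by
    simp only [← Finset.sum_add_distrib]
    refine Finset.sum_eq_zero fun k _ => Finset.sum_eq_zero fun m _ => ?_
    rw [mul_comm (L m y), ← add_mul]
    have := h k m
    have h3 : ((∑ l, ∑ p : Pair, c l p *
      (expo l p.1.1 k * expo l p.1.2 m + expo l p.1.1 m * expo l p.1.2 k) : ℤ) : ℂ) = 0 := by
      rw [this]; simp
    push_cast at h3
    simp only [mul_add, Finset.sum_add_distrib] at h3
    rw [add_comm, h3, zero_mul]
  rw [← e, ← e2] at h2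
  exact add_self_eq_zero.1 h2

theorem logFun_quad (L : Fin 10 → C5 → ℂ) (c : Fin 10 → Pair → ℤ) (l : Fin 10) (y : C5) :
    logFun L (quad c) l y = ∑ p : Pair, (c l p : ℂ) * (logU L l p.1.1 y * logU L l p.1.2 y) := by
  simp [logFun, quad]

/-- The ten triples, in lexicographic order. -/
def triple : Fin 10 → Triple :=
  ![⟨{0, 1, 2}, rfl⟩, ⟨{0, 1, 3}, rfl⟩, ⟨{0, 1, 4}, rfl⟩, ⟨{0, 2, 3}, rfl⟩, ⟨{0, 2, 4}, rfl⟩,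
    ⟨{0, 3, 4}, rfl⟩, ⟨{1, 2, 3}, rfl⟩, ⟨{1, 2, 4}, rfl⟩, ⟨{1, 3, 4}, rfl⟩, ⟨{2, 3, 4}, rfl⟩]

theorem triple_bijective : Function.Bijective triple := by decide +kernel

/-- The coefficients of the ten identities of weight two: one row of three coefficients for each
index in `{1, …, 5}`. -/
def coefTable : Fin 10 → Fin 5 → Fin 3 → ℤ :=
  ![![![0, 1, -1], ![0, -1, 1], ![0, 1, -1], 0, 0],
    ![![1, -1, 0], ![-1, 1, 0], 0, ![0, -1, 1], 0],
    ![![1, 0, -1], ![-1, 0, 1], 0, 0, ![0, -1, 1]],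
    ![![1, 0, -1], 0, ![-1, 1, 0], ![1, -1, 0], 0],
    ![![1, -1, 0], 0, ![-1, 0, 1], 0, ![1, -1, 0]],
    ![![0, 1, -1], 0, 0, ![1, 0, -1], ![-1, 0, 1]],
    ![0, ![1, 0, -1], ![-1, 0, 1], ![1, 0, -1], 0],
    ![0, ![1, -1, 0], ![-1, 1, 0], 0, ![1, 0, -1]],
    ![0, ![0, 1, -1], 0, ![1, -1, 0], ![-1, 1, 0]],
    ![0, 0, ![0, 1, -1], ![0, -1, 1], ![0, 1, -1]]]

/-- The coefficients of the identity of weight two attached to the `τ`-th triple. -/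
def coef (τ l : Fin 10) (p : Pair) : ℤ := coefTable τ (base l) (p.1.1 + p.1.2 - 1)

theorem sum_coef_expo : ∀ τ k m, ∑ l, ∑ p : Pair,
    coef τ l p * (expo l p.1.1 k * expo l p.1.2 m + expo l p.1.1 m * expo l p.1.2 k) = 0 := by
  decide +kernel

theorem IsLogDet.quad_mem {D : TopologicalSpace.Opens C5} {L : Fin 10 → C5 → ℂ}
    (hL : IsLogDet (D : Set C5) L) (τ : Fin 10) : quad (coef τ) ∈ relations D L := by
  refine hL.logFun_mem fun y _ => ?_
  simp only [logFun_quad]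
  exact sum_quad_eq_zero L (sum_coef_expo τ) y

/-- The combination of five of the systems `coef τ`, which form a basis of their span. -/
def coefComb : (Fin 5 → ℂ) →ₗ[ℂ] Fin 10 → Pair → ℂ where
  toFun γ l p := ∑ i, γ i * (coef (![0, 1, 2, 3, 7] i) l p : ℂ)
  map_add' γ δ := by
    funext l p
    simp only [Pi.add_apply, add_mul, Finset.sum_add_distrib]
  map_smul' a γ := by
    funext l p
    simp only [Pi.smul_apply, smul_eq_mul, mul_assoc, ← Finset.mul_sum, RingHom.id_apply]

theorem quadPoly_coefComb (γ : Fin 5 → ℂ) :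
    quadPoly (coefComb γ) = ∑ i, γ i • quad (coef (![0, 1, 2, 3, 7] i)) := by
  have h : coefComb γ = ∑ i, γ i • fun l p => (coef (![0, 1, 2, 3, 7] i) l p : ℂ) := by
    funext l p
    simp [coefComb, Finset.sum_apply]
  rw [h, map_sum]
  simp only [map_smul, quad_eq_quadPoly]

theorem IsLogDet.quadPoly_mem {D : TopologicalSpace.Opens C5} {L : Fin 10 → C5 → ℂ}
    (hL : IsLogDet (D : Set C5) L) (γ : Fin 5 → ℂ) : quadPoly (coefComb γ) ∈ relations D L := by
  rw [quadPoly_coefComb]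
  exact Submodule.sum_mem _ fun i _ => Submodule.smul_mem _ _ (hL.quad_mem _)

/-- Positions at which the five basic systems of coefficients have pivots. -/
def coefPivot : Fin 5 → Fin 10 × Pair :=
  ![(2, ⟨(1, 2), by decide⟩), (3, ⟨(1, 2), by decide⟩), (4, ⟨(0, 2), by decide⟩),
    (3, ⟨(0, 1), by decide⟩), (4, ⟨(0, 1), by decide⟩)]

/-- At each pivot exactly one of the five basic systems has a nonzero entry, and that entry is ±1.
This gives their independence and, later, the integrality of the coordinates. -/
theorem coef_coefPivot : ∀ i j : Fin 5,
    coef (![0, 1, 2, 3, 7] i) (coefPivot j).1 (coefPivot j).2 =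
      if i = j then ![-1, 1, -1, 1, 1] i else 0 := by decide +kernel

theorem coefComb_coefPivot (γ : Fin 5 → ℂ) (j : Fin 5) :
    coefComb γ (coefPivot j).1 (coefPivot j).2 = γ j * ((![-1, 1, -1, 1, 1] j : ℤ) : ℂ) := by
  simp only [coefComb, LinearMap.coe_mk, AddHom.coe_mk, coef_coefPivot]
  rw [Finset.sum_eq_single j]
  · rw [if_pos rfl]
  · intro i _ hi; rw [if_neg hi]; simp
  · simp

theorem coefComb_injective : Function.Injective coefComb := by
  rw [injective_iff_map_eq_zero]
  intro γ h
  funext j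
  have h1 := coefComb_coefPivot γ j
  rw [h] at h1
  have h2 : ((![-1, 1, -1, 1, 1] j : ℤ) : ℂ) ≠ 0 := by fin_cases j <;> simp
  exact ((mul_eq_zero.1 h1.symm).resolve_right h2)

/-- The relations of weight one. -/
def IsLogDet.rel1 {D : TopologicalSpace.Opens C5} {L : Fin 10 → C5 → ℂ}
    (hL : IsLogDet (D : Set C5) L) : linRel →ₗ[ℂ] AR0 D :=
  logClass D L ∘ₗ (linPoly ∘ₗ linRel.subtype).codRestrict _ fun α => hL.linPoly_mem α.2

/-- The relations of weight two. -/
def IsLogDet.rel2 {D : TopologicalSpace.Opens C5} {L : Fin 10 → C5 → ℂ}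
    (hL : IsLogDet (D : Set C5) L) : (Fin 5 → ℂ) →ₗ[ℂ] AR0 D :=
  logClass D L ∘ₗ (quadPoly ∘ₗ coefComb).codRestrict _ fun γ => hL.quadPoly_mem γ

theorem IsLogDet.isLogClass_rel1 {D : TopologicalSpace.Opens C5} {L : Fin 10 → C5 → ℂ}
    (hL : IsLogDet (D : Set C5) L) (α : linRel) : IsLogClass D L (linPoly α) (hL.rel1 α) :=
  ⟨hL.linPoly_mem α.2, rfl⟩

theorem IsLogDet.isLogClass_rel2 {D : TopologicalSpace.Opens C5} {L : Fin 10 → C5 → ℂ}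
    (hL : IsLogDet (D : Set C5) L) (γ : Fin 5 → ℂ) :
    IsLogClass D L (quadPoly (coefComb γ)) (hL.rel2 γ) :=
  ⟨hL.quadPoly_mem γ, rfl⟩

theorem IsLogDet.d0_of_isLogClass {D : TopologicalSpace.Opens C5} {L : Fin 10 → C5 → ℂ}
    (hL : IsLogDet (D : Set C5) L) {Q : Fin 10 → MvPolynomial (Fin 3) ℂ} {x : AR0 D}
    (h : IsLogClass D L Q x) : d0 D x = logForm D L (fun l s => pderiv s (Q l)) := by
  obtain ⟨h, rfl⟩ := h
  exact hL.d0_logFun h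

/-- The symmetric matrix of a quadratic form without square terms. -/
def pairMatrix (c : Pair → ℂ) (s t : Fin 3) : ℂ :=
  ∑ p : Pair, c p * if (s, t) = p.1 ∨ (t, s) = p.1 then 1 else 0

theorem pairMatrix_comm (c : Pair → ℂ) (s t : Fin 3) : pairMatrix c s t = pairMatrix c t s := by
  simp only [pairMatrix, or_comm]

theorem sum_pair {M : Type*} [AddCommMonoid M] (f : Pair → M) :
    ∑ p, f p = f ⟨(0, 1), by decide⟩ + f ⟨(0, 2), by decide⟩ + f ⟨(1, 2), by decide⟩ := by
  rw [show (Finset.univ : Finset Pair) =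
    {⟨(0, 1), by decide⟩, ⟨(0, 2), by decide⟩, ⟨(1, 2), by decide⟩} by decide +kernel,
    Finset.sum_insert (by decide), Finset.sum_insert (by decide), Finset.sum_singleton, add_assoc]

theorem pairMatrix_apply (c : Pair → ℂ) (p : Pair) : pairMatrix c p.1.1 p.1.2 = c p := by
  obtain ⟨⟨a, b⟩, hp⟩ := p
  rw [pairMatrix, sum_pair]
  fin_cases a <;> fin_cases b <;> first | exact absurd hp (by decide) | simp

theorem eval_pderiv_linPoly (α : Fin 10 → Fin 3 → ℂ) (l : Fin 10) (s : Fin 3) (v : Fin 3 → ℂ) :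
    eval v (pderiv s (linPoly α l)) = α l s := by
  simp only [linPoly, LinearMap.coe_mk, AddHom.coe_mk, map_sum, pderiv_C_mul, pderiv_X]
  rw [Finset.sum_eq_single s]
  · simp
  · intro t _ ht; simp [Pi.single_eq_of_ne ht]
  · simp

theorem eval_pderiv_quadPoly (c : Fin 10 → Pair → ℂ) (l : Fin 10) (s : Fin 3) (v : Fin 3 → ℂ) :
    eval v (pderiv s (quadPoly c l)) = ∑ t, pairMatrix (c l) s t * v t := by
  simp only [quadPoly, LinearMap.coe_mk, AddHom.coe_mk, pairMatrix, sum_pair,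
    Fin.sum_univ_three]
  fin_cases s <;> simp

theorem _root_.MvPolynomial.IsHomogeneous.eval_eq_sum {ι : Type*} [Fintype ι]
    {Q : MvPolynomial ι ℂ} (hQ : Q.IsHomogeneous 1) (v : ι → ℂ) :
    eval v Q = ∑ s, eval 0 (pderiv s Q) * v s := by
  have h := congrArg (eval v) hQ.sum_X_mul_pderiv
  rw [one_smul, map_sum] at h
  rw [← h]
  refine Finset.sum_congr rfl fun s _ => ?_
  rw [totalDegree_eq_zero_iff_eq_C.1 (Nat.le_zero.1 (hQ.pderiv (i := s)).totalDegree_le)]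
  simp [mul_comm]

theorem _root_.MvPolynomial.IsHomogeneous.eval_eq_const {ι : Type*}
    {Q : MvPolynomial ι ℂ} (hQ : Q.IsHomogeneous 0) (v : ι → ℂ) : eval v Q = eval 0 Q := by
  rw [totalDegree_eq_zero_iff_eq_C.1 (Nat.le_zero.1 hQ.totalDegree_le)]
  simp

/-- Independence, for polynomials of degree at most two. -/
theorem IsLogDet.eq_of_logForm_eq {D : TopologicalSpace.Opens C5} (hne : (D : Set C5).Nonempty)
    {L : Fin 10 → C5 → ℂ} (hL : IsLogDet (D : Set C5) L) {P P' : Fin 10 → Fin 3 → MvPolynomial (Fin 3) ℂ}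
    (h : logForm D L P = logForm D L P')
    {α α' : Fin 10 → Fin 3 → ℂ} {b b' : Fin 10 → Fin 3 → Fin 3 → ℂ}
    (hb : ∀ l s t, b l s t = b l t s) (hb' : ∀ l s t, b' l s t = b' l t s)
    (hP : ∀ l s v, eval v (P l s) = α l s + ∑ t, b l s t * v t)
    (hP' : ∀ l s v, eval v (P' l s) = α' l s + ∑ t, b' l s t * v t) : α = α' ∧ b = b' := by
  have key (l : Fin 10) := hL.independent hne l (α := α l - α' l) (b := b l - b' l)
    (fun s t => by simp only [Pi.sub_apply, hb l s t, hb' l s t]) (fun y hy => by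
      have h1 := congrFun (congrFun h l) ⟨y, hy⟩
      rw [← sub_eq_zero, logForm, logForm, ← Finset.sum_sub_distrib] at h1
      rw [← h1]
      refine Finset.sum_congr rfl fun s _ => ?_
      refine Eq.trans ?_ (sub_smul _ _ _)
      rw [hP, hP']
      congr 1
      simp only [Pi.sub_apply, sub_mul, Finset.sum_sub_distrib]
      ring)
  exact ⟨funext fun l => sub_eq_zero.1 (key l).1, funext fun l => sub_eq_zero.1 (key l).2⟩

end

end GMWeb

namespace GMWeb

open scoped Topology
open Filter MvPolynomial

noncomputable section

/-! ### The structure of `AR⁰` -/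

/-- The commutator of two derivations is a derivation, and this one kills every variable. -/
theorem _root_.MvPolynomial.pderiv_pderiv_comm {ι R : Type*} [CommRing R] (i j : ι)
    (p : MvPolynomial ι R) : pderiv i (pderiv j p) = pderiv j (pderiv i p) := by
  classical
  have h : ⁅pderiv (R := R) i, pderiv j⁆ = 0 := derivation_ext fun k => by
    rw [Derivation.commutator_apply, pderiv_X, pderiv_X, Derivation.coe_zero, Pi.zero_apply,
      Pi.single_apply, Pi.single_apply]
    split_ifs <;> simp
  have := congrArg (fun d => d p) h
  simpa [Derivation.commutator_apply, sub_eq_zero] using this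


variable {D : TopologicalSpace.Opens C5} {L : Fin 10 → C5 → ℂ}

/-- The coefficients of a quadratic relation are determined by its class. -/
theorem IsLogDet.rel_ext (hD : (D : Set C5).Nonempty) (hL : IsLogDet (D : Set C5) L)
    {P : Fin 10 → Fin 3 → MvPolynomial (Fin 3) ℂ} {α : Fin 10 → Fin 3 → ℂ}
    {b : Fin 10 → Fin 3 → Fin 3 → ℂ} (hb : ∀ l s t, b l s t = b l t s)
    (hP : ∀ l s v, eval v (P l s) = α l s + ∑ t, b l s t * v t) {β : linRel} {γ : Fin 5 → ℂ}
    (h : d0 D (hL.rel1 β + hL.rel2 γ) = logForm D L P) :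
    α = β ∧ b = fun l => pairMatrix (coefComb γ l) := by
  have h1 : d0 D (hL.rel1 β + hL.rel2 γ) = logForm D L fun l s =>
      pderiv s (linPoly β l) + pderiv s (quadPoly (coefComb γ) l) := by
    rw [map_add, hL.d0_of_isLogClass (hL.isLogClass_rel1 β),
      hL.d0_of_isLogClass (hL.isLogClass_rel2 γ)]
    funext l y
    simp only [Pi.add_apply, logForm, map_add, ← Finset.sum_add_distrib]
    exact Finset.sum_congr rfl fun s _ => (add_smul _ _ _).symm
  rw [h1] at h
  exact hL.eq_of_logForm_eq hD h.symm hb (fun l s t => pairMatrix_comm _ s t) hP fun l s v => by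
    rw [map_add, eval_pderiv_linPoly, eval_pderiv_quadPoly]

theorem pairMatrix_injective : Function.Injective pairMatrix := fun c c' h => by
  funext p
  rw [← pairMatrix_apply c, h, pairMatrix_apply]

/-- The parametrisation of `AR⁰` by coefficients of relations of weight one and two. -/
def IsLogDet.rel (hL : IsLogDet (D : Set C5) L) : (linRel × (Fin 5 → ℂ)) →ₗ[ℂ] AR0 D :=
  hL.rel1.coprod hL.rel2

theorem IsLogDet.rel_injective (hD : (D : Set C5).Nonempty) (hL : IsLogDet (D : Set C5) L) :
    Function.Injective hL.rel := by
  rw [injective_iff_map_eq_zero]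
  rintro ⟨β, γ⟩ h
  have h1 : d0 D (hL.rel1 β + hL.rel2 γ) = logForm D L 0 := by
    have : hL.rel1 β + hL.rel2 γ = 0 := h
    rw [this, map_zero]
    funext l y
    refine (Finset.sum_eq_zero fun s _ => ?_).symm
    rw [Pi.zero_apply, Pi.zero_apply, map_zero]
    exact zero_smul ℂ (dlogU l s y)
  obtain ⟨h2, h3⟩ := hL.rel_ext hD (α := 0) (b := 0) (fun _ _ _ => rfl) (fun l s v => by simp) h1
  have hβ : β = 0 := Subtype.ext h2.symm
  have hγ : γ = 0 := by
    apply coefComb_injective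
    rw [map_zero]
    funext l
    apply pairMatrix_injective
    rw [← congrFun h3 l]
    funext s t
    simp [pairMatrix]
  rw [hβ, hγ, Prod.mk_zero_zero]

/-- The injection from a space of dimension at least 20 + 5 into one of dimension at most 25 forces
equality everywhere; the dimension of `linRel` comes out at the same time. -/
theorem IsLogDet.rel_bijective (hD : IsConnected (D : Set C5)) (hL : IsLogDet (D : Set C5) L) :
    Function.Bijective hL.rel ∧ Module.finrank ℂ linRel = 20 := by
  obtain ⟨hfin, hle⟩ := finrank_AR0_le hD hL.subset_Ystar
  have hinj := hL.rel_injective hD.nonempty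
  have h1 := LinearMap.finrank_le_finrank_of_injective hinj
  have h2 : Module.finrank ℂ (linRel × (Fin 5 → ℂ)) = Module.finrank ℂ linRel + 5 := by
    rw [Module.finrank_prod, Module.finrank_fin_fun]
  have h3 := twenty_le_finrank_linRel
  have h4 : Module.finrank ℂ linRel = 20 := by omega
  have h5 : Module.finrank ℂ (linRel × (Fin 5 → ℂ)) = Module.finrank ℂ (AR0 D) := by omega
  exact ⟨⟨hinj, (LinearMap.injective_iff_surjective_of_finrank_eq_finrank h5).1 hinj⟩, h4⟩

theorem IsLogDet.exists_rel (hD : IsConnected (D : Set C5)) (hL : IsLogDet (D : Set C5) L)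
    (x : AR0 D) : ∃ β γ, hL.rel1 β + hL.rel2 γ = x := by
  obtain ⟨⟨β, γ⟩, h⟩ := (hL.rel_bijective hD).1.2 x
  exact ⟨β, γ, h⟩

theorem IsLogDet.isCompl_range (hD : IsConnected (D : Set C5)) (hL : IsLogDet (D : Set C5) L) :
    IsCompl (LinearMap.range hL.rel1) (LinearMap.range hL.rel2) := by
  refine ⟨Submodule.disjoint_def.2 ?_, codisjoint_iff.2 (eq_top_iff.2 fun x _ => ?_)⟩
  · rintro x ⟨β, rfl⟩ ⟨γ, h⟩
    have h1 : hL.rel (β, -γ) = hL.rel (0, 0) := by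
      simp [IsLogDet.rel, h]
    have h2 := congrArg Prod.fst (hL.rel_injective hD.nonempty h1)
    rw [show β = 0 from h2, map_zero]
  · obtain ⟨β, γ, rfl⟩ := hL.exists_rel hD x
    exact Submodule.add_mem_sup ⟨β, rfl⟩ ⟨γ, rfl⟩

theorem isHomogeneous_linPoly (α : Fin 10 → Fin 3 → ℂ) (l : Fin 10) :
    (linPoly α l).IsHomogeneous 1 :=
  IsHomogeneous.sum _ _ _ fun s _ => (isHomogeneous_X ℂ s).C_mul _

theorem isHomogeneous_quadPoly (c : Fin 10 → Pair → ℂ) (l : Fin 10) :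
    (quadPoly c l).IsHomogeneous 2 :=
  IsHomogeneous.sum _ _ _ fun p _ => ((isHomogeneous_X ℂ p.1.1).mul (isHomogeneous_X ℂ p.1.2)).C_mul _

/-- Every class is already a sum `rel1 β + rel2 γ`. For a class given by linear forms, comparing
differentials shows that the quadratic part vanishes. -/
theorem IsLogDet.WAR0_one (hD : IsConnected (D : Set C5)) (hL : IsLogDet (D : Set C5) L) :
    WAR0 D L 1 = LinearMap.range hL.rel1 := by
  refine le_antisymm (Submodule.span_le.2 ?_) ?_
  · rintro x ⟨Q, hQ, hx⟩
    obtain ⟨β, γ, rfl⟩ := hL.exists_rel hD x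
    obtain ⟨-, h⟩ := hL.rel_ext hD.nonempty (α := fun l s => eval 0 (pderiv s (Q l))) (b := 0)
      (fun _ _ _ => rfl) (fun l s v => by
        simp [((hQ l).pderiv (i := s)).eval_eq_const v]) (hL.d0_of_isLogClass hx)
    have hγ : γ = 0 := by
      apply coefComb_injective
      rw [map_zero]
      funext l
      apply pairMatrix_injective
      rw [← congrFun h l]
      funext s t
      simp [pairMatrix]
    exact ⟨β, by rw [hγ, map_zero, add_zero]⟩
  · rintro _ ⟨β, rfl⟩
    exact Submodule.subset_span ⟨_, isHomogeneous_linPoly _, hL.isLogClass_rel1 β⟩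

theorem IsLogDet.WAR0_two (hD : IsConnected (D : Set C5)) (hL : IsLogDet (D : Set C5) L) :
    WAR0 D L 2 = LinearMap.range hL.rel2 := by
  refine le_antisymm (Submodule.span_le.2 ?_) ?_
  · rintro x ⟨Q, hQ, hx⟩
    obtain ⟨β, γ, rfl⟩ := hL.exists_rel hD x
    obtain ⟨h, -⟩ := hL.rel_ext hD.nonempty (α := 0)
      (b := fun l s t => eval 0 (pderiv t (pderiv s (Q l))))
      (fun l s t => by rw [pderiv_pderiv_comm]) (fun l s v => by
        simp [((hQ l).pderiv (i := s)).eval_eq_sum v]) (hL.d0_of_isLogClass hx)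
    have hβ : β = 0 := Subtype.ext h.symm
    exact ⟨γ, by rw [hβ, map_zero, zero_add]⟩
  · rintro _ ⟨γ, rfl⟩
    exact Submodule.subset_span ⟨_, isHomogeneous_quadPoly _, hL.isLogClass_rel2 γ⟩

theorem IsLogDet.rel1_injective (hD : IsConnected (D : Set C5)) (hL : IsLogDet (D : Set C5) L) :
    Function.Injective hL.rel1 := fun β β' h => by
  have : hL.rel (β, 0) = hL.rel (β', 0) := by simp [IsLogDet.rel, h]
  exact congrArg Prod.fst (hL.rel_injective hD.nonempty this)

theorem IsLogDet.rel2_injective (hD : IsConnected (D : Set C5)) (hL : IsLogDet (D : Set C5) L) :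
    Function.Injective hL.rel2 := fun β β' h => by
  have : hL.rel (0, β) = hL.rel (0, β') := by simp [IsLogDet.rel, h]
  exact congrArg Prod.snd (hL.rel_injective hD.nonempty this)

/-- The isomorphism between coefficients and relations of weight one. -/
def IsLogDet.equiv1 (hD : IsConnected (D : Set C5)) (hL : IsLogDet (D : Set C5) L) :
    linRel ≃ₗ[ℂ] WAR0 D L 1 :=
  (LinearEquiv.ofInjective hL.rel1 (hL.rel1_injective hD)).trans
    (LinearEquiv.ofEq _ _ (hL.WAR0_one hD).symm)

/-- The isomorphism between coefficients and relations of weight two. -/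
def IsLogDet.equiv2 (hD : IsConnected (D : Set C5)) (hL : IsLogDet (D : Set C5) L) :
    (Fin 5 → ℂ) ≃ₗ[ℂ] WAR0 D L 2 :=
  (LinearEquiv.ofInjective hL.rel2 (hL.rel2_injective hD)).trans
    (LinearEquiv.ofEq _ _ (hL.WAR0_two hD).symm)

theorem IsLogDet.coe_equiv1 (hD : IsConnected (D : Set C5)) (hL : IsLogDet (D : Set C5) L)
    (β : linRel) : (hL.equiv1 hD β : AR0 D) = hL.rel1 β := rfl

theorem IsLogDet.coe_equiv2 (hD : IsConnected (D : Set C5)) (hL : IsLogDet (D : Set C5) L)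
    (γ : Fin 5 → ℂ) : (hL.equiv2 hD γ : AR0 D) = hL.rel2 γ := rfl

theorem IsLogDet.finrank_WAR0_one (hD : IsConnected (D : Set C5))
    (hL : IsLogDet (D : Set C5) L) : Module.finrank ℂ (WAR0 D L 1) = 20 := by
  rw [← (hL.equiv1 hD).finrank_eq, (hL.rel_bijective hD).2]

theorem IsLogDet.finrank_WAR0_two (hD : IsConnected (D : Set C5))
    (hL : IsLogDet (D : Set C5) L) : Module.finrank ℂ (WAR0 D L 2) = 5 := by
  rw [← (hL.equiv2 hD).finrank_eq, Module.finrank_fin_fun]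

theorem IsLogDet.isCompl_WAR0 (hD : IsConnected (D : Set C5)) (hL : IsLogDet (D : Set C5) L) :
    IsCompl (WAR0 D L 1) (WAR0 D L 2) := by
  rw [hL.WAR0_one hD, hL.WAR0_two hD]
  exact hL.isCompl_range hD

/-! ### The forms of weight zero and one -/

/-- A form of weight 0 has constant coefficients with respect to the `d Log U_{l,s}`, so it is the
differential of a linear form in the logarithms; integrating the relation gives a 0-abelian
relation, again without quadratic part. -/
theorem IsLogDet.map_WAR0_one (hD : IsConnected (D : Set C5)) (hL : IsLogDet (D : Set C5) L) :
    (WAR0 D L 1).map (d0 D) = WAR1 D L 0 := by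
  refine le_antisymm (Submodule.map_le_iff_le_comap.2 ?_) (Submodule.span_le.2 ?_)
  · rw [hL.WAR0_one hD]
    rintro _ ⟨β, rfl⟩
    rw [Submodule.mem_comap]
    have h := hL.d0_of_isLogClass (hL.isLogClass_rel1 β)
    refine Submodule.subset_span ⟨?_, _, fun l s => (isHomogeneous_linPoly β l).pderiv, h⟩
    rw [h]
    apply hL.logForm_mem
    rw [← h]
    exact sum_d0 _
  · rintro η ⟨hη, P, hP, rfl⟩
    have h1 : logForm D L P =
        logForm D L fun l s => pderiv s (linPoly (fun l s => eval 0 (P l s)) l) := by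
      funext l y
      simp only [logForm]
      refine Finset.sum_congr rfl fun s _ => ?_
      rw [eval_pderiv_linPoly, (hP l s).eval_eq_const]
    rw [h1] at hη ⊢
    obtain ⟨f, hf⟩ := hL.exists_primitive hD.isPreconnected hη.2
    obtain ⟨β, γ, hβ⟩ := hL.exists_rel hD ((K0 D).mkQ f)
    rw [← hβ] at hf
    obtain ⟨-, h⟩ := hL.rel_ext hD.nonempty (α := fun l s => eval 0 (P l s)) (b := 0)
      (fun _ _ _ => rfl) (fun l s v => by
      rw [eval_pderiv_linPoly]; simp) hf
    have hγ : γ = 0 := by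
      apply coefComb_injective
      rw [map_zero]
      funext l
      apply pairMatrix_injective
      rw [← congrFun h l]
      funext s t
      simp [pairMatrix]
    rw [hγ, map_zero, add_zero] at hf
    rw [← hf]
    exact Submodule.mem_map_of_mem (by rw [hL.WAR0_one hD]; exact ⟨β, rfl⟩)

/-! ### The ten quadratic relations: determination up to sign -/

/-- The coefficients of the quadratic 1-abelian relations. -/
theorem IsLogDet.exists_coefComb (hD : IsConnected (D : Set C5)) (hL : IsLogDet (D : Set C5) L)
    {c : Fin 10 → Pair → ℤ} (h : logForm D L (dquad c) ∈ AR1 D) :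
    ∃ γ, (fun l p => (c l p : ℂ)) = coefComb γ ∧ d0 D (hL.rel2 γ) = logForm D L (dquad c) := by
  obtain ⟨f, hf⟩ := hL.exists_primitive hD.isPreconnected h.2
  obtain ⟨β, γ, hβ⟩ := hL.exists_rel hD ((K0 D).mkQ f)
  rw [← hβ] at hf
  obtain ⟨h1, h2⟩ := hL.rel_ext hD.nonempty (α := 0) (fun l s t => pairMatrix_comm (fun p => (c l p : ℂ)) s t)
    (fun l s v => by
      rw [quad_eq_quadPoly, eval_pderiv_quadPoly, Pi.zero_apply, Pi.zero_apply, zero_add]) hf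
  have h0 : β = 0 := Subtype.ext h1.symm
  rw [h0, map_zero, zero_add] at hf
  exact ⟨γ, funext fun l => pairMatrix_injective (congrFun h2 l), hf⟩

/-- An exhaustive check over the `3 ^ 5` combinations with coordinates in `{-1, 0, 1}` and the ten
possible supports. -/
theorem coef_unique : ∀ a b c d e : Fin 3, ∀ τ : Fin 10,
    (∀ i : Fin 5, i ∉ (triple τ).1 → ∀ s : Fin 3, ∑ j : Fin 5,
      (![-1, 0, 1] (![a, b, c, d, e] j) : ℤ) * coefTable (![0, 1, 2, 3, 7] j) i s = 0) →
    (∀ i s, ∑ j : Fin 5, (![-1, 0, 1] (![a, b, c, d, e] j) : ℤ) *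
        coefTable (![0, 1, 2, 3, 7] j) i s = 0) ∨
      (∀ i s, ∑ j : Fin 5, (![-1, 0, 1] (![a, b, c, d, e] j) : ℤ) *
        coefTable (![0, 1, 2, 3, 7] j) i s = coefTable τ i s) ∨
      (∀ i s, ∑ j : Fin 5, (![-1, 0, 1] (![a, b, c, d, e] j) : ℤ) *
        coefTable (![0, 1, 2, 3, 7] j) i s = -coefTable τ i s) := by
  decide +kernel

theorem isCoeff_coef : ∀ τ, IsCoeff (triple τ) (coef τ) := by
  unfold IsCoeff
  decide +kernel

/-- The arithmetic is that of `Fin 3`: the pairs 01, 02, 12 get the numbers 0, 1, 2, the last one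
because `1 + 2 - 1` wraps around to 2. -/
theorem pair_surjective : ∀ s : Fin 3, ∃ p : Pair, p.1.1 + p.1.2 - 1 = s := by decide +kernel

/-- As the pivot entries are ±1, each coordinate in the basis of five systems is, up to sign, an
entry of `c`, hence -1, 0 or 1. This reduces the uniqueness to the finite check `coef_unique`. -/
theorem IsCoeff.eq_or_eq_neg {τ : Fin 10} {c : Fin 10 → Pair → ℤ} (hc : IsCoeff (triple τ) c)
    {γ : Fin 5 → ℂ} (h : (fun l p => (c l p : ℂ)) = coefComb γ) : c = coef τ ∨ c = -coef τ := by
  have h1 (j : Fin 5) : ∃ a : Fin 3, γ j = ((![-1, 0, 1] a : ℤ) : ℂ) := by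
    have h2 := coefComb_coefPivot γ j
    rw [← h] at h2
    have h3 : ((![-1, 1, -1, 1, 1] j : ℤ) : ℂ) * ((![-1, 1, -1, 1, 1] j : ℤ) : ℂ) = 1 := by
      fin_cases j <;> simp
    have h4 : γ j = ((c (coefPivot j).1 (coefPivot j).2 * ![-1, 1, -1, 1, 1] j : ℤ) : ℂ) := by
      push_cast
      rw [show (c (coefPivot j).1 (coefPivot j).2 : ℂ) = _ from h2, mul_assoc, h3, mul_one]
    have h5 : ∀ u v : ℤ, (u = -1 ∨ u = 0 ∨ u = 1) → (v = -1 ∨ v = 1) →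
        ∃ a : Fin 3, u * v = ![-1, 0, 1] a := by
      rintro u v (rfl | rfl | rfl) (rfl | rfl) <;> decide
    obtain ⟨a, ha⟩ := h5 _ (![-1, 1, -1, 1, 1] j) (hc.2.1 (coefPivot j).1 (coefPivot j).2)
      (by fin_cases j <;> simp)
    exact ⟨a, by rw [h4, ha]⟩
  choose a ha using h1
  have h2 (l : Fin 10) (p : Pair) : c l p = ∑ j, ![-1, 0, 1] (![a 0, a 1, a 2, a 3, a 4] j) *
      coefTable (![0, 1, 2, 3, 7] j) (base l) (p.1.1 + p.1.2 - 1) := by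
    have := congrFun (congrFun h l) p
    simp only [coefComb, LinearMap.coe_mk, AddHom.coe_mk, ha] at this
    rw [show (![a 0, a 1, a 2, a 3, a 4] : Fin 5 → Fin 3) = a by
      funext j; fin_cases j <;> rfl]
    exact_mod_cast this
  have hl (i : Fin 5) : ∃ l, base l = i := ⟨⟨i, by omega⟩, Fin.ext (Nat.mod_eq_of_lt i.2)⟩
  rcases coef_unique (a 0) (a 1) (a 2) (a 3) (a 4) τ (fun i hi s => by
    obtain ⟨l, rfl⟩ := hl i
    obtain ⟨p, rfl⟩ := pair_surjective s
    rw [← h2, hc.2.2 l hi, Pi.zero_apply]) with h3 | h3 | h3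
  · exact absurd (funext fun l => funext fun p => (h2 l p).trans (h3 _ _)) hc.1
  · exact Or.inl (funext fun l => funext fun p => (h2 l p).trans (h3 _ _))
  · exact Or.inr (funext fun l => funext fun p => (h2 l p).trans (h3 _ _))

theorem IsLogDet.isLogClass_quad (hL : IsLogDet (D : Set C5) L) (τ : Fin 10) :
    IsLogClass D L (quad (coef τ)) (logClass D L ⟨quad (coef τ), hL.quad_mem τ⟩) :=
  ⟨hL.quad_mem τ, rfl⟩

theorem IsLogDet.rel2_eq_sum (hL : IsLogDet (D : Set C5) L) (γ : Fin 5 → ℂ) :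
    hL.rel2 γ = ∑ i, γ i • logClass D L ⟨_, hL.quad_mem (![0, 1, 2, 3, 7] i)⟩ := by
  rw [← Finset.sum_congr rfl fun i _ => map_smul (logClass D L) (γ i) _, ← map_sum]
  refine congrArg (logClass D L) (Subtype.ext ?_)
  rw [AddSubmonoidClass.coe_finsetSum]
  exact quadPoly_coefComb γ

theorem IsLogDet.isAR1ijk_coef (hL : IsLogDet (D : Set C5) L) (τ : Fin 10) :
    IsAR1ijk D L (triple τ) (coef τ) := by
  refine ⟨isCoeff_coef τ, hL.logForm_mem ?_⟩
  rw [show logForm D L (dquad (coef τ)) = _ from (hL.d0_of_isLogClass (hL.isLogClass_quad τ)).symm]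
  exact sum_d0 _

theorem isIdentity_coef (D : TopologicalSpace.Opens C5) (L : Fin 10 → C5 → ℂ) (τ : Fin 10) :
    IsIdentity D L (triple τ) (coef τ) :=
  ⟨isCoeff_coef τ, fun y _ => sum_quad_eq_zero L (sum_coef_expo τ) y⟩

/-- Differentiation carries identities to 1-abelian relations, so the uniqueness of the former
follows from that of the latter. -/
theorem IsLogDet.isAR1ijk_of_isIdentity (hL : IsLogDet (D : Set C5) L) {t : Triple}
    {c : Fin 10 → Pair → ℤ} (h : IsIdentity D L t c) : IsAR1ijk D L t c := by
  have hm : logFun L (quad c) ∈ Z0 D := hL.logFun_mem fun y hy => by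
    simpa only [logFun_quad] using h.2 y hy
  refine ⟨h.1, hL.logForm_mem ?_⟩
  rw [show logForm D L (dquad c) = _ from (hL.d0_logFun hm).symm]
  exact sum_d0 _

theorem IsLogDet.isAR1ijk_unique (hD : IsConnected (D : Set C5)) (hL : IsLogDet (D : Set C5) L)
    {τ : Fin 10} {c : Fin 10 → Pair → ℤ} (h : IsAR1ijk D L (triple τ) c) :
    c = coef τ ∨ c = -coef τ := by
  obtain ⟨γ, hγ, -⟩ := hL.exists_coefComb hD h.2
  exact h.1.eq_or_eq_neg hγ

theorem IsLogDet.map_WAR0_two (hD : IsConnected (D : Set C5)) (hL : IsLogDet (D : Set C5) L) :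
    (WAR0 D L 2).map (d0 D) = AR1Sym D L := by
  refine le_antisymm (Submodule.map_le_iff_le_comap.2 ?_) (Submodule.span_le.2 ?_)
  · rw [hL.WAR0_two hD]
    rintro _ ⟨γ, rfl⟩
    rw [Submodule.mem_comap, hL.rel2_eq_sum, map_sum]
    refine Submodule.sum_mem _ fun i _ => ?_
    rw [map_smul, hL.d0_of_isLogClass (hL.isLogClass_quad _)]
    exact Submodule.smul_mem _ _ (Submodule.subset_span ⟨_, _, hL.isAR1ijk_coef _, rfl⟩)
  · rintro _ ⟨t, c, h, rfl⟩
    obtain ⟨γ, -, h2⟩ := hL.exists_coefComb hD h.2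
    rw [← h2]
    exact Submodule.mem_map_of_mem (by rw [hL.WAR0_two hD]; exact ⟨γ, rfl⟩)

theorem IsLogDet.span_quad (hD : IsConnected (D : Set C5)) (hL : IsLogDet (D : Set C5) L) :
    Submodule.span ℂ {x | ∃ τ, IsLogClass D L (quad (coef τ)) x} = WAR0 D L 2 := by
  refine le_antisymm (Submodule.span_le.2 ?_) ?_
  · rintro x ⟨τ, hx⟩
    exact Submodule.subset_span ⟨quad (coef τ), fun l => by
      rw [quad_eq_quadPoly]; exact isHomogeneous_quadPoly _ l, hx⟩
  · rw [hL.WAR0_two hD]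
    rintro _ ⟨γ, rfl⟩
    rw [hL.rel2_eq_sum]
    refine Submodule.sum_mem _ fun i _ => Submodule.smul_mem _ _ (Submodule.subset_span ?_)
    exact ⟨![0, 1, 2, 3, 7] i, hL.isLogClass_quad (![0, 1, 2, 3, 7] i)⟩

end

end GMWeb

namespace GMWeb

open scoped Topology
open Filter MvPolynomial

noncomputable section

/-! ### Pull-backs by the Cremona involutions -/

/-- The signs in the action of `σ_k` on the `ζ_j`. -/
def zetaSign : Fin 5 → Fin 10 → ℤ :=
  ![![1, -1, -1, 1, -1, 1, 1, 1, -1, 1],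
    ![1, -1, 1, -1, -1, 1, 1, 1, 1, -1],
    ![-1, -1, 1, -1, 1, -1, 1, 1, 1, 1],
    ![-1, 1, -1, -1, 1, 1, -1, 1, 1, 1],
    ![-1, 1, -1, -1, 1, 1, -1, 1, 1, 1]]

/-- The exponents in the action of `σ_k` on the `ζ_j`, see `zeta_sigma`. -/
def zetaExp : Fin 5 → Fin 10 → Fin 10 → ℤ :=
  ![![![0, 0, 0, -1, 0, 0, 0, 0, 0, 0], ![1, 0, 1, 0, 0, 0, 0, 0, 0, 0],
      ![0, 1, 0, 1, 0, 0, 0, 0, 0, 0], ![-1, 0, 0, 0, 0, 0, 0, 0, 0, 0],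
      ![-1, 0, 0, -1, 1, 0, 0, 0, 0, 0], ![-1, 0, 0, 0, 0, 0, 1, 0, 0, 0],
      ![0, 0, 0, -1, 0, 1, 0, 0, 0, 0], ![0, 0, 0, 0, 0, 0, 0, 1, 0, 0],
      ![-1, 0, 0, -1, 0, 0, 0, 0, 1, 0], ![0, 0, 0, 0, 0, 0, 0, 0, 0, 1]],
    ![![0, 0, -1, 0, 0, 0, 0, 0, 0, 0], ![-1, 1, -1, 0, 0, 0, 0, 0, 0, 0],
      ![-1, 0, 0, 0, 0, 0, 0, 0, 0, 0], ![0, 0, 1, 0, 1, 0, 0, 0, 0, 0],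
      ![1, 0, 0, 1, 0, 0, 0, 0, 0, 0], ![0, 0, 0, 0, 0, 1, 0, 0, 0, 0],
      ![0, 0, -1, 0, 0, 0, 0, 1, 0, 0], ![-1, 0, 0, 0, 0, 0, 1, 0, 0, 0],
      ![0, 0, 0, 0, 0, 0, 0, 0, 1, 0], ![-1, 0, -1, 0, 0, 0, 0, 0, 0, 1]],
    ![![0, 1, 0, 0, 1, 0, 0, 0, 0, 0], ![1, 0, 1, 0, 0, 0, 0, 0, 0, 0],
      ![0, 0, 0, 0, -1, 0, 0, 0, 0, 0], ![0, 0, -1, 1, -1, 0, 0, 0, 0, 0],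
      ![0, 0, -1, 0, 0, 0, 0, 0, 0, 0], ![0, 0, -1, 0, -1, 1, 0, 0, 0, 0],
      ![0, 0, 0, 0, 0, 0, 1, 0, 0, 0], ![0, 0, 0, 0, -1, 0, 0, 0, 1, 0],
      ![0, 0, -1, 0, 0, 0, 0, 1, 0, 0], ![0, 0, 0, 0, 0, 0, 0, 0, 0, 1]],
    ![![1, -1, 0, 0, -1, 0, 0, 0, 0, 0], ![0, 0, 0, 0, -1, 0, 0, 0, 0, 0],
      ![0, 1, 0, 1, 0, 0, 0, 0, 0, 0], ![0, 0, 1, 0, 1, 0, 0, 0, 0, 0],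
      ![0, -1, 0, 0, 0, 0, 0, 0, 0, 0], ![0, 0, 0, 0, 0, 1, 0, 0, 0, 0],
      ![0, -1, 0, 0, -1, 0, 1, 0, 0, 0], ![0, 0, 0, 0, 0, 0, 0, 1, 0, 0],
      ![0, -1, 0, 0, 0, 0, 0, 0, 0, 1], ![0, 0, 0, 0, -1, 0, 0, 0, 1, 0]],
    ![![0, 0, 0, 0, 0, 0, 1, 0, 0, 0], ![0, 1, 0, 0, 0, 1, 0, -1, 0, 0],
      ![0, 0, 1, 0, 0, 0, 0, -1, 0, 0], ![0, 0, 0, 1, 0, -1, 0, 0, 0, 0],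
      ![0, 0, 0, 0, 1, -1, 0, 1, 0, 0], ![0, 0, 0, 0, 0, -1, 0, 0, 0, 0],
      ![1, 0, 0, 0, 0, 0, 0, 0, 0, 0], ![0, 0, 0, 0, 0, 0, 0, -1, 0, 0],
      ![0, 0, 0, 0, 0, -1, 0, 0, 1, 0], ![0, 0, 0, 0, 0, 0, 0, -1, 0, 1]]]

/-- The type of the action of `σ_k` on the logarithms of the `U_{l,s}`. -/
def pullType : Fin 5 → Fin 10 → Fin 4 :=
  ![![0, 0, 1, 1, 1, 0, 0, 1, 1, 1],
    ![1, 0, 0, 2, 2, 1, 0, 0, 2, 2],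
    ![2, 2, 0, 0, 1, 2, 2, 0, 0, 3],
    ![1, 1, 1, 0, 0, 3, 3, 3, 0, 0],
    ![3, 3, 3, 0, 0, 1, 1, 1, 0, 0]]

/-- The four linear substitutions of the logarithms of the `U_{l,s}` induced by the `σ_k`. -/
def typeMatrix : Fin 4 → Fin 3 → Fin 3 → ℤ :=
  ![![![1, 0, 0], ![0, 1, 0], ![0, 0, 1]],
    ![![0, 1, 0], ![1, 0, 0], ![0, 0, 1]],
    ![![1, -1, 0], ![0, -1, 0], ![0, -1, 1]],
    ![![1, 0, -1], ![0, 1, -1], ![0, 0, -1]]]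

/-- The matrix of the pull-back by `σ_k` of the logarithms of the `U_{l,s}`. -/
def pullMatrix (k : Fin 5) (l : Fin 10) : Fin 3 → Fin 3 → ℤ := typeMatrix (pullType k l)

/-- An equality of exponent vectors in the `ζ_m`: up to sign, `U_{l,s} ∘ σ_k` is a monomial in the
three first integrals of the foliation `foliationPerm k l`. -/
theorem pullMatrix_expo : ∀ k l s m, ∑ t, pullMatrix k l s t * expo (foliationPerm k l) t m =
    ∑ j, expo l s j * zetaExp k j m := by
  decide +kernel

theorem foliationPerm_foliationPerm : ∀ k l, foliationPerm k (foliationPerm k l) = l := by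
  decide +kernel

/-- The fifty verifications behind the whole group action: each involution permutes the ten
hypersurfaces up to monomial factors and signs. The names `p` and `q` keep `P₁` and `P₃` as
indivisible denominators until the final polynomial identity. -/
theorem zeta_sigma {y : C5} (hy : y ∈ Ystar) (k : Fin 5) (j : Fin 10) :
    zeta j (sigma k y) = (zetaSign k j : ℂ) * ∏ m, zeta m y ^ zetaExp k j m := by
  have h (k : Fin 10) : eval y (zetaPoly k) ≠ 0 := hy k
  have h0 := h 0
  have h1 := h 1
  have h2 := h 2
  have h3 := h 3
  have h4 := h 4
  have h5 := h 5
  have h7 := h 7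
  simp only [zetaPoly, Matrix.cons_val, eval_X, map_add, map_sub, map_mul, map_one] at h0 h1 h2 h3 h4 h5 h7
  obtain ⟨p, hp⟩ : ∃ p, p = 1 + y 3 - y 2 * y 4 := ⟨_, rfl⟩
  obtain ⟨q, hq⟩ : ∃ q, q = 1 + y 2 - y 1 * y 3 := ⟨_, rfl⟩
  rw [← hp] at h5
  rw [← hq] at h7
  fin_cases k <;> fin_cases j <;>
    simp [sigma, zetaSign, zetaExp, zeta, zetaPoly, prod_fin_ten, ← hp, ← hq] <;>
    field_simp <;> (try rw [hp]) <;> (try rw [hq]) <;> ring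

end

end GMWeb

namespace GMWeb

open scoped Topology
open Filter MvPolynomial

noncomputable section

/-! ### Substitutions of logarithms induced by the involutions -/

theorem zetaSign_ne_zero (k : Fin 5) (j : Fin 10) : (zetaSign k j : ℂ) ≠ 0 := by
  have : ∀ k j, zetaSign k j ≠ 0 := by decide +kernel
  exact_mod_cast this k j

theorem norm_zetaSign (k : Fin 5) (j : Fin 10) : ‖(zetaSign k j : ℂ)‖ = 1 := by
  have : ∀ k j, zetaSign k j = 1 ∨ zetaSign k j = -1 := by decide +kernel
  rcases this k j with h | h <;> simp [h]

theorem sigma_mem {y : C5} (hy : y ∈ Ystar) (k : Fin 5) : sigma k y ∈ Ystar := fun j => by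
  rw [zeta_sigma hy]
  exact mul_ne_zero (zetaSign_ne_zero k j) (Finset.prod_ne_zero_iff.2 fun m _ => zpow_ne_zero _ (hy m))

theorem log_norm_prod_zpow {ι : Type*} (I : Finset ι) {g : ι → ℂ} (h0 : ∀ k, g k ≠ 0) (n : ι → ℤ) :
    Real.log ‖∏ k ∈ I, g k ^ n k‖ = ∑ k ∈ I, n k * Real.log ‖g k‖ := by
  rw [norm_prod, Real.log_prod fun k _ => norm_ne_zero_iff.2 (zpow_ne_zero _ (h0 k))]
  simp only [norm_zpow, Real.log_zpow]

theorem absLogU_eq {y : C5} (hy : y ∈ Ystar) (l : Fin 10) (s : Fin 3) :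
    absLogU l s y = ∑ j, (expo l s j : ℂ) * (Real.log ‖zeta j y‖ : ℂ) := by
  rw [absLogU, U_eq_prod hy, log_norm_prod_zpow _ hy]
  push_cast
  rfl

theorem sum_pullMatrix_expo (k : Fin 5) (l : Fin 10) (s : Fin 3) (m : Fin 10) :
    ∑ t, (pullMatrix k l s t : ℂ) * (expo (foliationPerm k l) t m : ℂ) =
      ∑ j, (expo l s j : ℂ) * (zetaExp k j m : ℂ) := by
  exact_mod_cast pullMatrix_expo k l s m

/-- The absolute value erases the signs in `zeta_sigma`, so the pull-back is exactly linear on the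
functions `log |U_{l,s}|`, without additive constants. -/
theorem absLogU_sigma {y : C5} (hy : y ∈ Ystar) (k : Fin 5) (l : Fin 10) (s : Fin 3) :
    absLogU l s (sigma k y) = ∑ t, (pullMatrix k l s t : ℂ) * absLogU (foliationPerm k l) t y := by
  have h (j : Fin 10) : Real.log ‖zeta j (sigma k y)‖ =
      ∑ m, zetaExp k j m * Real.log ‖zeta m y‖ := by
    rw [zeta_sigma hy, norm_mul, norm_zetaSign, one_mul, log_norm_prod_zpow _ hy]
  rw [absLogU_eq (sigma_mem hy k)]
  simp only [h, absLogU_eq hy]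
  push_cast
  simp only [Finset.mul_sum, ← mul_assoc]
  rw [Finset.sum_comm, Finset.sum_comm (s := (Finset.univ : Finset (Fin 3)))]
  simp only [← Finset.sum_mul, sum_pullMatrix_expo]

theorem hasFDerivAt_zeta_sigma {y : C5} (hy : y ∈ Ystar) (k : Fin 5) (j : Fin 10) :
    HasFDerivAt (fun y => zeta j (sigma k y))
      (zeta j (sigma k y) • ∑ m, (zetaExp k j m : ℂ) • (zeta m y)⁻¹ • fderiv ℂ (zeta m) y) y := by
  have h := ((hasFDerivAt_prod_zpow Finset.univ (fun k => (analyticAt_zeta k y).differentiableAt)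
    hy (zetaExp k j)).const_mul (zetaSign k j : ℂ)).congr_of_eventuallyEq
    (Filter.eventuallyEq_of_mem (isOpen_Ystar.mem_nhds hy) fun z hz => zeta_sigma hz k j)
  rwa [smul_smul, ← zeta_sigma hy] at h

theorem differentiableAt_sigma {y : C5} (hy : y ∈ Ystar) (k : Fin 5) :
    DifferentiableAt ℂ (sigma k) y := by
  -- The coordinates of `sigma k y` are its first five `ζ_j`, which have just been differentiated.
  rw [differentiableAt_pi]
  intro i
  have h := (hasFDerivAt_zeta_sigma hy k (i.castLE (by norm_num))).differentiableAt
  have e : (fun y => zeta (i.castLE (by norm_num)) (sigma k y)) = fun y => sigma k y i := by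
    funext y
    fin_cases i <;> simp [zeta, zetaPoly]
  rwa [e] at h

theorem dlogU_sigma {y : C5} (hy : y ∈ Ystar) (k : Fin 5) (l : Fin 10) (s : Fin 3) :
    (dlogU l s (sigma k y)).comp (fderiv ℂ (sigma k) y) =
      ∑ t, (pullMatrix k l s t : ℂ) • dlogU (foliationPerm k l) t y := by
  have h (j : Fin 10) : (fderiv ℂ (zeta j) (sigma k y)).comp (fderiv ℂ (sigma k) y) =
      zeta j (sigma k y) • ∑ m, (zetaExp k j m : ℂ) • (zeta m y)⁻¹ • fderiv ℂ (zeta m) y :=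
    ((analyticAt_zeta j _).differentiableAt.hasFDerivAt.comp y
      (differentiableAt_sigma hy k).hasFDerivAt).unique (hasFDerivAt_zeta_sigma hy k j)
  ext v
  have h' (j : Fin 10) : fderiv ℂ (zeta j) (sigma k y) (fderiv ℂ (sigma k) y v) =
      zeta j (sigma k y) * ∑ m, (zetaExp k j m : ℂ) * ((zeta m y)⁻¹ * fderiv ℂ (zeta m) y v) := by
    have := congrArg (· v) (h j)
    simpa only [ContinuousLinearMap.comp_apply, smul_apply, sum_apply, smul_eq_mul] using this
  rw [dlogU_eq (sigma_mem hy k)]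
  simp only [ContinuousLinearMap.comp_apply, sum_apply, smul_apply, smul_eq_mul, dlogU_eq hy, h']
  have h2 (j : Fin 10) (a : ℂ) : (zeta j (sigma k y))⁻¹ * (zeta j (sigma k y) * a) = a :=
    inv_mul_cancel_left₀ (sigma_mem hy k j) a
  simp only [h2, Finset.mul_sum]
  rw [Finset.sum_comm, Finset.sum_comm (s := (Finset.univ : Finset (Fin 3)))]
  refine Finset.sum_congr rfl fun m _ => ?_
  simp only [← mul_assoc, ← Finset.sum_mul, sum_pullMatrix_expo]

/-- The substitution of the logarithms of `U_{l,s}` by `σ_k`. -/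
def pullSubst (k : Fin 5) (l : Fin 10) (s : Fin 3) : MvPolynomial (Fin 3) ℂ :=
  ∑ t, C (pullMatrix k l s t : ℂ) * X t

/-- The pull-back by `σ_k` of a tuple of polynomials in the logarithms. -/
def pull (k : Fin 5) (Q : Fin 10 → MvPolynomial (Fin 3) ℂ) (l : Fin 10) : MvPolynomial (Fin 3) ℂ :=
  aeval (pullSubst k (foliationPerm k l)) (Q (foliationPerm k l))

theorem pull_foliationPerm (k : Fin 5) (Q : Fin 10 → MvPolynomial (Fin 3) ℂ) (l : Fin 10) :
    pull k Q (foliationPerm k l) = aeval (pullSubst k l) (Q l) := by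
  rw [pull, foliationPerm_foliationPerm]

theorem eval_aeval {ι κ : Type*} (f : ι → MvPolynomial κ ℂ) (v : κ → ℂ) (Q : MvPolynomial ι ℂ) :
    eval v (aeval f Q) = eval (fun s => eval v (f s)) Q := by
  induction Q using MvPolynomial.induction_on with
  | C a => simp
  | add p q hp hq => simp only [map_add, hp, hq]
  | mul_X p i hp => simp only [map_mul, aeval_X, eval_X, hp]

theorem pderiv_aeval {ι κ : Type*} [Fintype ι] (f : ι → MvPolynomial κ ℂ) (t : κ)
    (Q : MvPolynomial ι ℂ) :
    pderiv t (aeval f Q) = ∑ s, aeval f (pderiv s Q) * pderiv t (f s) := by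
  classical
  induction Q using MvPolynomial.induction_on with
  | C a => simp
  | add p q hp hq => simp only [map_add, hp, hq, add_mul, Finset.sum_add_distrib]
  | mul_X p i hp =>
    simp only [map_mul, aeval_X, Derivation.leibniz, smul_eq_mul, hp, map_add, add_mul,
      Finset.sum_add_distrib, Finset.mul_sum, mul_assoc]
    congr 1
    rw [Finset.sum_eq_single i]
    · simp
    · intro j _ hj; simp [pderiv_X_of_ne hj.symm]
    · simp

theorem eval_pullSubst {y : C5} (hy : y ∈ Ystar) (k : Fin 5) (l : Fin 10) :
    (fun s => eval (fun t => absLogU (foliationPerm k l) t y) (pullSubst k l s)) =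
      fun s => absLogU l s (sigma k y) := by
  funext s
  simp [pullSubst, absLogU_sigma hy]

theorem absLogFun_pull {y : C5} (hy : y ∈ Ystar) (k : Fin 5)
    (Q : Fin 10 → MvPolynomial (Fin 3) ℂ) (l : Fin 10) :
    absLogFun (pull k Q) (foliationPerm k l) y = absLogFun Q l (sigma k y) := by
  rw [absLogFun, pull_foliationPerm, eval_aeval, eval_pullSubst hy, absLogFun]

theorem pderiv_pullSubst (k : Fin 5) (l : Fin 10) (s t : Fin 3) :
    pderiv t (pullSubst k l s) = C (pullMatrix k l s t : ℂ) := by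
  rw [pullSubst, map_sum, Finset.sum_eq_single t]
  · simp
  · intro j _ hj; rw [pderiv_C_mul, pderiv_X_of_ne hj, mul_zero]
  · simp

theorem absLogForm_pull {y : C5} (hy : y ∈ Ystar) (k : Fin 5)
    (Q : Fin 10 → MvPolynomial (Fin 3) ℂ) (l : Fin 10) :
    absLogForm (fun l s => pderiv s (pull k Q l)) (foliationPerm k l) y =
      (absLogForm (fun l s => pderiv s (Q l)) l (sigma k y)).comp (fderiv ℂ (sigma k) y) := by
  simp only [absLogForm, pull_foliationPerm, pderiv_aeval, map_sum, map_mul, eval_aeval,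
    eval_pullSubst hy, pderiv_pullSubst, eval_C]
  ext v
  have h (s : Fin 3) := congrArg (· v) (dlogU_sigma hy k l s)
  simp only [ContinuousLinearMap.comp_apply, sum_apply, smul_apply, smul_eq_mul] at h
  simp only [ContinuousLinearMap.comp_apply, sum_apply, smul_apply, smul_eq_mul, h, Finset.mul_sum,
    Finset.sum_mul]
  rw [Finset.sum_comm]
  simp only [mul_assoc]

theorem isHomogeneous_pull {w : ℕ} {Q : Fin 10 → MvPolynomial (Fin 3) ℂ}
    (hQ : ∀ l, (Q l).IsHomogeneous w) (k : Fin 5) (l : Fin 10) : (pull k Q l).IsHomogeneous w := by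
  have h := (hQ (foliationPerm k l)).aeval (pullSubst k (foliationPerm k l)) (n := 1) fun s =>
    IsHomogeneous.sum _ _ _ fun t _ => (isHomogeneous_X ℂ t).C_mul _
  rwa [one_mul] at h

variable {D : TopologicalSpace.Opens C5} {L : Fin 10 → C5 → ℂ}

theorem isPullback0_pull {w : ℕ} {Q : Fin 10 → MvPolynomial (Fin 3) ℂ}
    (hQ : ∀ l, (Q l).IsHomogeneous w) (k : Fin 5) {x x' : AR0 D} (hx : IsLogClass D L Q x)
    (hx' : IsLogClass D L (pull k Q) x') : IsPullback0 D L w k x x' :=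
  ⟨Q, pull k Q, fun l => ⟨hQ l, isHomogeneous_pull hQ k l⟩, hx, hx',
    fun l _ hy => absLogFun_pull hy k Q l⟩

theorem isPullback1_pull (hL : IsLogDet (D : Set C5) L) {w : ℕ}
    {Q : Fin 10 → MvPolynomial (Fin 3) ℂ} (hQ : ∀ l, (Q l).IsHomogeneous (w + 1)) (k : Fin 5)
    {x x' : AR0 D} (hx : IsLogClass D L Q x) (hx' : IsLogClass D L (pull k Q) x') :
    IsPullback1 D L w k (d0 D x) (d0 D x') :=
  ⟨_, _, fun l _ => ⟨(hQ l).pderiv, (isHomogeneous_pull hQ k l).pderiv⟩, hL.d0_of_isLogClass hx,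
    hL.d0_of_isLogClass hx', fun l _ hy => absLogForm_pull hy k Q l⟩

end

end GMWeb

namespace GMWeb

open scoped Topology
open Filter MvPolynomial

noncomputable section

variable {D : TopologicalSpace.Opens C5} {L : Fin 10 → C5 → ℂ}

/-! ### Pull-back of the coefficients of weight one -/

/-- The coefficients of the pull-back by `σ_k` of a tuple of linear forms. -/
def pullLin (k : Fin 5) (α : Fin 10 → Fin 3 → ℂ) (l : Fin 10) (t : Fin 3) : ℂ :=
  ∑ s, α (foliationPerm k l) s * (pullMatrix k (foliationPerm k l) s t : ℂ)

theorem pull_linPoly (k : Fin 5) (α : Fin 10 → Fin 3 → ℂ) :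
    pull k (linPoly α) = linPoly (pullLin k α) := by
  funext l
  simp only [pull, linPoly, pullLin, pullSubst, LinearMap.coe_mk, AddHom.coe_mk, map_sum, map_mul,
    aeval_X, algHom_C, algebraMap_eq, Finset.mul_sum, Finset.sum_mul]
  rw [Finset.sum_comm]
  simp only [mul_assoc]

/-- Pulling back multiplies the vector of total exponents in the `ζ_j` by the matrix `zetaExp k`; a
zero vector stays zero. -/
theorem pullLin_mem (k : Fin 5) {α : Fin 10 → Fin 3 → ℂ} (hα : α ∈ linRel) :
    pullLin k α ∈ linRel := by
  intro m
  rw [← Equiv.sum_comp (foliationPerm k)]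
  simp only [pullLin, foliationPerm_foliationPerm, Finset.sum_mul]
  have h (l : Fin 10) : ∑ t, ∑ s, α l s * (pullMatrix k l s t : ℂ) *
      (expo (foliationPerm k l) t m : ℂ) =
      ∑ s, ∑ j, α l s * (expo l s j : ℂ) * (zetaExp k j m : ℂ) := by
    rw [Finset.sum_comm]
    refine Finset.sum_congr rfl fun s _ => ?_
    simp only [mul_assoc, ← Finset.mul_sum, sum_pullMatrix_expo]
  simp only [h]
  have h2 : ∑ l, ∑ s, ∑ j, α l s * (expo l s j : ℂ) * (zetaExp k j m : ℂ) =
      ∑ j, (∑ l, ∑ s, α l s * (expo l s j : ℂ)) * (zetaExp k j m : ℂ) := by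
    simp only [Finset.sum_mul]
    rw [Finset.sum_comm' (t' := Finset.univ) (s' := fun _ => Finset.univ) (by simp)]
    rw [Finset.sum_comm]
    simp only [Finset.sum_comm (s := (Finset.univ : Finset (Fin 3)))]
    rw [Finset.sum_comm]
  rw [h2]
  exact Finset.sum_eq_zero fun j _ => by rw [hα j, zero_mul]

/-! ### Pull-back of the coefficients of weight two -/

/-- The action of the `s_k` on the ten triples. -/
def triplePerm : Fin 5 → Fin 10 → Fin 10 :=
  ![![0, 1, 2, 6, 7, 8, 3, 4, 5, 9], ![0, 3, 4, 1, 2, 5, 6, 7, 9, 8],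
    ![1, 0, 2, 3, 5, 4, 6, 8, 7, 9], ![0, 2, 1, 4, 3, 5, 7, 6, 8, 9],
    ![0, 2, 1, 4, 3, 5, 7, 6, 8, 9]]

/-- The signs in the action of the `s_k` on the ten identities of weight two. -/
def tripleSign : Fin 5 → Fin 10 → ℤ :=
  ![![-1, -1, -1, 1, 1, 1, 1, 1, 1, -1], ![-1, 1, 1, 1, 1, -1, -1, -1, 1, 1],
    ![-1, -1, -1, -1, -1, -1, -1, -1, -1, -1], ![-1, 1, 1, 1, 1, -1, 1, 1, -1, -1],
    ![-1, 1, 1, 1, 1, -1, 1, 1, -1, -1]]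

/-- The permutations of the coefficients of a quadratic form induced by the four substitutions. -/
def rowPerm : Fin 4 → Fin 3 → Fin 3 := ![![0, 1, 2], ![0, 2, 1], ![2, 1, 0], ![0, 2, 1]]

theorem sum_coefTable : ∀ τ i, coefTable τ i 0 + coefTable τ i 1 + coefTable τ i 2 = 0 := by
  decide +kernel

theorem coefTable_rowPerm : ∀ k τ l s, coefTable τ (base (foliationPerm k l))
    (rowPerm (pullType k (foliationPerm k l)) s) =
      tripleSign k τ * coefTable (triplePerm k τ) (base l) s := by
  decide +kernel

/-- The quadratic form with a given row of coefficients. -/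
def rowPoly (r : Fin 3 → ℤ) : MvPolynomial (Fin 3) ℂ :=
  C (r 0 : ℂ) * (X 0 * X 1) + C (r 1 : ℂ) * (X 0 * X 2) + C (r 2 : ℂ) * (X 1 * X 2)

theorem quad_coef (τ l : Fin 10) : quad (coef τ) l = rowPoly (coefTable τ (base l)) := by
  rw [quad, sum_pair, rowPoly]
  rfl

/-- The last two substitutions create squares, whose coefficient is the sum of the row. When this
sum is zero the squares disappear, and the other three coefficients are merely permuted. -/
theorem aeval_rowPoly (a : Fin 4) {r : Fin 3 → ℤ} (hr : r 0 + r 1 + r 2 = 0) :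
    aeval (fun s => ∑ t, C (typeMatrix a s t : ℂ) * X t) (rowPoly r) =
      rowPoly fun s => r (rowPerm a s) := by
  have h : r 2 = -r 0 - r 1 := by omega
  fin_cases a <;>
    simp [rowPoly, rowPerm, typeMatrix, Fin.sum_univ_three, h] <;> ring

theorem pull_quad_coef (k : Fin 5) (τ : Fin 10) :
    pull k (quad (coef τ)) = (tripleSign k τ : ℂ) • quad (coef (triplePerm k τ)) := by
  funext l
  rw [pull, quad_coef]
  refine (aeval_rowPoly _ (sum_coefTable τ _)).trans ?_
  simp only [coefTable_rowPerm, Pi.smul_apply, quad_coef, rowPoly, smul_eq_C_mul]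
  push_cast
  simp only [C_mul]
  ring

/-- The coordinates of the ten identities in the basis formed by five of them. -/
def coefCoord : Fin 10 → Fin 5 → ℤ :=
  ![![1, 0, 0, 0, 0], ![0, 1, 0, 0, 0], ![0, 0, 1, 0, 0], ![0, 0, 0, 1, 0], ![-1, 0, 1, 0, 1],
    ![0, -1, 0, 1, -1], ![-1, -1, 0, 1, 0], ![0, 0, 0, 0, 1], ![0, 0, -1, 1, -1],
    ![1, 1, -1, 0, 0]]

theorem coef_eq_sum : ∀ τ l p, coef τ l p = ∑ j, coefCoord τ j * coef (![0, 1, 2, 3, 7] j) l p := by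
  decide +kernel

theorem quad_coef_eq_sum (τ : Fin 10) :
    quad (coef τ) = ∑ j, (coefCoord τ j : ℂ) • quad (coef (![0, 1, 2, 3, 7] j)) := by
  rw [← quadPoly_coefComb, quad_eq_quadPoly]
  congr 1
  funext l p
  rw [coef_eq_sum]
  simp [coefComb]

/-- The coordinates of the pull-back by `σ_k` of a combination of the five basic identities. -/
def pullQuad (k : Fin 5) (γ : Fin 5 → ℂ) (j : Fin 5) : ℂ :=
  ∑ i, γ i * (tripleSign k (![0, 1, 2, 3, 7] i) : ℂ) *
    (coefCoord (triplePerm k (![0, 1, 2, 3, 7] i)) j : ℂ)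

theorem pull_sum_smul {ι : Type*} [Fintype ι] (k : Fin 5) (a : ι → ℂ)
    (Q : ι → Fin 10 → MvPolynomial (Fin 3) ℂ) :
    pull k (∑ i, a i • Q i) = ∑ i, a i • pull k (Q i) := by
  funext l
  simp [pull, Finset.sum_apply]

theorem pull_quadPoly (k : Fin 5) (γ : Fin 5 → ℂ) :
    pull k (quadPoly (coefComb γ)) = quadPoly (coefComb (pullQuad k γ)) := by
  rw [quadPoly_coefComb, quadPoly_coefComb, pull_sum_smul]
  simp only [pull_quad_coef, pullQuad, Finset.sum_smul]
  rw [Finset.sum_comm]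
  refine Finset.sum_congr rfl fun i _ => ?_
  rw [quad_coef_eq_sum (triplePerm k _), Finset.smul_sum, Finset.smul_sum]
  simp only [smul_smul, mul_assoc]

end

end GMWeb

namespace GMWeb

open MvPolynomial

noncomputable section

/-! ### Representations of `W(D₅)` by signed permutations of variables -/

theorem polyRep_simple (k : Fin 5) (f : MvPolynomial (Fin 5) ℂ) :
    polyRep (D5.simple k) f = polyGen k f := by
  change (D5.toCoxeterSystem.lift ⟨polyGen, polyGen_liftable⟩ (D5.simple k)) f = polyGen k f
  have h := D5.toCoxeterSystem.lift_apply_simple polyGen_liftable k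
  rw [CoxeterMatrix.toCoxeterSystem_simple] at h
  rw [h]

theorem polyRep_mem {V : Submodule ℂ (MvPolynomial (Fin 5) ℂ)}
    (hV : ∀ k, ∀ f ∈ V, polyGen k f ∈ V) (g : WD5) : ∀ f ∈ V, polyRep g f ∈ V := by
  refine D5.toCoxeterSystem.simple_induction (p := fun g => ∀ f ∈ V, polyRep g f ∈ V) g
    (fun k f hf => ?_) (fun f hf => ?_) fun g h hg hh f hf => ?_
  · rw [CoxeterMatrix.toCoxeterSystem_simple, polyRep_simple]
    exact hV k f hf
  · rw [map_one]
    exact hf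
  · rw [map_mul]
    exact hg _ (hh f hf)

/-- A space identified with an invariant subspace of `ℂ[x₁, …, x₅]` is a representation. -/
theorem exists_representation {E : Type*} [AddCommGroup E] [Module ℂ E]
    {V : Submodule ℂ (MvPolynomial (Fin 5) ℂ)} (e : E ≃ₗ[ℂ] V) {a : Fin 5 → E → E}
    (he : ∀ k x, polyGen k (e x) = e (a k x)) :
    ∃ ρ : Representation ℂ WD5 E, (∀ k x, ρ (D5.simple k) x = a k x) ∧
      ∀ g x, (e (ρ g x) : MvPolynomial (Fin 5) ℂ) = polyRep g (e x) := by
  have hV : ∀ g, ∀ f ∈ V, polyRep g f ∈ V := polyRep_mem fun k f hf => by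
    have := he k (e.symm ⟨f, hf⟩)
    rw [LinearEquiv.apply_symm_apply] at this
    rw [this]
    exact (e _).2
  -- Transporting the action on polynomials makes the Coxeter relations automatic; they need not be
  -- checked for the maps `a k`.
  let ρ : Representation ℂ WD5 E :=
    { toFun := fun g => e.symm.toLinearMap ∘ₗ (polyRep g).restrict (hV g) ∘ₗ e.toLinearMap
      map_one' := by
        ext x
        change e.symm ((polyRep 1).restrict (hV 1) (e x)) = x
        rw [LinearEquiv.symm_apply_eq]
        refine Subtype.ext ?_
        rw [LinearMap.coe_restrict_apply, map_one, Module.End.one_apply]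
      map_mul' := fun g h => by
        ext x
        change e.symm _ = e.symm ((polyRep g).restrict (hV g) (e (e.symm _)))
        rw [LinearEquiv.apply_symm_apply]
        congr 1
        refine Subtype.ext ?_
        change polyRep (g * h) (e x) = polyRep g (polyRep h (e x))
        rw [map_mul, Module.End.mul_apply] }
  have hρ (g : WD5) (x : E) : (e (ρ g x) : MvPolynomial (Fin 5) ℂ) = polyRep g (e x) := by
    change ((e (e.symm ((polyRep g).restrict (hV g) (e x))) : V) : MvPolynomial (Fin 5) ℂ) = _
    rw [LinearEquiv.apply_symm_apply, LinearMap.coe_restrict_apply]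
  refine ⟨ρ, fun k x => e.injective (Subtype.ext ?_), hρ⟩
  rw [hρ, polyRep_simple, he]

/-- The underlying permutations of variables of the generators of `W(D₅)`. -/
def varPerm (k : Fin 5) : Fin 5 → Fin 5 :=
  ![![1, 0, 2, 3, 4], ![0, 2, 1, 3, 4], ![0, 1, 3, 2, 4], ![0, 1, 2, 4, 3], ![0, 1, 2, 4, 3]] k

/-- The signs of the generators of `W(D₅)`. -/
def varSign (k i : Fin 5) : ℤ := if k = 4 ∧ (i = 3 ∨ i = 4) then -1 else 1

theorem polyGen_X (k i : Fin 5) : polyGen k (X i) = C (varSign k i : ℂ) * X (varPerm k i) := by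
  fin_cases k <;> fin_cases i <;> simp [polyGen, varSign, varPerm]

theorem varPerm_varPerm : ∀ k i, varPerm k (varPerm k i) = i := by decide

/-- Adjacent transpositions generate the symmetric group, and the first four generators act on the
variables by exactly these. -/
theorem rename_mem {V : Submodule ℂ (MvPolynomial (Fin 5) ℂ)}
    (hV : ∀ k, ∀ f ∈ V, polyGen k f ∈ V) (π : Equiv.Perm (Fin 5)) :
    ∀ f ∈ V, rename π f ∈ V := by
  have hπ : π ∈ Submonoid.closure (Set.range fun i : Fin 4 => Equiv.swap i.castSucc i.succ) := by
    rw [Equiv.Perm.mclosure_swap_castSucc_succ]; trivial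
  induction hπ using Submonoid.closure_induction with
  | mem x hx =>
    obtain ⟨k, rfl⟩ := hx
    intro f hf
    have h : rename (Equiv.swap k.castSucc k.succ) = polyGen k.castSucc := by
      refine algHom_ext fun i => ?_
      rw [rename_X]
      fin_cases k <;> fin_cases i <;> simp [polyGen, Equiv.swap_apply_def]
    rw [h]
    exact hV _ f hf
  | one => intro f hf; rw [Equiv.Perm.coe_one, rename_id]; exact hf
  | mul x y _ _ hx hy => intro f hf; rw [Equiv.Perm.coe_mul, ← rename_rename]; exact hx _ (hy f hf)

/-! ### Specht modules -/

/-- The Specht polynomial of a bitableau. -/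
def spechtPoly {lam mu : YoungDiagram} (T : (lam.cells ⊕ mu.cells) ≃ Fin 5) :
    MvPolynomial (Fin 5) ℂ :=
  colProd lam (fun a => T (Sum.inl a)) * colProd mu (fun a => T (Sum.inr a)) *
    ∏ a : mu.cells, X (T (Sum.inr a))

theorem rename_spechtPoly {lam mu : YoungDiagram} (T : (lam.cells ⊕ mu.cells) ≃ Fin 5)
    (π : Equiv.Perm (Fin 5)) : rename π (spechtPoly T) = spechtPoly (T.trans π) := by
  simp only [spechtPoly, colProd, map_mul, map_prod, apply_ite (rename π), map_sub, map_pow,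
    rename_X, map_one, Equiv.trans_apply]

/-- All bitableaux of a given shape differ by a relabelling, so the module is spanned by the orbit
of any one Specht polynomial. -/
theorem spechtModule_eq {lam mu : YoungDiagram} (T : (lam.cells ⊕ mu.cells) ≃ Fin 5) :
    spechtModule lam mu = Submodule.span ℂ (Set.range fun π : Equiv.Perm (Fin 5) =>
      rename π (spechtPoly T)) := by
  rw [spechtModule]
  congr 1
  ext f
  constructor
  · rintro ⟨T', rfl⟩
    refine ⟨T.symm.trans T', ?_⟩
    change rename (T.symm.trans T') (spechtPoly T) = spechtPoly T'
    rw [rename_spechtPoly]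
    congr 1
    ext
    simp
  · rintro ⟨π, rfl⟩
    exact ⟨T.trans π, rename_spechtPoly T π⟩

/-- By cyclicity, an invariant subspace contains the Specht module as soon as it contains one Specht
polynomial. -/
theorem spechtModule_le {lam mu : YoungDiagram} (T : (lam.cells ⊕ mu.cells) ≃ Fin 5)
    {V : Submodule ℂ (MvPolynomial (Fin 5) ℂ)} (hV : ∀ k, ∀ f ∈ V, polyGen k f ∈ V)
    (hT : spechtPoly T ∈ V) : spechtModule lam mu ≤ V := by
  rw [spechtModule_eq T, Submodule.span_le]
  rintro _ ⟨π, rfl⟩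
  exact rename_mem hV π _ hT

theorem rename_mem_spechtModule {lam mu : YoungDiagram} (T : (lam.cells ⊕ mu.cells) ≃ Fin 5)
    (π : Equiv.Perm (Fin 5)) : rename π (spechtPoly T) ∈ spechtModule lam mu := by
  rw [spechtModule_eq T]
  exact Submodule.subset_span ⟨π, rfl⟩

/-! ### Explicit bitableaux of the two shapes -/

/-- The diagram `[2]`. -/
abbrev diag2 : YoungDiagram := YoungDiagram.ofRowLens [2] (by decide)

/-- The diagram `[2, 1]`. -/
abbrev diag21 : YoungDiagram := YoungDiagram.ofRowLens [2, 1] (by decide)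

/-- The diagram `[2, 2, 1]`. -/
abbrev diag221 : YoungDiagram := YoungDiagram.ofRowLens [2, 2, 1] (by decide)

theorem univ_diag2 : (Finset.univ : Finset diag2.cells) =
    {⟨(0, 0), by decide⟩, ⟨(0, 1), by decide⟩} := by decide +kernel

theorem univ_diag21 : (Finset.univ : Finset diag21.cells) =
    {⟨(0, 0), by decide⟩, ⟨(1, 0), by decide⟩, ⟨(0, 1), by decide⟩} := by decide +kernel

theorem univ_diag221 : (Finset.univ : Finset diag221.cells) =
    {⟨(0, 0), by decide⟩, ⟨(1, 0), by decide⟩, ⟨(2, 0), by decide⟩, ⟨(0, 1), by decide⟩,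
      ⟨(1, 1), by decide⟩} := by decide +kernel

/-- The cells of the bidiagram `([2], [2, 1])`. -/
def cells2_21 : Fin 5 → diag2.cells ⊕ diag21.cells :=
  ![.inr ⟨(0, 0), by decide⟩, .inr ⟨(1, 0), by decide⟩, .inr ⟨(0, 1), by decide⟩,
    .inl ⟨(0, 0), by decide⟩, .inl ⟨(0, 1), by decide⟩]

/-- The cells of the bidiagram `(-, [2, 2, 1])`. -/
def cells0_221 : Fin 5 → (⊥ : YoungDiagram).cells ⊕ diag221.cells :=
  ![.inr ⟨(0, 0), by decide⟩, .inr ⟨(1, 0), by decide⟩, .inr ⟨(2, 0), by decide⟩,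
    .inr ⟨(0, 1), by decide⟩, .inr ⟨(1, 1), by decide⟩]

/-- A bitableau of shape `([2], [2, 1])`. -/
def tableau2_21 : (diag2.cells ⊕ diag21.cells) ≃ Fin 5 :=
  (Equiv.ofBijective cells2_21 (by decide +kernel)).symm

/-- A bitableau of shape `(-, [2, 2, 1])`. -/
def tableau0_221 : ((⊥ : YoungDiagram).cells ⊕ diag221.cells) ≃ Fin 5 :=
  (Equiv.ofBijective cells0_221 (by decide +kernel)).symm

theorem tableau2_21_apply (i : Fin 5) : tableau2_21 (cells2_21 i) = i :=
  Equiv.ofBijective_symm_apply_apply _ _ i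

theorem tableau0_221_apply (i : Fin 5) : tableau0_221 (cells0_221 i) = i :=
  Equiv.ofBijective_symm_apply_apply _ _ i

theorem spechtPoly_tableau2_21 :
    spechtPoly tableau2_21 = (X 0 ^ 2 - X 1 ^ 2) * (X 0 * (X 1 * X 2)) := by
  have h0 := tableau2_21_apply 0
  have h1 := tableau2_21_apply 1
  have h2 := tableau2_21_apply 2
  simp only [cells2_21, Matrix.cons_val] at h0 h1 h2
  simp only [spechtPoly, colProd, univ_diag2, univ_diag21]
  simp [h0, h1, h2]

theorem spechtPoly_tableau0_221 :
    spechtPoly tableau0_221 = (X 0 ^ 2 - X 1 ^ 2) * (X 0 ^ 2 - X 2 ^ 2) * (X 1 ^ 2 - X 2 ^ 2) *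
      (X 3 ^ 2 - X 4 ^ 2) * (X 0 * (X 1 * (X 2 * (X 3 * X 4)))) := by
  have h0 := tableau0_221_apply 0
  have h1 := tableau0_221_apply 1
  have h2 := tableau0_221_apply 2
  have h3 := tableau0_221_apply 3
  have h4 := tableau0_221_apply 4
  simp only [cells0_221, Matrix.cons_val] at h0 h1 h2 h3 h4
  simp only [spechtPoly, colProd, univ_diag221]
  simp [h0, h1, h2, h3, h4]
  ring

end

end GMWeb

namespace GMWeb

open MvPolynomial

noncomputable section

/-! ### The representation `V_[-,221]` -/

/-- The Specht polynomial of shape `(-, [2, 2, 1])` with columns `(v 0, v 1, v 2)` and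
`(v 3, v 4)`. -/
def vand (v : Fin 5 → Fin 5) : MvPolynomial (Fin 5) ℂ :=
  (X (v 0) ^ 2 - X (v 1) ^ 2) * (X (v 0) ^ 2 - X (v 2) ^ 2) * (X (v 1) ^ 2 - X (v 2) ^ 2) *
    (X (v 3) ^ 2 - X (v 4) ^ 2) * (X 0 * (X 1 * (X 2 * (X 3 * X 4))))

/-- The ten triples, followed by their complements. -/
def tripleArr : Fin 10 → Fin 5 → Fin 5 :=
  ![![0, 1, 2, 3, 4], ![0, 1, 3, 2, 4], ![0, 1, 4, 2, 3], ![0, 2, 3, 1, 4], ![0, 2, 4, 1, 3],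
    ![0, 3, 4, 1, 2], ![1, 2, 3, 0, 4], ![1, 2, 4, 0, 3], ![1, 3, 4, 0, 2], ![2, 3, 4, 0, 1]]

/-- The signs of the Specht polynomials corresponding to the ten identities of weight two. -/
def vandSign : Fin 10 → ℤ := ![1, -1, -1, -1, -1, 1, -1, -1, 1, 1]

/-- The Specht polynomials corresponding to the ten identities of weight two. -/
def vandPoly (τ : Fin 10) : MvPolynomial (Fin 5) ℂ := C (vandSign τ : ℂ) * vand (tripleArr τ)

theorem polyGen_X_sq (k i : Fin 5) : polyGen k (X i) ^ 2 = X (varPerm k i) ^ 2 := by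
  rw [polyGen_X, mul_pow, ← C_pow]
  have h : ∀ k i, varSign k i ^ 2 = 1 := by decide
  rw [show (varSign k i : ℂ) ^ 2 = 1 by exact_mod_cast h k i, C_1, one_mul]

/-- Squares do not see signs, and the last generator changes two signs in the product of all the
variables, which is therefore invariant. -/
theorem polyGen_vand (k : Fin 5) (v : Fin 5 → Fin 5) :
    polyGen k (vand v) = vand fun i => varPerm k (v i) := by
  have h : polyGen k (X 0 * (X 1 * (X 2 * (X 3 * X 4)))) = X 0 * (X 1 * (X 2 * (X 3 * X 4))) := by
    fin_cases k <;> simp [polyGen] <;> ring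
  simp only [vand, map_mul (polyGen k) _ (X 0 * _), h]
  simp only [map_mul, map_sub, map_pow, polyGen_X_sq]

/-- The same permutation and the same signs as in `pull_quad_coef`: this is where the identities and
the Specht polynomials are seen to transform alike. -/
theorem polyGen_vandPoly (k : Fin 5) (τ : Fin 10) :
    polyGen k (vandPoly τ) = (tripleSign k τ : ℂ) • vandPoly (triplePerm k τ) := by
  simp only [vandPoly, map_mul, polyGen_vand, smul_eq_C_mul, algHom_C, algebraMap_eq]
  simp only [vand]
  generalize (X 0 * (X 1 * (X 2 * (X 3 * X 4))) : MvPolynomial (Fin 5) ℂ) = m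
  fin_cases k <;> fin_cases τ <;>
    simp [vandSign, tripleSign, triplePerm, tripleArr, varPerm] <;> ring

/-- The ten polynomials satisfy the same linear relations as the ten identities, so the map defined
on five of them is compatible with all ten. -/
theorem vandPoly_eq_sum (τ : Fin 10) :
    vandPoly τ = ∑ j, (coefCoord τ j : ℂ) • vandPoly (![0, 1, 2, 3, 7] j) := by
  simp only [vandPoly, smul_eq_C_mul, Fin.sum_univ_five, vand]
  generalize (X 0 * (X 1 * (X 2 * (X 3 * X 4))) : MvPolynomial (Fin 5) ℂ) = m
  fin_cases τ <;> simp [vandSign, coefCoord, tripleArr] <;> ring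

theorem vandPoly_mem (τ : Fin 10) : vandPoly τ ∈ V0_221 := by
  have hb : ∀ τ, Function.Bijective (tripleArr τ) := by decide +kernel
  have h := rename_mem_spechtModule tableau0_221 (Equiv.ofBijective _ (hb τ))
  have hp : (X (tripleArr τ 0) * (X (tripleArr τ 1) * (X (tripleArr τ 2) *
      (X (tripleArr τ 3) * X (tripleArr τ 4)))) : MvPolynomial (Fin 5) ℂ) =
      X 0 * (X 1 * (X 2 * (X 3 * X 4))) := by
    fin_cases τ <;> simp [tripleArr] <;> ring
  rw [spechtPoly_tableau0_221] at h
  simp only [map_mul, map_sub, map_pow, rename_X, Equiv.ofBijective_apply, hp] at h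
  rw [vandPoly, ← smul_eq_C_mul]
  exact Submodule.smul_mem _ _ h

/-- The map from coordinates of identities of weight two to polynomials. -/
def theta : (Fin 5 → ℂ) →ₗ[ℂ] MvPolynomial (Fin 5) ℂ where
  toFun γ := ∑ j, γ j • vandPoly (![0, 1, 2, 3, 7] j)
  map_add' γ δ := by simp only [Pi.add_apply, add_smul, Finset.sum_add_distrib]
  map_smul' a γ := by
    simp only [Pi.smul_apply, smul_eq_mul, mul_smul, Finset.smul_sum, RingHom.id_apply]

theorem polyGen_theta (k : Fin 5) (γ : Fin 5 → ℂ) : polyGen k (theta γ) = theta (pullQuad k γ) := by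
  simp only [theta, LinearMap.coe_mk, AddHom.coe_mk, map_sum, map_smul, polyGen_vandPoly, pullQuad,
    Finset.sum_smul]
  rw [Finset.sum_comm]
  refine Finset.sum_congr rfl fun i _ => ?_
  rw [vandPoly_eq_sum (triplePerm k _), Finset.smul_sum, Finset.smul_sum]
  simp only [smul_smul, mul_assoc]

/-- The values of the Specht polynomials at integral points. -/
def vandVal (τ : Fin 10) (x : Fin 5 → ℤ) : ℤ :=
  let v := tripleArr τ
  vandSign τ * ((x (v 0) ^ 2 - x (v 1) ^ 2) * (x (v 0) ^ 2 - x (v 2) ^ 2) *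
    (x (v 1) ^ 2 - x (v 2) ^ 2) * (x (v 3) ^ 2 - x (v 4) ^ 2) *
    (x 0 * (x 1 * (x 2 * (x 3 * x 4)))))

theorem eval_vandPoly (τ : Fin 10) (x : Fin 5 → ℤ) :
    eval (fun i => (x i : ℂ)) (vandPoly τ) = (vandVal τ x : ℂ) := by
  simp [vandPoly, vand, vandVal]

theorem fullRank_vandVal : fullRank (List.finRange 5) (fun i j => vandVal (![0, 1, 2, 3, 7] j)
    (![![1, 1, 2, 2, 3], ![1, 1, 2, 3, 2], ![1, 2, 1, 2, 3], ![1, 2, 1, 3, 2],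
      ![1, 2, 3, 1, 2]] i)) = true := by
  decide +kernel

theorem theta_injective : Function.Injective theta := by
  rw [injective_iff_map_eq_zero]
  intro γ h
  refine eq_zero_of_fullRank fullRank_vandVal (by norm_num) fun i _ => ?_
  have h1 := congrArg (eval fun j => ((![![1, 1, 2, 2, 3], ![1, 1, 2, 3, 2], ![1, 2, 1, 2, 3],
    ![1, 2, 1, 3, 2], ![1, 2, 3, 1, 2]] i : Fin 5 → ℤ) j : ℂ)) h
  simp only [theta, LinearMap.coe_mk, AddHom.coe_mk, map_sum, smul_eval, eval_vandPoly,
    map_zero] at h1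
  rw [← h1]
  exact Finset.sum_congr rfl fun j _ => mul_comm _ _

/-- The image is spanned by Specht polynomials up to sign; conversely it is invariant and contains
one of them, so cyclicity concludes. -/
theorem range_theta : LinearMap.range theta = V0_221 := by
  refine le_antisymm ?_ (spechtModule_le tableau0_221 ?_ ?_)
  · rintro _ ⟨γ, rfl⟩
    change ∑ j, γ j • vandPoly (![0, 1, 2, 3, 7] j) ∈ V0_221
    exact Submodule.sum_mem _ fun j _ => Submodule.smul_mem _ _ (vandPoly_mem _)
  · rintro k _ ⟨γ, rfl⟩
    exact ⟨_, (polyGen_theta k γ).symm⟩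
  · refine ⟨fun j => (coefCoord 0 j : ℂ), ?_⟩
    change ∑ j, (coefCoord 0 j : ℂ) • vandPoly (![0, 1, 2, 3, 7] j) = _
    rw [← vandPoly_eq_sum, spechtPoly_tableau0_221]
    simp [vandPoly, vandSign, vand, tripleArr]

/-! ### The representation `V_[2,21]` -/

/-- The polynomials `x_i x_q x_r (x_q² + x_r² - 2 x_i²)`. -/
def triPoly (i q r : Fin 5) : MvPolynomial (Fin 5) ℂ :=
  X i * X q * X r * (X q ^ 2 + X r ^ 2 - 2 * X i ^ 2)

theorem polyGen_triPoly (k i q r : Fin 5) : polyGen k (triPoly i q r) =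
    ((varSign k i * varSign k q * varSign k r : ℤ) : ℂ) •
      triPoly (varPerm k i) (varPerm k q) (varPerm k r) := by
  simp only [triPoly, map_mul, map_sub, map_add, map_pow, map_ofNat, polyGen_X_sq, smul_eq_C_mul,
    Int.cast_mul]
  simp only [polyGen_X]
  ring

/-- The position of `q` among the elements of `{1, …, 5}` different from `i`. -/
def others (i q : Fin 5) : Fin 4 := Fin.ofNat 4 (if q < i then q else q - 1)

/-- Coefficients of the equivariant map on the logarithms `Log U_{l,s}`, as a function of the six
pairs of indices different from that of `l`. -/
def phiTable : Fin 2 → Fin 3 → Fin 6 → ℤ :=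
  ![![![1, 0, -1, -1, 0, 1], ![1, -1, 0, 0, -1, 1], ![0, -1, -1, -1, -1, 0]],
    ![![-1, 0, -1, 1, 0, 1], ![-1, 1, 0, 0, -1, 1], ![0, 1, -1, 1, -1, 0]]]

/-- The coefficients of `triPoly (base l) q r` in the image of `Log U_{l,s}`. -/
def phiCoef (l : Fin 10) (s : Fin 3) (q r : Fin 5) : ℤ :=
  if q = base l ∨ r = base l ∨ q = r then 0
  else phiTable (Fin.ofNat 2 (l / 5)) s ((![![0, 0, 1, 2], ![0, 0, 3, 4], ![1, 3, 0, 5],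
    ![2, 4, 5, 0]] : Fin 4 → Fin 4 → Fin 6) (others (base l) q) (others (base l) r))

/-- The image of `Log U_{l,s}`. -/
def phiRow (l : Fin 10) (s : Fin 3) : MvPolynomial (Fin 5) ℂ :=
  ∑ q, ∑ r, (phiCoef l s q r : ℂ) • triPoly (base l) q r

theorem base_foliationPerm : ∀ k l, base (foliationPerm k l) = varPerm k (base l) := by
  decide +kernel

/-- Equivariance of `phi`, read on the coefficients of the `triPoly` and checked case by case. -/
theorem phiCoef_varPerm : ∀ k l s q r, phiCoef l s (varPerm k q) (varPerm k r) *
    (varSign k (base l) * varSign k (varPerm k q) * varSign k (varPerm k r)) =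
      ∑ t, pullMatrix k l s t * phiCoef (foliationPerm k l) t q r := by
  decide +kernel

theorem polyGen_phiRow (k : Fin 5) (l : Fin 10) (s : Fin 3) :
    polyGen k (phiRow l s) = ∑ t, (pullMatrix k l s t : ℂ) • phiRow (foliationPerm k l) t := by
  -- Both summation indices are moved by the involution of the variables, so that the two sides
  -- become sums over the same `triPoly`.
  let e : Equiv.Perm (Fin 5) := Function.Involutive.toPerm (varPerm k) (varPerm_varPerm k)
  simp only [phiRow, map_sum, map_smul, polyGen_triPoly, smul_smul]
  rw [← Equiv.sum_comp e]
  have h (q : Fin 5) := (Equiv.sum_comp e fun r => ((phiCoef l s (e q) r : ℂ) *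
    ((varSign k (base l) * varSign k (e q) * varSign k r : ℤ) : ℂ)) •
      triPoly (varPerm k (base l)) (varPerm k (e q)) (varPerm k r)).symm
  simp only [h]
  simp only [show ∀ q, e q = varPerm k q from fun _ => rfl, varPerm_varPerm, ← Int.cast_mul,
    phiCoef_varPerm, ← base_foliationPerm, Finset.smul_sum, smul_smul]
  push_cast
  simp only [Finset.sum_smul]
  rw [Finset.sum_comm (s := (Finset.univ : Finset (Fin 3)))]
  exact Finset.sum_congr rfl fun q _ => Finset.sum_comm

/-- The map from coefficients of linear forms to polynomials. -/
def phi : (Fin 10 → Fin 3 → ℂ) →ₗ[ℂ] MvPolynomial (Fin 5) ℂ where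
  toFun α := ∑ l, ∑ s, α l s • phiRow l s
  map_add' γ δ := by simp only [Pi.add_apply, add_smul, Finset.sum_add_distrib]
  map_smul' a γ := by
    simp only [Pi.smul_apply, smul_eq_mul, mul_smul, Finset.smul_sum, RingHom.id_apply]

theorem polyGen_phi (k : Fin 5) (α : Fin 10 → Fin 3 → ℂ) :
    polyGen k (phi α) = phi (pullLin k α) := by
  simp only [phi, LinearMap.coe_mk, AddHom.coe_mk, map_sum, map_smul, polyGen_phiRow]
  rw [← Equiv.sum_comp (foliationPerm k) fun l => ∑ s, pullLin k α l s • phiRow l s]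
  refine Finset.sum_congr rfl fun l _ => ?_
  simp only [pullLin, foliationPerm_foliationPerm, Finset.sum_smul, Finset.smul_sum, smul_smul]
  exact Finset.sum_comm

theorem exists_perm (i q r : Fin 5) (hiq : i ≠ q) (hir : i ≠ r) (hqr : q ≠ r) :
    ∃ π : Equiv.Perm (Fin 5), π 0 = q ∧ π 1 = i ∧ π 2 = r := by
  have h : ∀ i q r : Fin 5, i ≠ q → i ≠ r → q ≠ r →
      let a := Equiv.swap 0 q
      let b := Equiv.swap (a 1) i * a
      let π := Equiv.swap (b 2) r * b
      π 0 = q ∧ π 1 = i ∧ π 2 = r := by decide +kernel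
  exact ⟨_, h i q r hiq hir hqr⟩

/-- It is the sum of two Specht polynomials with `x_i` at the foot of the first column, the other
two variables exchanging their places. -/
theorem triPoly_mem {i q r : Fin 5} (hiq : i ≠ q) (hir : i ≠ r) (hqr : q ≠ r) :
    triPoly i q r ∈ V2_21 := by
  have h (q r : Fin 5) (hiq : i ≠ q) (hir : i ≠ r) (hqr : q ≠ r) :
      (X q ^ 2 - X i ^ 2) * (X q * (X i * X r)) ∈ V2_21 := by
    obtain ⟨π, h0, h1, h2⟩ := exists_perm i q r hiq hir hqr
    have h := rename_mem_spechtModule tableau2_21 π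
    rw [spechtPoly_tableau2_21] at h
    simp only [map_mul, map_sub, map_pow, rename_X, h0, h1, h2] at h
    exact h
  have h1 := Submodule.add_mem _ (h q r hiq hir hqr) (h r q hir hiq hqr.symm)
  convert h1 using 1
  rw [triPoly]
  ring

theorem phiRow_mem (l : Fin 10) (s : Fin 3) : phiRow l s ∈ V2_21 := by
  refine Submodule.sum_mem _ fun q _ => Submodule.sum_mem _ fun r _ => ?_
  rw [phiCoef]
  split_ifs with h
  · simp
  · rw [not_or, not_or] at h
    exact Submodule.smul_mem _ _ (triPoly_mem (Ne.symm h.1) (Ne.symm h.2.1) h.2.2)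

/-- The values of `phiRow` at integral points. -/
def phiVal (l : Fin 10) (s : Fin 3) (x : Fin 5 → ℤ) : ℤ :=
  ∑ q, ∑ r, phiCoef l s q r * (x (base l) * x q * x r * (x q ^ 2 + x r ^ 2 - 2 * x (base l) ^ 2))

theorem eval_phiRow (l : Fin 10) (s : Fin 3) (x : Fin 5 → ℤ) :
    eval (fun i => (x i : ℂ)) (phiRow l s) = (phiVal l s x : ℂ) := by
  simp [phiRow, triPoly, phiVal]

/-- Points supported on three indices. -/
def triplePoint (τ : Fin 10) (e : Fin 2) (i : Fin 5) : ℤ :=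
  if i ∈ (triple τ).1 then if i = tripleArr τ e.castSucc.castSucc.castSucc then 2 else 1 else 0

/-- The equations of `linRel ∩ ker phi`. -/
def phiEqn (i : Fin 10 ⊕ Fin 10 × Fin 2) (j : Fin (10 * 3)) : ℤ :=
  match i with
  | .inl k => expo j.divNat j.modNat k
  | .inr τ => phiVal j.divNat j.modNat (triplePoint τ.1 τ.2)

/-- Thirty unknowns against thirty equations: the ten equations of `linRel` and the values of the
image at two points for each of the ten triples. -/
theorem fullRank_phiEqn : fullRank ((List.finRange 10).map Sum.inl ++
    (List.finRange 10).map (fun τ => Sum.inr (τ, 0)) ++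
    (List.finRange 10).map (fun τ => Sum.inr (τ, 1))) phiEqn = true := by
  decide +kernel

theorem sum_divNat_modNat {M : Type*} [AddCommMonoid M] {m n : ℕ} (F : Fin m → Fin n → M) :
    ∑ j : Fin (m * n), F j.divNat j.modNat = ∑ l, ∑ s, F l s := by
  rw [← Fintype.sum_prod_type', ← Equiv.sum_comp finProdFinEquiv.symm]
  rfl

theorem eq_zero_of_divNat_modNat {M : Type*} [Zero M] {m n : ℕ} {α : Fin m → Fin n → M}
    (h1 : (fun j : Fin (m * n) => α j.divNat j.modNat) = 0) : α = 0 := by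
  funext l s
  have h2 := finProdFinEquiv.symm_apply_apply (l, s)
  have h3 : (finProdFinEquiv (l, s)).divNat = l := congrArg Prod.fst h2
  have h4 : (finProdFinEquiv (l, s)).modNat = s := congrArg Prod.snd h2
  have := congrFun h1 (finProdFinEquiv (l, s))
  simp only [h3, h4] at this
  exact this

theorem eq_zero_of_phi {α : Fin 10 → Fin 3 → ℂ} (hα : α ∈ linRel) (h : phi α = 0) : α = 0 := by
  have h1 : (fun j : Fin (10 * 3) => α j.divNat j.modNat) = 0 := by
    refine eq_zero_of_fullRank fullRank_phiEqn (by norm_num) fun i _ => ?_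
    rcases i with k | ⟨τ, e⟩
    · simp only [phiEqn]
      rw [sum_divNat_modNat fun l s => (expo l s k : ℂ) * α l s, ← hα k]
      simp only [mul_comm]
    · simp only [phiEqn]
      rw [sum_divNat_modNat fun l s => (phiVal l s (triplePoint τ e) : ℂ) * α l s]
      have := congrArg (eval fun i => (triplePoint τ e i : ℂ)) h
      simp only [phi, LinearMap.coe_mk, AddHom.coe_mk, map_sum, smul_eval, eval_phiRow,
        map_zero] at this
      rw [← this]
      simp only [mul_comm]
  exact eq_zero_of_divNat_modNat h1

/-- Coefficients mapped to a Specht polynomial. -/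
def phiWitness : Fin 10 → Fin 3 → ℤ :=
  ![![-1, -1, 1], ![1, 1, -1], 0, 0, 0, ![1, 1, -1], ![-1, -1, 1], 0, 0, 0]

theorem phiWitness_mem : (fun l s => (phiWitness l s : ℂ)) ∈ linRel := by
  have h : ∀ k, ∑ l, ∑ s, phiWitness l s * expo l s k = 0 := by decide +kernel
  intro k
  have := congrArg (fun n : ℤ => (n : ℂ)) (h k)
  push_cast at this
  exact this

/-- The terms in the last two variables cancel between `l` and `l*`, which leaves 8 times `triPoly 1
0 2 - triPoly 0 1 2`. This difference is 3 times the Specht polynomial, whence 24. -/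
theorem phi_phiWitness : phi (fun l s => (phiWitness l s : ℂ)) = (24 : ℂ) • spechtPoly tableau2_21 := by
  have h1 : ∀ l q r, ∑ s, phiWitness l s * phiCoef l s q r =
      (![![0, ![0, 0, -2, 0, 0], ![0, -2, 0, 0, 0], ![0, 0, 0, 0, -2], ![0, 0, 0, -2, 0]],
        ![![0, 0, 2, 0, 0], 0, ![2, 0, 0, 0, 0], ![0, 0, 0, 0, 2], ![0, 0, 0, 2, 0]], 0, 0, 0,
        ![0, ![0, 0, -2, 0, 0], ![0, -2, 0, 0, 0], ![0, 0, 0, 0, 2], ![0, 0, 0, 2, 0]],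
        ![![0, 0, 2, 0, 0], 0, ![2, 0, 0, 0, 0], ![0, 0, 0, 0, -2], ![0, 0, 0, -2, 0]], 0, 0, 0] :
          Fin 10 → Fin 5 → Fin 5 → ℤ) l q r := by
    decide +kernel
  have h2 (l : Fin 10) : ∑ s, (phiWitness l s : ℂ) • phiRow l s =
      ∑ q, ∑ r, ((∑ s, phiWitness l s * phiCoef l s q r : ℤ) : ℂ) • triPoly (base l) q r := by
    push_cast
    simp only [phiRow, Finset.smul_sum, smul_smul, Finset.sum_smul]
    rw [Finset.sum_comm]
    exact Finset.sum_congr rfl fun q _ => Finset.sum_comm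
  change ∑ l, ∑ s, (phiWitness l s : ℂ) • phiRow l s = _
  simp only [h2, h1, spechtPoly_tableau2_21, sum_fin_ten, Fin.sum_univ_five]
  simp [base, triPoly, smul_eq_C_mul]
  rw [show (C 2 : MvPolynomial (Fin 5) ℂ) = 2 from map_ofNat C 2,
    show (C 24 : MvPolynomial (Fin 5) ℂ) = 24 from map_ofNat C 24]
  ring

theorem map_phi : linRel.map phi = V2_21 := by
  refine le_antisymm ?_ (spechtModule_le tableau2_21 ?_ ?_)
  · rintro _ ⟨α, -, rfl⟩
    change ∑ l, ∑ s, α l s • phiRow l s ∈ V2_21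
    exact Submodule.sum_mem _ fun l _ => Submodule.sum_mem _ fun s _ =>
      Submodule.smul_mem _ _ (phiRow_mem l s)
  · rintro k _ ⟨α, hα, rfl⟩
    exact ⟨_, pullLin_mem k hα, (polyGen_phi k α).symm⟩
  · have h := Submodule.smul_mem _ (24 : ℂ)⁻¹ (Submodule.mem_map_of_mem (f := phi) phiWitness_mem)
    rwa [phi_phiWitness, smul_smul, inv_mul_cancel₀ (by norm_num), one_smul] at h

end

end GMWeb

namespace GMWeb

open MvPolynomial

noncomputable section

variable {D : TopologicalSpace.Opens C5} {L : Fin 10 → C5 → ℂ}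

/-! ### The representations of `W(D₅)` -/

/-- The isomorphism between coefficients of weight one and `V_[2,21]`. -/
def phiEquiv : linRel ≃ₗ[ℂ] V2_21 :=
  (LinearEquiv.ofInjective (phi ∘ₗ linRel.subtype) ((injective_iff_map_eq_zero _).2 fun α h =>
    Subtype.ext (eq_zero_of_phi α.2 h))).trans
    (LinearEquiv.ofEq _ _ (by rw [LinearMap.range_comp, Submodule.range_subtype, map_phi]))

theorem coe_phiEquiv (α : linRel) : (phiEquiv α : MvPolynomial (Fin 5) ℂ) = phi α := rfl

/-- The isomorphism between coordinates of identities of weight two and `V_[-,221]`. -/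
def thetaEquiv : (Fin 5 → ℂ) ≃ₗ[ℂ] V0_221 :=
  (LinearEquiv.ofInjective theta theta_injective).trans (LinearEquiv.ofEq _ _ range_theta)

theorem coe_thetaEquiv (γ : Fin 5 → ℂ) : (thetaEquiv γ : MvPolynomial (Fin 5) ℂ) = theta γ := rfl

theorem IsLogDet.isPullback_rel1 (hL : IsLogDet (D : Set C5) L) (k : Fin 5) (α : linRel) :
    IsPullback0 D L 1 k (hL.rel1 α) (hL.rel1 ⟨pullLin k α, pullLin_mem k α.2⟩) ∧
      IsPullback1 D L 0 k (d0 D (hL.rel1 α)) (d0 D (hL.rel1 ⟨pullLin k α, pullLin_mem k α.2⟩)) := by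
  have hx := hL.isLogClass_rel1 α
  have hx' := hL.isLogClass_rel1 ⟨pullLin k α, pullLin_mem k α.2⟩
  generalize hL.rel1 ⟨pullLin k α, pullLin_mem k α.2⟩ = x' at hx' ⊢
  generalize hL.rel1 α = x at hx ⊢
  change IsLogClass D L (linPoly (pullLin k α)) x' at hx'
  rw [← pull_linPoly] at hx'
  exact ⟨isPullback0_pull (isHomogeneous_linPoly α) k hx hx',
    isPullback1_pull hL (isHomogeneous_linPoly α) k hx hx'⟩

theorem IsLogDet.isPullback_rel2 (hL : IsLogDet (D : Set C5) L) (k : Fin 5) (γ : Fin 5 → ℂ) :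
    IsPullback0 D L 2 k (hL.rel2 γ) (hL.rel2 (pullQuad k γ)) ∧
      IsPullback1 D L 1 k (d0 D (hL.rel2 γ)) (d0 D (hL.rel2 (pullQuad k γ))) := by
  have hx := hL.isLogClass_rel2 γ
  have hx' := hL.isLogClass_rel2 (pullQuad k γ)
  generalize hL.rel2 (pullQuad k γ) = x' at hx' ⊢
  generalize hL.rel2 γ = x at hx ⊢
  rw [← pull_quadPoly] at hx'
  exact ⟨isPullback0_pull (isHomogeneous_quadPoly _) k hx hx',
    isPullback1_pull hL (isHomogeneous_quadPoly _) k hx hx'⟩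

theorem IsLogDet.exists_rep_one (hD : IsConnected (D : Set C5)) (hL : IsLogDet (D : Set C5) L) :
    ∃ ρ : Representation ℂ WD5 (WAR0 D L 1),
      (∀ k (x : WAR0 D L 1), IsPullback0 D L 1 k x (ρ (D5.simple k) x) ∧
        IsPullback1 D L 0 k (d0 D x) (d0 D (ρ (D5.simple k) x))) ∧
      ∃ e : WAR0 D L 1 ≃ₗ[ℂ] V2_21,
        ∀ g x, (e (ρ g x) : MvPolynomial (Fin 5) ℂ) = polyRep g (e x) := by
  obtain ⟨ρ, h1, h2⟩ := exists_representation ((hL.equiv1 hD).symm.trans phiEquiv)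
    (a := fun k x => hL.equiv1 hD ⟨pullLin k ((hL.equiv1 hD).symm x), pullLin_mem k (Subtype.prop _)⟩)
    (fun k x => by
      rw [LinearEquiv.trans_apply, LinearEquiv.trans_apply, LinearEquiv.symm_apply_apply,
        coe_phiEquiv, coe_phiEquiv, polyGen_phi])
  refine ⟨ρ, fun k x => ?_, _, h2⟩
  rw [h1]
  obtain ⟨α, rfl⟩ := (hL.equiv1 hD).surjective x
  rw [LinearEquiv.symm_apply_apply, coe_equiv1, coe_equiv1]
  exact hL.isPullback_rel1 k α

theorem IsLogDet.exists_rep_two (hD : IsConnected (D : Set C5)) (hL : IsLogDet (D : Set C5) L) :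
    ∃ ρ : Representation ℂ WD5 (WAR0 D L 2),
      (∀ k (x : WAR0 D L 2), IsPullback0 D L 2 k x (ρ (D5.simple k) x) ∧
        IsPullback1 D L 1 k (d0 D x) (d0 D (ρ (D5.simple k) x))) ∧
      ∃ e : WAR0 D L 2 ≃ₗ[ℂ] V0_221,
        ∀ g x, (e (ρ g x) : MvPolynomial (Fin 5) ℂ) = polyRep g (e x) := by
  obtain ⟨ρ, h1, h2⟩ := exists_representation ((hL.equiv2 hD).symm.trans thetaEquiv)
    (a := fun k x => hL.equiv2 hD (pullQuad k ((hL.equiv2 hD).symm x)))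
    (fun k x => by
      rw [LinearEquiv.trans_apply, LinearEquiv.trans_apply, LinearEquiv.symm_apply_apply,
        coe_thetaEquiv, coe_thetaEquiv, polyGen_theta])
  refine ⟨ρ, fun k x => ?_, _, h2⟩
  rw [h1]
  obtain ⟨γ, rfl⟩ := (hL.equiv2 hD).surjective x
  rw [LinearEquiv.symm_apply_apply, coe_equiv2, coe_equiv2]
  exact hL.isPullback_rel2 k γ

/-- Transport of a representation along an injective linear map. -/
theorem exists_representation_map {E F : Type*} [AddCommGroup E] [Module ℂ E] [AddCommGroup F]
    [Module ℂ F] (f : E →ₗ[ℂ] F) (hf : Function.Injective f) {V : Submodule ℂ E} {W : Submodule ℂ F}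
    (h : V.map f = W) (ρ : Representation ℂ WD5 V) :
    ∃ (θ : Representation ℂ WD5 W) (δ : V ≃ₗ[ℂ] W),
      (∀ x, (δ x : F) = f x) ∧ ∀ g x, δ (ρ g x) = θ g (δ x) := by
  subst h
  let δ := Submodule.equivMapOfInjective f hf V
  let θ : Representation ℂ WD5 (V.map f) :=
    { toFun := fun g => δ.toLinearMap ∘ₗ ρ g ∘ₗ δ.symm.toLinearMap
      map_one' := by
        refine LinearMap.ext fun x => ?_
        change δ (ρ 1 (δ.symm x)) = x
        rw [map_one, Module.End.one_apply, LinearEquiv.apply_symm_apply]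
      map_mul' := fun g h => by
        refine LinearMap.ext fun x => ?_
        change δ (ρ (g * h) (δ.symm x)) = δ (ρ g (δ.symm (δ (ρ h (δ.symm x)))))
        rw [map_mul, Module.End.mul_apply, LinearEquiv.symm_apply_apply] }
  refine ⟨θ, δ, fun x => rfl, fun g x => ?_⟩
  change δ (ρ g x) = δ (ρ g (δ.symm (δ x)))
  rw [LinearEquiv.symm_apply_apply]

theorem IsLogDet.structure_AR0 (hD : IsConnected (D : Set C5)) (hL : IsLogDet (D : Set C5) L) :
    IsCompl (WAR0 D L 1) (WAR0 D L 2) ∧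
      Module.finrank ℂ (WAR0 D L 1) = 20 ∧ Module.finrank ℂ (WAR0 D L 2) = 5 ∧
      Function.Injective (d0 D) ∧
      (WAR0 D L 1).map (d0 D) = WAR1 D L 0 ∧
      (WAR0 D L 2).map (d0 D) = AR1Sym D L ∧
      ∃ (ρ₁ : Representation ℂ WD5 (WAR0 D L 1)) (ρ₂ : Representation ℂ WD5 (WAR0 D L 2))
        (θ₁ : Representation ℂ WD5 (WAR1 D L 0)) (θ₂ : Representation ℂ WD5 (AR1Sym D L)),
        (∀ k (x : WAR0 D L 1), IsPullback0 D L 1 k x (ρ₁ (D5.simple k) x)) ∧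
        (∀ k (x : WAR0 D L 2), IsPullback0 D L 2 k x (ρ₂ (D5.simple k) x)) ∧
        (∀ k (η : WAR1 D L 0), IsPullback1 D L 0 k η (θ₁ (D5.simple k) η)) ∧
        (∀ k (η : AR1Sym D L), IsPullback1 D L 1 k η (θ₂ (D5.simple k) η)) ∧
        (∃ δ : WAR0 D L 1 ≃ₗ[ℂ] WAR1 D L 0,
          (∀ x, (δ x : Forms D) = d0 D x) ∧ ∀ g x, δ (ρ₁ g x) = θ₁ g (δ x)) ∧
        (∃ δ : WAR0 D L 2 ≃ₗ[ℂ] AR1Sym D L,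
          (∀ x, (δ x : Forms D) = d0 D x) ∧ ∀ g x, δ (ρ₂ g x) = θ₂ g (δ x)) ∧
        (∃ e : WAR0 D L 1 ≃ₗ[ℂ] V2_21,
          ∀ g x, (e (ρ₁ g x) : MvPolynomial (Fin 5) ℂ) = polyRep g (e x)) ∧
        (∃ e : WAR0 D L 2 ≃ₗ[ℂ] V0_221,
          ∀ g x, (e (ρ₂ g x) : MvPolynomial (Fin 5) ℂ) = polyRep g (e x)) := by
  have hinj := d0_injective (D := D) hD.isPreconnected
  obtain ⟨ρ₁, p₁, e₁⟩ := hL.exists_rep_one hD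
  obtain ⟨ρ₂, p₂, e₂⟩ := hL.exists_rep_two hD
  obtain ⟨θ₁, δ₁, h₁, h₁'⟩ := exists_representation_map (d0 D) hinj (hL.map_WAR0_one hD) ρ₁
  obtain ⟨θ₂, δ₂, h₂, h₂'⟩ := exists_representation_map (d0 D) hinj (hL.map_WAR0_two hD) ρ₂
  refine ⟨hL.isCompl_WAR0 hD, hL.finrank_WAR0_one hD, hL.finrank_WAR0_two hD, hinj,
    hL.map_WAR0_one hD, hL.map_WAR0_two hD, ρ₁, ρ₂, θ₁, θ₂, fun k x => (p₁ k x).1,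
    fun k x => (p₂ k x).1, fun k η => ?_, fun k η => ?_, ⟨δ₁, h₁, h₁'⟩, ⟨δ₂, h₂, h₂'⟩, e₁, e₂⟩
  · obtain ⟨x, rfl⟩ := δ₁.surjective η
    rw [← h₁', h₁, h₁]
    exact (p₁ k x).2
  · obtain ⟨x, rfl⟩ := δ₂.surjective η
    rw [← h₂', h₂, h₂]
    exact (p₂ k x).2

end

end GMWeb

namespace GMWeb

open MvPolynomial

noncomputable section

variable {D : TopologicalSpace.Opens C5} {L : Fin 10 → C5 → ℂ}

/-! ### Subwebs -/

/-- The coefficients of the relations of weight one of a subweb. -/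
def linRelOn (S : Finset (Fin 10)) : Submodule ℂ linRel where
  carrier := {α | ∀ l ∉ S, (α : Fin 10 → Fin 3 → ℂ) l = 0}
  zero_mem' _ _ := rfl
  add_mem' ha hb l hl := by
    rw [Submodule.coe_add, Pi.add_apply, ha l hl, hb l hl, add_zero]
  smul_mem' a α ha l hl := by
    rw [Submodule.coe_smul, Pi.smul_apply, ha l hl, smul_zero]

/-- Independence holds within each single foliation, so one vanishing component already kills all
the coefficients attached to it. -/
theorem IsLogDet.eq_zero_of_d0_apply (hD : (D : Set C5).Nonempty) (hL : IsLogDet (D : Set C5) L)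
    (β : linRel) (γ : Fin 5 → ℂ) {l : Fin 10} (h : d0 D (hL.rel1 β + hL.rel2 γ) l = 0) :
    (β : Fin 10 → Fin 3 → ℂ) l = 0 ∧ coefComb γ l = 0 := by
  rw [map_add, hL.d0_of_isLogClass (hL.isLogClass_rel1 β),
    hL.d0_of_isLogClass (hL.isLogClass_rel2 γ)] at h
  obtain ⟨h1, h2⟩ := hL.independent hD l (α := (β : Fin 10 → Fin 3 → ℂ) l)
    (b := pairMatrix (coefComb γ l)) (pairMatrix_comm _) fun y hy => by
      have h1 := congrFun h ⟨y, hy⟩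
      rw [Pi.zero_apply] at h1
      refine Eq.trans ?_ h1
      simp only [Pi.add_apply, logForm, ← Finset.sum_add_distrib]
      refine Finset.sum_congr rfl fun s _ => ?_
      rw [eval_pderiv_linPoly, eval_pderiv_quadPoly]
      exact add_smul (R := ℂ) (M := C5 →L[ℂ] ℂ) _ _ (dlogU l s y)
  refine ⟨h1, pairMatrix_injective ?_⟩
  rw [h2]
  funext s t
  simp [pairMatrix]

/-- Coefficients of the five basic systems, as equations. -/
def coefEqn (i : Fin 5 × Fin 3) (j : Fin 5) : ℤ := coefTable (![0, 1, 2, 3, 7] j) i.1 i.2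

/-- The rows of coefficients at any four of the five underlying indices determine a combination of
the basic identities. -/
theorem fullRank_coefEqn : ∀ i : Fin 5, fullRank
    (((List.finRange 5).filter (· ≠ i)).flatMap fun i => [(i, 0), (i, 1), (i, 2)]) coefEqn = true := by
  decide +kernel

/-- Three foliations contain at most one full pair `{i, i*}`; every other underlying index keeps at
least one foliation outside. -/
theorem exists_base_cover : ∀ a b c : Fin 10, ∃ i : Fin 5, ∀ j : Fin 5, j ≠ i →
    (a ≠ j.castLE (by decide) ∧ b ≠ j.castLE (by decide) ∧ c ≠ j.castLE (by decide)) ∨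
      (a ≠ j.natAdd 5 ∧ b ≠ j.natAdd 5 ∧ c ≠ j.natAdd 5) := by
  decide +kernel

theorem base_castLE_natAdd : ∀ j : Fin 5,
    base (j.castLE (by decide)) = j ∧ base (j.natAdd 5) = j := by decide

/-- The coefficients of weight two are the same at `l` and at `l*`. A relation carried by three
foliations thus has zero rows at four underlying indices, and vanishes by `fullRank_coefEqn`. -/
theorem eq_zero_of_coefComb {S : Finset (Fin 10)} (hS : S.card = 3) {γ : Fin 5 → ℂ}
    (h : ∀ l ∉ S, coefComb γ l = 0) : γ = 0 := by
  obtain ⟨a, b, c, -, -, -, rfl⟩ := Finset.card_eq_three.1 hS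
  obtain ⟨i, hi⟩ := exists_base_cover a b c
  refine eq_zero_of_fullRank (fullRank_coefEqn i) (by norm_num) ?_
  rintro ⟨j, s⟩ hj
  have hne : j ≠ i := by
    obtain ⟨a, ha, hj⟩ := List.mem_flatMap.1 hj
    have h1 : a ≠ i := by simpa using (List.mem_filter.1 ha).2
    have h2 : j = a := by
      simp only [List.mem_cons, Prod.mk.injEq, List.not_mem_nil, or_false] at hj
      rcases hj with hj | hj | hj <;> exact hj.1
    rwa [h2]
  obtain ⟨l, hl, rfl⟩ : ∃ l ∉ ({a, b, c} : Finset (Fin 10)), base l = j := by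
    simp only [Finset.mem_insert, Finset.mem_singleton, not_or]
    rcases hi j hne with h | h
    · exact ⟨_, ⟨h.1.symm, h.2.1.symm, h.2.2.symm⟩, (base_castLE_natAdd j).1⟩
    · exact ⟨_, ⟨h.1.symm, h.2.1.symm, h.2.2.symm⟩, (base_castLE_natAdd j).2⟩
  obtain ⟨p, rfl⟩ := pair_surjective s
  refine Eq.trans ?_ (congrFun (h l hl) p)
  exact Finset.sum_congr rfl fun _ _ => mul_comm _ _

theorem IsLogDet.subAR0_eq (hD : IsConnected (D : Set C5)) (hL : IsLogDet (D : Set C5) L)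
    {S : Finset (Fin 10)} (hS : S.card = 3) : subAR0 D S = (linRelOn S).map hL.rel1 := by
  refine le_antisymm (Submodule.span_le.2 ?_) ?_
  · rintro x ⟨f, hf, rfl⟩
    obtain ⟨β, γ, h⟩ := hL.exists_rel hD ((K0 D).mkQ f)
    have h1 (l : Fin 10) (hl : l ∉ S) := hL.eq_zero_of_d0_apply hD.nonempty β γ (l := l) (by
      rw [h]
      funext y
      have h2 : f.1 l =ᶠ[nhds (y : C5)] fun _ => (0 : ℂ) :=
        Filter.eventuallyEq_of_mem (D.isOpen.mem_nhds y.2) (hf l hl)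
      exact h2.fderiv_eq.trans (fderiv_const_apply 0))
    rw [eq_zero_of_coefComb hS fun l hl => (h1 l hl).2, map_zero, add_zero] at h
    exact ⟨β, fun l hl => (h1 l hl).1, h⟩
  · rintro _ ⟨α, hα, rfl⟩
    refine Submodule.subset_span ⟨⟨logFun L (linPoly α), hL.linPoly_mem α.2⟩, fun l hl y _ => ?_, rfl⟩
    have h0 : (α : Fin 10 → Fin 3 → ℂ) l = 0 := hα l hl
    simp [logFun, linPoly, h0]

theorem IsLogDet.finrank_subAR0 (hD : IsConnected (D : Set C5)) (hL : IsLogDet (D : Set C5) L)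
    {S : Finset (Fin 10)} (hS : S.card = 3) :
    Module.finrank ℂ (subAR0 D S) = Module.finrank ℂ (linRelOn S) := by
  rw [hL.subAR0_eq hD hS]
  exact (Submodule.equivMapOfInjective hL.rel1 (hL.rel1_injective hD) (linRelOn S)).finrank_eq.symm

/-! ### Linear relations of the 3-subwebs -/

/-- Equations for the relations of the subweb with indices `σ 0`, `σ 1`, `σ 2`: the equations of
`linRel`, then the vanishing of a coefficient. -/
def subEqn (σ : Fin 3 → Fin 10) (i : Fin 10 ⊕ Fin 3) (j : Fin (3 * 3)) : ℤ :=
  match i with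
  | .inl k => expo (σ j.divNat) j.modNat k
  | .inr s => if j.divNat = 0 ∧ j.modNat = s then 1 else 0

theorem sum_eq_of_support {M : Type*} [AddCommMonoid M] {σ : Fin 3 → Fin 10}
    (hσ : Function.Injective σ) {F : Fin 10 → M} (h : ∀ l, (∀ a, σ a ≠ l) → F l = 0) :
    ∑ l, F l = ∑ a, F (σ a) := by
  rw [← Finset.sum_image (f := F) fun a _ b _ hab => hσ hab]
  refine (Finset.sum_subset (Finset.subset_univ _) fun l _ hl => h l fun a ha => hl ?_).symm
  exact Finset.mem_image.2 ⟨a, Finset.mem_univ a, ha⟩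

theorem eq_zero_of_subEqn {σ : Fin 3 → Fin 10} (hσ : Function.Injective σ) {I : List (Fin 3)}
    (hI : fullRank ((List.finRange 10).map .inl ++ I.map .inr) (subEqn σ) = true)
    {α : Fin 10 → Fin 3 → ℂ} (hα : α ∈ linRel) (h : ∀ l, (∀ a, σ a ≠ l) → α l = 0)
    (h0 : ∀ s ∈ I, α (σ 0) s = 0) : α = 0 := by
  have h1 : (fun j : Fin (3 * 3) => α (σ j.divNat) j.modNat) = 0 := by
    refine eq_zero_of_fullRank hI (by norm_num) fun i hi => ?_
    rcases i with k | s
    · simp only [subEqn]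
      rw [sum_divNat_modNat fun a s => (expo (σ a) s k : ℂ) * α (σ a) s, ← hα k,
        sum_eq_of_support hσ fun l hl => by simp [h l hl]]
      simp only [mul_comm]
    · simp only [subEqn]
      rw [sum_divNat_modNat fun a t => ((if a = 0 ∧ t = s then 1 else 0 : ℤ) : ℂ) * α (σ a) t,
        Finset.sum_eq_single 0, Finset.sum_eq_single s]
      · rw [h0 s (by simpa using hi), mul_zero]
      · intro t _ ht; simp [ht]
      · simp
      · intro a _ ha; simp [ha]
      · simp
  have h2 := eq_zero_of_divNat_modNat (α := fun a => α (σ a)) h1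
  funext l
  by_cases hl : ∀ a, σ a ≠ l
  · exact h l hl
  · push Not at hl
    obtain ⟨a, rfl⟩ := hl
    exact congrFun h2 a

/-- The roots appearing in the relations of weight one of the 3-subwebs. -/
def rootTable : Fin 12 → Fin 3 → ℤ :=
  ![![1, 0, 0], ![-1, 0, 0], ![0, 1, 0], ![0, -1, 0], ![0, 0, 1], ![0, 0, -1], ![1, -1, 0],
    ![-1, 1, 0], ![1, 0, -1], ![-1, 0, 1], ![0, 1, -1], ![0, -1, 1]]

/-- A nonzero coordinate of each root. -/
def rootPivot : Fin 12 → Fin 3 := ![0, 0, 1, 1, 2, 2, 0, 0, 0, 0, 1, 1]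

/-- The relations of weight one of the 80 subwebs formed by three foliations with different
underlying indices. -/
def subTable : Fin 10 → Fin 8 → Fin 3 → Fin 12 :=
  ![![![7, 6, 7], ![4, 5, 7], ![5, 6, 4], ![6, 5, 4],
      ![6, 5, 4], ![5, 6, 4], ![4, 5, 7], ![7, 6, 7]],
    ![![1, 0, 7], ![11, 10, 7], ![10, 0, 4], ![0, 10, 4],
      ![0, 10, 4], ![10, 0, 4], ![11, 10, 7], ![1, 0, 7]],
    ![![3, 2, 7], ![9, 8, 7], ![8, 8, 4], ![2, 2, 4],
      ![8, 8, 4], ![2, 2, 4], ![3, 2, 7], ![9, 8, 7]],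
    ![![2, 1, 0], ![8, 11, 0], ![8, 0, 11], ![2, 10, 11],
      ![2, 10, 11], ![8, 0, 11], ![8, 11, 0], ![2, 1, 0]],
    ![![0, 3, 0], ![10, 9, 0], ![10, 8, 11], ![0, 2, 11],
      ![10, 8, 11], ![0, 2, 11], ![0, 3, 0], ![10, 9, 0]],
    ![![6, 3, 2], ![4, 8, 9], ![5, 8, 9], ![7, 3, 2],
      ![5, 8, 9], ![7, 3, 2], ![6, 3, 2], ![4, 8, 9]],
    ![![2, 3, 2], ![8, 9, 2], ![8, 2, 9], ![2, 8, 9],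
      ![2, 8, 9], ![8, 2, 9], ![8, 9, 2], ![2, 3, 2]],
    ![![0, 1, 2], ![10, 11, 2], ![10, 10, 9], ![0, 0, 9],
      ![10, 10, 9], ![0, 0, 9], ![0, 1, 2], ![10, 11, 2]],
    ![![6, 1, 0], ![4, 10, 11], ![5, 10, 11], ![7, 1, 0],
      ![5, 10, 11], ![7, 1, 0], ![6, 1, 0], ![4, 10, 11]],
    ![![7, 6, 7], ![4, 5, 4], ![5, 5, 4], ![6, 6, 7],
      ![5, 5, 4], ![6, 6, 7], ![7, 6, 7], ![4, 5, 4]]]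

/-- The indices of the 80 subwebs. -/
def subIdx (τ : Fin 10) (e : Fin 8) (a : Fin 3) : Fin 10 :=
  Fin.ofNat 10 (tripleArr τ a.castSucc.castSucc + 5 * ((![![0, 0, 0], ![0, 0, 1], ![0, 1, 0],
    ![0, 1, 1], ![1, 0, 0], ![1, 0, 1], ![1, 1, 0], ![1, 1, 1]] : Fin 8 → Fin 3 → ℕ) e a))

/-- The 80 subwebs. -/
def subSet (τ : Fin 10) (e : Fin 8) : Finset (Fin 10) := {subIdx τ e 0, subIdx τ e 1, subIdx τ e 2}

/-- The relations of weight one of the 80 subwebs. -/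
def subVec (τ : Fin 10) (e : Fin 8) (l : Fin 10) (s : Fin 3) : ℤ :=
  ∑ a, if l = subIdx τ e a then rootTable (subTable τ e a) s else 0

theorem rootTable_expo : ∀ τ e k,
    ∑ a, ∑ s, rootTable (subTable τ e a) s * expo (subIdx τ e a) s k = 0 := by
  decide +kernel

theorem subVec_expo (τ : Fin 10) (e : Fin 8) (k : Fin 10) :
    ∑ l, ∑ s, subVec τ e l s * expo l s k = 0 := by
  have h (l : Fin 10) : ∑ s, subVec τ e l s * expo l s k =
      ∑ a, if l = subIdx τ e a then ∑ s, rootTable (subTable τ e a) s * expo l s k else 0 := by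
    simp only [subVec, Finset.sum_mul, ite_mul, zero_mul]
    rw [Finset.sum_comm]
    refine Finset.sum_congr rfl fun a _ => ?_
    split_ifs <;> simp
  rw [← rootTable_expo τ e k, Finset.sum_congr rfl fun l _ => h l, Finset.sum_comm]
  simp

theorem subVec_pivot : ∀ τ e, subVec τ e (subIdx τ e 0) (rootPivot (subTable τ e 0)) ≠ 0 := by
  decide +kernel

theorem subVec_support : ∀ τ e, ∀ l ∉ subSet τ e, ∀ s, subVec τ e l s = 0 := by
  decide +kernel

/-- Prescribing one coefficient to be zero leaves only the zero solution, so the space of relations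
has dimension at most one; `subVec` provides a nonzero element. -/
theorem fullRank_subSet : ∀ τ e, fullRank ((List.finRange 10).map .inl ++
    [rootPivot (subTable τ e 0)].map .inr) (subEqn (subIdx τ e)) = true := by
  decide +kernel

/-- When both `i` and `i*` occur, the ten exponent equations alone have rank 9: no linear relation
exists. -/
theorem fullRank_pair : ∀ i : Fin 5, ∀ c : Fin 10,
    Function.Injective ![i.castLE (by decide), i.natAdd 5, c] →
    fullRank ((List.finRange 10).map .inl ++ ([] : List (Fin 3)).map .inr)
      (subEqn ![i.castLE (by decide), i.natAdd 5, c]) = true := by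
  decide +kernel

theorem subIdx_injective : ∀ τ e, Function.Injective (subIdx τ e) := by
  decide +kernel

theorem exists_subIdx : ∀ a b c : Fin 10, base a ≠ base b → base a ≠ base c → base b ≠ base c →
    ∃ τ, (base a ∈ (triple τ).1 ∧ base b ∈ (triple τ).1 ∧ base c ∈ (triple τ).1) ∧ ∃ e,
      (a = subIdx τ e 0 ∨ a = subIdx τ e 1 ∨ a = subIdx τ e 2) ∧
      (b = subIdx τ e 0 ∨ b = subIdx τ e 1 ∨ b = subIdx τ e 2) ∧
      (c = subIdx τ e 0 ∨ c = subIdx τ e 1 ∨ c = subIdx τ e 2) := by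
  decide +kernel

theorem eq_castLE_natAdd : ∀ a b : Fin 10, a ≠ b → base a = base b → ∃ i : Fin 5,
    (a = i.castLE (by decide) ∧ b = i.natAdd 5) ∨ (a = i.natAdd 5 ∧ b = i.castLE (by decide)) := by
  decide +kernel

theorem card_subSet : ∀ τ e, (subSet τ e).card = 3 := by decide +kernel

theorem subSet_injOn : ∀ τ e, ∀ a ∈ subSet τ e, ∀ b ∈ subSet τ e, base a = base b → a = b := by
  decide +kernel

/-- The relation of weight one of a subweb, as an element of `linRel`. -/
def subRel (τ : Fin 10) (e : Fin 8) : linRel :=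
  ⟨fun l s => (subVec τ e l s : ℂ), fun k => by
    have := congrArg (fun n : ℤ => (n : ℂ)) (subVec_expo τ e k)
    push_cast at this
    exact this⟩

theorem subRel_mem (τ : Fin 10) (e : Fin 8) : subRel τ e ∈ linRelOn (subSet τ e) := fun l hl => by
  funext s
  change (subVec τ e l s : ℂ) = 0
  rw [subVec_support τ e l hl s, Int.cast_zero]

theorem finrank_linRelOn_subSet (τ : Fin 10) (e : Fin 8) :
    Module.finrank ℂ (linRelOn (subSet τ e)) = 1 := by
  set l₀ := subIdx τ e 0
  set s₀ := rootPivot (subTable τ e 0)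
  have hp : (subVec τ e l₀ s₀ : ℂ) ≠ 0 := Int.cast_ne_zero.2 (subVec_pivot τ e)
  refine finrank_eq_one (⟨subRel τ e, subRel_mem τ e⟩ : linRelOn (subSet τ e)) ?_ ?_
  · intro h
    exact hp (congrFun (congrFun (congrArg (fun x : linRelOn (subSet τ e) =>
      (x.1 : Fin 10 → Fin 3 → ℂ)) h) l₀) s₀)
  · rintro ⟨α, hα⟩
    refine ⟨(α : Fin 10 → Fin 3 → ℂ) l₀ s₀ / subVec τ e l₀ s₀, Subtype.ext ?_⟩
    set c := (α : Fin 10 → Fin 3 → ℂ) l₀ s₀ / subVec τ e l₀ s₀ with hc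
    change c • subRel τ e = α
    have hm := Submodule.sub_mem _ (Submodule.smul_mem _ c (subRel_mem τ e)) hα
    refine sub_eq_zero.1 (Subtype.ext (eq_zero_of_subEqn (subIdx_injective τ e)
      (fullRank_subSet τ e) (Subtype.prop _) (fun l hl => hm l ?_) fun s hs => ?_))
    · simp only [subSet, Finset.mem_insert, Finset.mem_singleton, not_or]
      exact ⟨(hl 0).symm, (hl 1).symm, (hl 2).symm⟩
    · rw [List.mem_singleton.1 hs]
      change c * (subVec τ e l₀ s₀ : ℂ) - (α : Fin 10 → Fin 3 → ℂ) l₀ s₀ = 0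
      rw [hc, div_mul_cancel₀ _ hp, sub_self]

theorem linRelOn_eq_bot {a b c : Fin 10} (hab : a ≠ b) (hac : a ≠ c) (hbc : b ≠ c)
    (h : base a = base b) : linRelOn {a, b, c} = ⊥ := by
  have key (i : Fin 5) (hi : Function.Injective ![i.castLE (by decide), i.natAdd 5, c]) :
      linRelOn {i.castLE (by decide), i.natAdd 5, c} = ⊥ := by
    rw [Submodule.eq_bot_iff]
    refine fun α hα => Subtype.ext (eq_zero_of_subEqn hi (fullRank_pair i c hi) α.2
      (fun l hl => hα l ?_) fun s hs => absurd hs List.not_mem_nil)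
    simp only [Finset.mem_insert, Finset.mem_singleton, not_or]
    exact ⟨(hl 0).symm, (hl 1).symm, (hl 2).symm⟩
  have inj {x y z : Fin 10} (hxy : x ≠ y) (hxz : x ≠ z) (hyz : y ≠ z) :
      Function.Injective ![x, y, z] := by
    intro i j hij
    fin_cases i <;> fin_cases j <;> first | rfl | skip
    · exact absurd hij hxy
    · exact absurd hij hxz
    · exact absurd hij hxy.symm
    · exact absurd hij hyz
    · exact absurd hij hxz.symm
    · exact absurd hij hyz.symm
  obtain ⟨i, ⟨rfl, rfl⟩ | ⟨rfl, rfl⟩⟩ := eq_castLE_natAdd a b hab h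
  · exact key i (inj hab hac hbc)
  · rw [Finset.insert_comm]
    exact key i (inj hab.symm hbc hac)

theorem subweb_cases {S : Finset (Fin 10)} (hS : S.card = 3) :
    ((∀ a ∈ S, ∀ b ∈ S, base a = base b → a = b) ∧ ∃ τ e, S = subSet τ e) ∨
      (¬(∀ a ∈ S, ∀ b ∈ S, base a = base b → a = b) ∧ linRelOn S = ⊥) := by
  obtain ⟨a, b, c, hab, hac, hbc, rfl⟩ := Finset.card_eq_three.1 hS
  have ha : a ∈ ({a, b, c} : Finset (Fin 10)) := by simp
  have hb : b ∈ ({a, b, c} : Finset (Fin 10)) := by simp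
  have hc : c ∈ ({a, b, c} : Finset (Fin 10)) := by simp
  by_cases h1 : base a = base b
  · exact Or.inr ⟨fun h => hab (h a ha b hb h1), linRelOn_eq_bot hab hac hbc h1⟩
  by_cases h2 : base a = base c
  · refine Or.inr ⟨fun h => hac (h a ha c hc h2), ?_⟩
    rw [Finset.pair_comm b c]
    exact linRelOn_eq_bot hac hab hbc.symm h2
  by_cases h3 : base b = base c
  · refine Or.inr ⟨fun h => hbc (h b hb c hc h3), ?_⟩
    rw [Finset.insert_comm a b, Finset.pair_comm a c]
    exact linRelOn_eq_bot hbc hab.symm hac.symm h3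
  obtain ⟨τ, -, e, h⟩ := exists_subIdx a b c h1 h2 h3
  have hS' : {a, b, c} = subSet τ e := by
    refine Finset.eq_of_subset_of_card_le ?_ (by rw [hS, card_subSet])
    intro x hx
    simp only [Finset.mem_insert, Finset.mem_singleton] at hx
    simp only [subSet, Finset.mem_insert, Finset.mem_singleton]
    rcases hx with rfl | rfl | rfl
    · exact h.1
    · exact h.2.1
    · exact h.2.2
  exact Or.inl ⟨by rw [hS']; exact subSet_injOn τ e, τ, e, hS'⟩

/-! ### Generation of the relations of weight one -/

/-- Linearly independent relations of weight one generate. -/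
theorem IsLogDet.WAR0_one_le (hD : IsConnected (D : Set C5)) (hL : IsLogDet (D : Set C5) L)
    {v : Fin 20 → Fin 10 → Fin 3 → ℤ} (hv : ∀ i, (fun l s => (v i l s : ℂ)) ∈ linRel)
    (hr : fullRank (List.finRange (10 * 3)) (fun j i => v i j.divNat j.modNat) = true)
    {W : Submodule ℂ (AR0 D)} (hW : ∀ i, hL.rel1 ⟨_, hv i⟩ ∈ W) : WAR0 D L 1 ≤ W := by
  rw [hL.WAR0_one hD]
  have hli : LinearIndependent ℂ fun i => (⟨_, hv i⟩ : linRel) := by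
    rw [Fintype.linearIndependent_iff]
    intro g hg
    refine congrFun (eq_zero_of_fullRank hr (by norm_num) fun j _ => ?_)
    have h1 := congrFun (congrFun (congrArg (linRel.subtype) hg) j.divNat) j.modNat
    rw [map_sum, Finset.sum_apply, Finset.sum_apply, map_zero, Pi.zero_apply, Pi.zero_apply] at h1
    rw [← h1]
    exact Finset.sum_congr rfl fun i _ => mul_comm _ _
  have htop := hli.span_eq_top_of_card_eq_finrank' (by
    rw [(hL.rel_bijective hD).2, Fintype.card_fin])
  rintro _ ⟨β, rfl⟩
  have hβ : β ∈ Submodule.span ℂ (Set.range fun i => (⟨_, hv i⟩ : linRel)) := by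
    rw [htop]; trivial
  have h2 : Submodule.span ℂ (Set.range fun i => (⟨_, hv i⟩ : linRel)) ≤ W.comap hL.rel1 := by
    rw [Submodule.span_le]
    rintro _ ⟨i, rfl⟩
    exact hW i
  exact h2 hβ

theorem subAR0_le (hD : IsConnected (D : Set C5)) (hL : IsLogDet (D : Set C5) L)
    {S : Finset (Fin 10)} (hS : S.card = 3) : subAR0 D S ≤ WAR0 D L 1 := by
  rw [hL.subAR0_eq hD hS, hL.WAR0_one hD]
  exact LinearMap.map_le_range

/-- Twenty of the 80 subwebs with independent relations. -/
def subBasis : Fin 20 → Fin 10 × Fin 8 :=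
  ![(0, 0), (0, 1), (0, 2), (0, 3), (0, 4), (0, 5), (1, 0), (1, 1), (1, 2), (1, 3), (1, 4), (2, 0),
    (2, 1), (2, 2), (2, 3), (3, 0), (3, 1), (3, 2), (4, 0), (4, 1)]

theorem fullRank_subBasis : fullRank (List.finRange (10 * 3))
    (fun j i => subVec (subBasis i).1 (subBasis i).2 j.divNat j.modNat) = true := by
  decide +kernel

theorem card_subwebs : ((Finset.powersetCard 3 (Finset.univ : Finset (Fin 10))).filter fun S =>
    ∀ a ∈ S, ∀ b ∈ S, base a = base b → a = b).card = 80 := by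
  decide +kernel

theorem IsLogDet.subwebs (hD : IsConnected (D : Set C5)) (hL : IsLogDet (D : Set C5) L) :
    (∀ S : Finset (Fin 10), S.card = 3 → Module.finrank ℂ (subAR0 D S) ≤ 1) ∧
      (∀ S : Finset (Fin 10), S.card = 3 →
        (Module.finrank ℂ (subAR0 D S) = 1 ↔ Set.InjOn base (S : Set (Fin 10)))) ∧
      {S : Finset (Fin 10) | S.card = 3 ∧ Module.finrank ℂ (subAR0 D S) = 1}.ncard = 80 ∧
      (∀ S : Finset (Fin 10), S.card = 3 → Module.finrank ℂ (subAR0 D S) = 1 →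
        subAR0 D S ≤ WAR0 D L 1) ∧
      (⨆ S ∈ {S : Finset (Fin 10) | S.card = 3 ∧ Module.finrank ℂ (subAR0 D S) = 1},
        subAR0 D S) = WAR0 D L 1 := by
  have key (S : Finset (Fin 10)) (hS : S.card = 3) :
      ((∀ a ∈ S, ∀ b ∈ S, base a = base b → a = b) ∧ Module.finrank ℂ (subAR0 D S) = 1) ∨
      (¬(∀ a ∈ S, ∀ b ∈ S, base a = base b → a = b) ∧ Module.finrank ℂ (subAR0 D S) = 0) := by
    rw [hL.finrank_subAR0 hD hS]
    rcases subweb_cases hS with ⟨h1, τ, e, rfl⟩ | ⟨h1, h2⟩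
    · exact Or.inl ⟨h1, finrank_linRelOn_subSet τ e⟩
    · exact Or.inr ⟨h1, by rw [h2, finrank_bot]⟩
  have key2 (S : Finset (Fin 10)) (hS : S.card = 3) : Module.finrank ℂ (subAR0 D S) = 1 ↔
      ∀ a ∈ S, ∀ b ∈ S, base a = base b → a = b := by
    rcases key S hS with ⟨h1, h2⟩ | ⟨h1, h2⟩
    · exact iff_of_true h2 h1
    · exact iff_of_false (by omega) h1
  refine ⟨fun S hS => ?_, fun S hS => ?_, ?_, fun S hS _ => subAR0_le hD hL hS, le_antisymm ?_ ?_⟩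
  · rcases key S hS with h | h <;> omega
  · exact (key2 S hS).trans ⟨fun h a ha b hb => h a ha b hb, fun h a ha b hb => h ha hb⟩
  · rw [← card_subwebs, ← Set.ncard_coe_finset]
    congr 1
    ext S
    rw [Finset.mem_coe, Finset.mem_filter, Finset.mem_powersetCard]
    exact ⟨fun h => ⟨⟨Finset.subset_univ S, h.1⟩, (key2 S h.1).1 h.2⟩,
      fun h => ⟨h.1.2, (key2 S h.1.2).2 h.2⟩⟩
  · exact iSup₂_le fun S hS => subAR0_le hD hL hS.1
  · refine hL.WAR0_one_le hD (fun i => (subRel (subBasis i).1 (subBasis i).2).2) fullRank_subBasis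
      fun i => ?_
    have hc := card_subSet (subBasis i).1 (subBasis i).2
    have hm : subSet (subBasis i).1 (subBasis i).2 ∈
        {S : Finset (Fin 10) | S.card = 3 ∧ Module.finrank ℂ (subAR0 D S) = 1} :=
      ⟨hc, by rw [hL.finrank_subAR0 hD hc, finrank_linRelOn_subSet]⟩
    refine le_iSup₂_of_le (f := fun S _ => subAR0 D S) _ hm le_rfl ?_
    rw [hL.subAR0_eq hD hc]
    exact Submodule.mem_map_of_mem (subRel_mem _ _)

end

end GMWeb

namespace GMWeb

open MvPolynomial

noncomputable section

variable {D : TopologicalSpace.Opens C5} {L : Fin 10 → C5 → ℂ}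

/-! ### Valuations along the hypersurfaces `ζ_k = 0` -/

theorem aeval_update_X {ι : Type*} [DecidableEq ι] {a b c : ι} (hb : b ≠ a) (hc : c ≠ a)
    (r : MvPolynomial ι ℂ) : aeval (Function.update X a r) (1 - X b * X c : MvPolynomial ι ℂ) =
      1 - X b * X c := by
  simp [hb, hc]

/-- The elementary automorphism `x_a ↦ 1 + x_a - x_b x_c`. -/
def shear {ι : Type*} [DecidableEq ι] {a b c : ι} (hb : b ≠ a) (hc : c ≠ a) :
    MvPolynomial ι ℂ ≃ₐ[ℂ] MvPolynomial ι ℂ :=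
  AlgEquiv.ofAlgHom (aeval (Function.update X a (X a + (1 - X b * X c))))
    (aeval (Function.update X a (X a - (1 - X b * X c))))
    (by
      refine algHom_ext fun i => ?_
      by_cases hi : i = a
      · subst hi
        rw [AlgHom.comp_apply, aeval_X, Function.update_self, map_sub, aeval_X,
          Function.update_self, aeval_update_X hb hc, AlgHom.id_apply, add_sub_cancel_right]
      · simp [hi])
    (by
      refine algHom_ext fun i => ?_
      by_cases hi : i = a
      · subst hi
        rw [AlgHom.comp_apply, aeval_X, Function.update_self, map_add, aeval_X,
          Function.update_self, aeval_update_X hb hc, AlgHom.id_apply, sub_add_cancel]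
      · simp [hi])

/-- An elementary automorphism of the polynomial ring carries a variable, which is prime, to this
polynomial. -/
theorem prime_one_add_X_sub {ι : Type*} [DecidableEq ι] {a b c : ι} (hb : b ≠ a) (hc : c ≠ a) :
    Prime (1 + X a - X b * X c : MvPolynomial ι ℂ) := by
  have h : shear hb hc (X a) = 1 + X a - X b * X c := by
    change aeval _ (X a) = _
    rw [aeval_X, Function.update_self]
    ring
  rw [← h]
  exact (MulEquiv.prime_iff (shear hb hc).toMulEquiv).2 X_prime

theorem prime_zetaPoly (k : Fin 10) : Prime (zetaPoly k) := by
  fin_cases k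
  iterate 5 exact X_prime
  all_goals exact prime_one_add_X_sub (by decide) (by decide)

/-- If the second order were larger, equating the two expressions would give `F ^ (d + 1) * p' * q =
p * q'`, and the prime `F` would divide `p` or `q'`. -/
theorem IsOrd.le {F : MvPolynomial (Fin 5) ℂ} (hF : Prime F) {V : C5 → ℂ} {m n : ℤ}
    (hm : IsOrd F V m) (hn : IsOrd F V n) : n ≤ m := by
  by_contra! hlt
  obtain ⟨p, q, hp, hq, h⟩ := hm
  obtain ⟨p', q', hp', hq', h'⟩ := hn
  obtain ⟨d, hd⟩ : ∃ d : ℕ, n = m + ((d + 1 : ℕ) : ℤ) := ⟨(n - m - 1).toNat, by omega⟩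
  -- The factor `F * q * q'` makes the identity true also at the points where the quotients are
  -- meaningless; it is cancelled afterwards in the polynomial ring.
  have key : F * q * q' * (F ^ (d + 1) * p' * q - p * q') = 0 := by
    refine MvPolynomial.funext fun y => ?_
    simp only [map_mul, map_sub, map_pow, map_zero]
    by_cases h1 : eval y F = 0
    · rw [h1]; ring
    by_cases h2 : eval y q = 0
    · rw [h2]; ring
    by_cases h3 : eval y q' = 0
    · rw [h3]; ring
    have h4 := (h y h1 h2).symm.trans (h' y h1 h3)
    rw [hd, zpow_add₀ h1, mul_assoc, zpow_natCast] at h4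
    have h5 := mul_left_cancel₀ (zpow_ne_zero m h1) h4
    field_simp at h5
    rw [h5]
    ring
  have h0 : q ≠ 0 := fun h => hq (h ▸ dvd_zero F)
  have h0' : q' ≠ 0 := fun h => hq' (h ▸ dvd_zero F)
  have h1 := (mul_eq_zero.1 key).resolve_left (mul_ne_zero (mul_ne_zero hF.ne_zero h0) h0')
  have h2 : F ∣ p * q' := by
    rw [← sub_eq_zero.1 h1, mul_assoc, pow_succ, mul_assoc, mul_left_comm]
    exact dvd_mul_right F _
  exact (hF.dvd_or_dvd h2).elim hp hq'

theorem IsOrd.ord_eq {F : MvPolynomial (Fin 5) ℂ} (hF : Prime F) {V : C5 → ℂ} {n : ℤ}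
    (h : IsOrd F V n) : ord F V = n :=
  have h' : IsOrd F V (ord F V) := Classical.epsilon_spec ⟨n, h⟩
  le_antisymm (h.le hF h') (h'.le hF h)

/-- A point of the hypersurface `ζ_k = 0` outside the nine other ones. -/
def zetaPoint : Fin 10 → C5 :=
  ![![0, 1, 1, 1, 3], ![1, 0, 2, 1, 2], ![1, 1, 0, 3, 1], ![1, 1, 1, 0, 3], ![1, 1, 1, 3, 0],
    ![1, 3, 1, 1, 2], ![1, 1, 3, 1, 2], ![1, 2, 1, 1, 3], ![1, 3, 1, 2, 1], ![1, 1, 2, 1, 3]]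

theorem zeta_zetaPoint_self (k : Fin 10) : zeta k (zetaPoint k) = 0 := by
  fin_cases k <;> simp [zeta, zetaPoly, zetaPoint] <;> norm_num

theorem zeta_zetaPoint_of_ne (k j : Fin 10) (h : j ≠ k) : zeta j (zetaPoint k) ≠ 0 := by
  fin_cases k <;> fin_cases j <;>
    first | exact absurd rfl h | (simp [zeta, zetaPoly, zetaPoint] <;> norm_num)

theorem not_zetaPoly_dvd (k : Fin 10) (e : Fin 10 → ℕ) :
    ¬ zetaPoly k ∣ ∏ j ∈ Finset.univ.erase k, zetaPoly j ^ e j := fun ⟨r, hr⟩ => by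
  have h := congrArg (eval (zetaPoint k)) hr
  rw [map_mul, map_prod, show eval (zetaPoint k) (zetaPoly k) = 0 from zeta_zetaPoint_self k,
    zero_mul] at h
  refine Finset.prod_ne_zero_iff.2 (fun j hj => ?_) h
  rw [map_pow]
  exact pow_ne_zero _ (zeta_zetaPoint_of_ne k j (Finset.ne_of_mem_erase hj))

theorem isOrd_U (k l : Fin 10) (s : Fin 3) : IsOrd (zetaPoly k) (U l s) (expo l s k) := by
  -- The added 1 in both exponents cancels in the quotient. It ensures that every other `ζ_j`
  -- divides the denominator, so that its non-vanishing places `y` in `Ystar`.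
  refine ⟨∏ j ∈ Finset.univ.erase k, zetaPoly j ^ ((expo l s j).toNat + 1),
    ∏ j ∈ Finset.univ.erase k, zetaPoly j ^ ((-expo l s j).toNat + 1),
    not_zetaPoly_dvd k _, not_zetaPoly_dvd k _, fun y hk hq => ?_⟩
  rw [map_prod, Finset.prod_ne_zero_iff] at hq
  have hy : y ∈ Ystar := fun j => by
    by_cases hj : j = k
    · rwa [hj]
    · have := hq j (Finset.mem_erase.2 ⟨hj, Finset.mem_univ j⟩)
      rw [map_pow] at this
      exact fun h => this (by rw [show eval y (zetaPoly j) = 0 from h, zero_pow (by omega)])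
  rw [U_eq_prod hy, ← Finset.mul_prod_erase _ _ (Finset.mem_univ k), map_prod, map_prod,
    ← Finset.prod_div_distrib]
  refine congrArg (zeta k y ^ expo l s k * ·) (Finset.prod_congr rfl fun j _ => ?_)
  rw [map_pow, map_pow, ← zpow_natCast, ← zpow_natCast,
    show eval y (zetaPoly j) = zeta j y from rfl, ← zpow_sub₀ (hy j)]
  congr 1
  omega

theorem ord_U (k l : Fin 10) (s : Fin 3) : ord (zetaPoly k) (U l s) = expo l s k :=
  (isOrd_U k l s).ord_eq (prime_zetaPoly k)

end

end GMWeb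

namespace GMWeb

open MvPolynomial

noncomputable section

variable {D : TopologicalSpace.Opens C5} {L : Fin 10 → C5 → ℂ}

/-! ### Residues -/

/-- The coefficients of the residues of the relations of weight two. -/
def resCoef (k τ l : Fin 10) : Fin 3 → ℤ :=
  ![coefTable τ (base l) 0 * expo l 1 k + coefTable τ (base l) 1 * expo l 2 k,
    coefTable τ (base l) 0 * expo l 0 k + coefTable τ (base l) 2 * expo l 2 k,
    coefTable τ (base l) 1 * expo l 0 k + coefTable τ (base l) 2 * expo l 1 k]

theorem res_quad (k τ : Fin 10) :
    res k (quad (coef τ)) = linPoly fun l s => (resCoef k τ l s : ℂ) := by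
  funext l
  simp only [res, ord_U, quad, linPoly, LinearMap.coe_mk, AddHom.coe_mk, sum_pair,
    Fin.sum_univ_three, resCoef, coef]
  rw [show ((1 : Fin 3) + 2 - 1) = 2 by decide]
  generalize coefTable τ (base l) = c
  generalize expo l 0 k = e₀
  generalize expo l 1 k = e₁
  generalize expo l 2 k = e₂
  simp [pderiv_X]
  ring

/-- The residue is a derivation with constant coefficients; it commutes with the differential
because partial derivatives commute. -/
theorem resForm_dquad (k : Fin 10) (c : Fin 10 → Pair → ℤ) :
    resForm k (dquad c) = fun l s => pderiv s (res k (quad c) l) := by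
  funext l s
  simp only [resForm, dquad, res, map_sum, pderiv_C_mul]
  exact Finset.sum_congr rfl fun t _ => by rw [pderiv_pderiv_comm]

/-- As `ν_{ζ_k}(U_{l,s})` is the coefficient of `Log ζ_k` in `Log U_{l,s}`, the residue
differentiates a formal quadratic identity with respect to `Log ζ_k`; what it gives is a formal
linear identity. -/
theorem sum_resCoef_expo : ∀ k τ m, ∑ l, ∑ s, resCoef k τ l s * expo l s m = 0 := by
  decide +kernel

theorem resCoef_mem (k τ : Fin 10) : (fun l s => (resCoef k τ l s : ℂ)) ∈ linRel := fun m => by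
  have := congrArg (fun n : ℤ => (n : ℂ)) (sum_resCoef_expo k τ m)
  push_cast at this
  exact this

theorem IsLogDet.isLogClass_res (hL : IsLogDet (D : Set C5) L) (k τ : Fin 10) :
    IsLogClass D L (res k (quad (coef τ))) (hL.rel1 ⟨_, resCoef_mem k τ⟩) := by
  rw [res_quad]
  exact hL.isLogClass_rel1 ⟨_, resCoef_mem k τ⟩

/-- Twenty independent residues. -/
def resBasis : Fin 20 → Fin 10 × Fin 10 :=
  ![(0, 0), (0, 1), (0, 2), (0, 3), (0, 4), (1, 0), (1, 1), (1, 3), (1, 4), (2, 0), (2, 1), (2, 3),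
    (2, 4), (3, 1), (3, 2), (3, 3), (3, 4), (4, 0), (4, 1), (4, 2)]

theorem fullRank_resBasis : fullRank (List.finRange (10 * 3))
    (fun j i => resCoef (resBasis i).1 (resBasis i).2 j.divNat j.modNat) = true := by
  decide +kernel

theorem IsLogDet.span_res (hD : IsConnected (D : Set C5)) (hL : IsLogDet (D : Set C5) L) :
    Submodule.span ℂ {x | ∃ k τ, IsLogClass D L (res k (quad (coef τ))) x} = WAR0 D L 1 := by
  refine le_antisymm (Submodule.span_le.2 ?_) ?_
  · rintro x ⟨k, τ, hx⟩
    exact Submodule.subset_span ⟨_, fun l => by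
      rw [res_quad]; exact isHomogeneous_linPoly _ l, hx⟩
  · exact hL.WAR0_one_le hD (fun i => resCoef_mem (resBasis i).1 (resBasis i).2) fullRank_resBasis
      fun i => Submodule.subset_span ⟨_, _, hL.isLogClass_res _ _⟩

theorem IsLogDet.span_resForm (hD : IsConnected (D : Set C5)) (hL : IsLogDet (D : Set C5) L) :
    Submodule.span ℂ {η | ∃ k τ, η = logForm D L (resForm k (dquad (coef τ)))} =
      (WAR0 D L 1).map (d0 D) := by
  rw [← hL.span_res hD, Submodule.map_span]
  refine congrArg (Submodule.span ℂ) (Set.ext fun η => ⟨?_, ?_⟩)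
  · rintro ⟨k, τ, rfl⟩
    refine ⟨_, ⟨k, τ, hL.isLogClass_res k τ⟩, ?_⟩
    rw [hL.d0_of_isLogClass (hL.isLogClass_res k τ), resForm_dquad]
  · rintro ⟨x, ⟨k, τ, hx⟩, rfl⟩
    exact ⟨k, τ, by rw [hL.d0_of_isLogClass hx, resForm_dquad]⟩

theorem IsLogDet.residues (hD : IsConnected (D : Set C5)) (hL : IsLogDet (D : Set C5) L) :
    ∃ c : Triple → Fin 10 → Pair → ℤ,
      (∀ t, IsAR1ijk D L t (c t) ∧ (∀ c', IsAR1ijk D L t c' → c' = c t ∨ c' = -c t)) ∧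
      (∀ t, IsIdentity D L t (c t) ∧ (∀ c', IsIdentity D L t c' → c' = c t ∨ c' = -c t)) ∧
      (∀ t, ∃ x, IsLogClass D L (quad (c t)) x ∧ d0 D x = logForm D L (dquad (c t))) ∧
      Submodule.span ℂ {x | ∃ t, IsLogClass D L (quad (c t)) x} = WAR0 D L 2 ∧
      (∀ k t, logFun L (res k (quad (c t))) ∈ Z0 D) ∧
      Submodule.span ℂ {x | ∃ k t, IsLogClass D L (res k (quad (c t))) x} = WAR0 D L 1 ∧
      Submodule.span ℂ {η | ∃ k t, η = logForm D L (resForm k (dquad (c t)))} =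
        (WAR0 D L 1).map (d0 D) := by
  -- The enumeration of the ten triples transfers the statements from the indices `τ` to the triples
  -- themselves.
  let e := Equiv.ofBijective triple triple_bijective
  have hex (P : (Fin 10 → Pair → ℤ) → Prop) : (∃ t, P (coef (e.symm t))) ↔ ∃ τ, P (coef τ) :=
    (e.symm.surjective.exists (p := fun τ => P (coef τ))).symm
  refine ⟨fun t => coef (e.symm t), fun t => ?_, fun t => ?_, fun t =>
    ⟨_, hL.isLogClass_quad _, hL.d0_of_isLogClass (hL.isLogClass_quad _)⟩, ?_,
    fun k t => (hL.isLogClass_res k _).1, ?_, ?_⟩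
  · obtain ⟨τ, rfl⟩ := triple_bijective.2 t
    beta_reduce
    rw [show e.symm (triple τ) = τ from e.symm_apply_apply τ]
    exact ⟨hL.isAR1ijk_coef τ, fun c' h => hL.isAR1ijk_unique hD h⟩
  · obtain ⟨τ, rfl⟩ := triple_bijective.2 t
    beta_reduce
    rw [show e.symm (triple τ) = τ from e.symm_apply_apply τ]
    exact ⟨isIdentity_coef D L τ, fun c' h => hL.isAR1ijk_unique hD (hL.isAR1ijk_of_isIdentity h)⟩
  · rw [← hL.span_quad hD]
    exact congrArg _ (Set.ext fun x => hex fun c => IsLogClass D L (quad c) x)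
  · rw [← hL.span_res hD]
    exact congrArg _ (Set.ext fun x => exists_congr fun k =>
      hex fun c => IsLogClass D L (res k (quad c)) x)
  · rw [← hL.span_resForm hD]
    exact congrArg _ (Set.ext fun η => exists_congr fun k =>
      hex fun c => η = logForm D L (resForm k (dquad c)))

end

end GMWeb

/-! ### Assembly of the three parts of the proposition -/

theorem mainTheorem6
    (D : TopologicalSpace.Opens C5) (hD : IsConnected (D : Set C5))
    (L : Fin 10 → C5 → ℂ) (hL : IsLogDet (D : Set C5) L) :
    -- 1. the decomposition, the differential, and the representations
    (IsCompl (WAR0 D L 1) (WAR0 D L 2) ∧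
      Module.finrank ℂ (WAR0 D L 1) = 20 ∧ Module.finrank ℂ (WAR0 D L 2) = 5 ∧
      Function.Injective (d0 D) ∧
      (WAR0 D L 1).map (d0 D) = WAR1 D L 0 ∧
      (WAR0 D L 2).map (d0 D) = AR1Sym D L ∧
      ∃ (ρ₁ : Representation ℂ WD5 (WAR0 D L 1)) (ρ₂ : Representation ℂ WD5 (WAR0 D L 2))
        (θ₁ : Representation ℂ WD5 (WAR1 D L 0)) (θ₂ : Representation ℂ WD5 (AR1Sym D L)),
        (∀ k (x : WAR0 D L 1), IsPullback0 D L 1 k x (ρ₁ (D5.simple k) x)) ∧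
        (∀ k (x : WAR0 D L 2), IsPullback0 D L 2 k x (ρ₂ (D5.simple k) x)) ∧
        (∀ k (η : WAR1 D L 0), IsPullback1 D L 0 k η (θ₁ (D5.simple k) η)) ∧
        (∀ k (η : AR1Sym D L), IsPullback1 D L 1 k η (θ₂ (D5.simple k) η)) ∧
        (∃ δ : WAR0 D L 1 ≃ₗ[ℂ] WAR1 D L 0,
          (∀ x, (δ x : Forms D) = d0 D x) ∧ ∀ g x, δ (ρ₁ g x) = θ₁ g (δ x)) ∧
        (∃ δ : WAR0 D L 2 ≃ₗ[ℂ] AR1Sym D L,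
          (∀ x, (δ x : Forms D) = d0 D x) ∧ ∀ g x, δ (ρ₂ g x) = θ₂ g (δ x)) ∧
        (∃ e : WAR0 D L 1 ≃ₗ[ℂ] V2_21,
          ∀ g x, (e (ρ₁ g x) : MvPolynomial (Fin 5) ℂ) = polyRep g (e x)) ∧
        (∃ e : WAR0 D L 2 ≃ₗ[ℂ] V0_221,
          ∀ g x, (e (ρ₂ g x) : MvPolynomial (Fin 5) ℂ) = polyRep g (e x))) ∧
    -- 2. the 3-subwebs
    ((∀ S : Finset (Fin 10), S.card = 3 → Module.finrank ℂ (subAR0 D S) ≤ 1) ∧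
      (∀ S : Finset (Fin 10), S.card = 3 →
        (Module.finrank ℂ (subAR0 D S) = 1 ↔ Set.InjOn base (S : Set (Fin 10)))) ∧
      {S : Finset (Fin 10) | S.card = 3 ∧ Module.finrank ℂ (subAR0 D S) = 1}.ncard = 80 ∧
      (∀ S : Finset (Fin 10), S.card = 3 → Module.finrank ℂ (subAR0 D S) = 1 →
        subAR0 D S ≤ WAR0 D L 1) ∧
      (⨆ S ∈ {S : Finset (Fin 10) | S.card = 3 ∧ Module.finrank ℂ (subAR0 D S) = 1},
        subAR0 D S) = WAR0 D L 1) ∧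
    -- 3. the ten relations of weight 2 and their residues
    ∃ c : Triple → Fin 10 → Pair → ℤ,
      (∀ t, IsAR1ijk D L t (c t) ∧ (∀ c', IsAR1ijk D L t c' → c' = c t ∨ c' = -c t)) ∧
      (∀ t, IsIdentity D L t (c t) ∧ (∀ c', IsIdentity D L t c' → c' = c t ∨ c' = -c t)) ∧
      (∀ t, ∃ x, IsLogClass D L (quad (c t)) x ∧ d0 D x = logForm D L (dquad (c t))) ∧
      Submodule.span ℂ {x | ∃ t, IsLogClass D L (quad (c t)) x} = WAR0 D L 2 ∧
      (∀ k t, logFun L (res k (quad (c t))) ∈ Z0 D) ∧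
      Submodule.span ℂ {x | ∃ k t, IsLogClass D L (res k (quad (c t))) x} = WAR0 D L 1 ∧
      Submodule.span ℂ {η | ∃ k t, η = logForm D L (resForm k (dquad (c t)))} =
        (WAR0 D L 1).map (d0 D) := by
  exact ⟨hL.structure_AR0 hD, hL.subwebs hD, hL.residues hD⟩
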